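/- Write $\Omega=\{0,1\}^{\mathbb Z}$, $\tau_x\eta(y)=\eta(x+y)$, and let $\eta^{x,x+1}$ be $\eta$ with the values at $x$ and $x+1$ interchanged. A function on $\Omega$ is local if it depends on finitely many coordinates only. Let $c:\Omega\to[0,\infty)$ be a local function with $c\ge\epsilon_0$ for some $\epsilon_0>0$ that does not depend on the coordinates $\eta(0),\eta(1)$, and put $c_y(\eta)=c(\tau_y\eta)$. Let $\mathcal R\subset\mathbb Z\setminus\{0\}$ be a finite set, and let $r_z:\Omega\to[0,\infty)$, $z\in\mathcal R$, be local functions. For $\lambda\in[0,1]$ let $\nu_\lambda$ be the Bernoulli product measure on $\Omega$ of density $\lambda$, and fix $\rho\in(0,1)$. For $n\ge 1$ let $(\eta^n_t,x^n_t)_{t\ge0}$ be the càdlàg Markov process on $\Omega\times\mathbb Z$, defined on a probability space with probability $\mathbb P_n$, started from $\eta^n_0\sim\nu_\rho$ and $x^n_0=0$, and generated by $$L_nf(\eta,x)=n^2\sum_{y\in\mathbb Z}c_y(\eta)\,[f(\eta^{y,y+1},x)-f(\eta,x)]+n\sum_{z\in\mathcal R}r_z(\tau_x\eta)\,[f(\eta,x+z)-f(\eta,x)]$$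 (that is, solving the martingale problem for $L_n$ on bounded functions $f$ on $\Omega\times\mathbb Z$ that depend on $\eta$ only through a finite set of coordinates). Let $\xi^n_t(y)=\eta^n_t(y+x^n_t)$ be the environment as seen by the walk. Let $\varphi:\mathbb R\to[0,\infty)$ be smooth with compact support in $(0,1)$ and $\int\varphi=1$, let $\varphi_\epsilon(u)=\epsilon^{-1}\varphi(u/\epsilon)$, and put $$(\xi\star\varphi_\epsilon)(x)=\frac1n\sum_{y\in\mathbb Z}\varphi_\epsilon\Big(\frac yn\Big)\,(\xi(x+y)-\rho).$$ **Theorem (Replacement lemma).** Let $\phi:\Omega\to\mathbb R$ be a local function and $\bar\phi(\lambda)=\int\phi\,d\nu_\lambda$ for $\lambda\in[0,1]$. Then $\bar\phi$ is differentiable at $\rho$ and, for every $\delta>0$ and every $t\ge0$, $$\limsup_{\epsilon\to0^+}\ \limsup_{n\to\infty}\ \mathbb P_n\Big(\Big|\sqrt n\int_0^t\big[\phi(\xi^n_s)-\bar\phi(\rho)-\bar\phi'(\rho)\,(\xi^n_s\star\varphi_\epsilon)(0)\big]\,ds\Big|>\delta\Big)=0.$$ -/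

import Mathlib

open MeasureTheory ProbabilityTheory Filter Topology
open scoped NNReal ENNReal

noncomputable section

namespace ExclusionWalk

/-- Particle configurations on `ℤ`: `η x = true` means that the site `x` is occupied. -/
abbrev Config : Type := ℤ → Bool

/-- The occupation number `η(x) ∈ {0, 1}` as a real number. -/
def occ (η : Config) (x : ℤ) : ℝ := if η x = true then 1 else 0

/-- The shift `(τ_x η)(y) = η(x + y)`. -/
def shift (x : ℤ) (η : Config) : Config := fun y => η (x + y)

/-- The configuration `η^{x,x+1}`, in which the values at `x` and `x + 1` are interchanged. -/
def swapAt (x : ℤ) (η : Config) : Config := fun z => η (Equiv.swap x (x + 1) z)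

/-- The support of `f` is contained in `A`. -/
def SupportedIn (f : Config → ℝ) (A : Set ℤ) : Prop :=
  ∀ η ξ : Config, (∀ x ∈ A, η x = ξ x) → f η = f ξ

/-- `f` is a local function. -/
def IsLocal (f : Config → ℝ) : Prop :=
  ∃ A : Set ℤ, A.Finite ∧ SupportedIn f A

/-- Hypotheses on the interaction rate `c` of the lattice gas: nonnegativity, finite range,
ellipticity and reversibility. -/
structure IsExchangeRate (c : Config → ℝ) : Prop where
  nonneg : ∀ η, 0 ≤ c η
  finiteRange : IsLocal c
  elliptic : ∃ ε₀ : ℝ, 0 < ε₀ ∧ ∀ η, ε₀ ≤ c η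
  reversible : SupportedIn c {x | x ≠ 0 ∧ x ≠ 1}

/-- Hypotheses on the jump set `R` and on the jump rates `r z`, `z ∈ R`, of the random walk. -/
structure IsJumpRate (R : Finset ℤ) (r : ℤ → Config → ℝ) : Prop where
  zero_notMem : (0 : ℤ) ∉ R
  nonneg : ∀ z ∈ R, ∀ η, 0 ≤ r z η
  isLocal : ∀ z ∈ R, IsLocal (r z)

/-- The Bernoulli product measure `ν_p` on configurations: the sites are independent, and each of
them is occupied with probability `p`. -/
def bernoulliProduct (p : unitInterval) : Measure Config :=
  Measure.infinitePi fun _ : ℤ => bernoulliMeasure true false p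

/-- The function `φ̄(p) = ∫ φ dν_p`, `p ∈ [0, 1]` (extended to a function on `ℝ` that is constant
to the left of `0` and to the right of `1`). -/
def meanUnder (φ : Config → ℝ) (p : ℝ) : ℝ :=
  ∫ η, φ η ∂bernoulliProduct (Set.projIcc 0 1 zero_le_one p)

/-- Test functions on `Config × ℤ`: bounded, and depending on the configuration only through a
finite set of sites. -/
def IsTestFunction (f : Config → ℤ → ℝ) : Prop :=
  (∃ A : Set ℤ, A.Finite ∧ ∀ x, SupportedIn (fun η => f η x) A) ∧
    ∃ C : ℝ, ∀ η x, |f η x| ≤ C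

/-- The generator `L_n` of the pair (lattice gas speeded up by `n²`, random walk speeded up by `n`)
on a test function. The sum over the bonds has only finitely many non-zero terms. -/
def generator (c : Config → ℝ) (R : Finset ℤ) (r : ℤ → Config → ℝ) (n : ℕ)
    (f : Config → ℤ → ℝ) (η : Config) (x : ℤ) : ℝ :=
  (n : ℝ) ^ 2 * ∑' y : ℤ, c (shift y η) * (f (swapAt y η) x - f η x) +
    (n : ℝ) * ∑ z ∈ R, r z (shift x η) * (f η (x + z) - f η x)

section Dynamics

variable {S : Type*} [mS : MeasurableSpace S]

/-- The canonical filtration `σ((η_s, x_s) : s ≤ t)` of the pair `(η, x)`. -/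
def canonicalFiltration (η : ℝ≥0 → S → Config) (x : ℝ≥0 → S → ℤ)
    (hη : ∀ t, Measurable (η t)) (hx : ∀ t, Measurable (x t)) : Filtration ℝ≥0 mS where
  seq t := ⨆ s ≤ t, (MeasurableSpace.comap (η s) inferInstance ⊔
    MeasurableSpace.comap (x s) inferInstance)
  mono' _ _ hst := biSup_mono fun _ hu => le_trans hu hst
  le' _ := iSup₂_le fun s _ => sup_le (hη s).comap_le (hx s).comap_le

/-- A path with values in a topological space is càdlàg: right-continuous with left limits. -/
def IsCadlag {E : Type*} [TopologicalSpace E] (u : ℝ≥0 → E) : Prop :=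
  ∀ t, ContinuousWithinAt u (Set.Ici t) t ∧ (0 < t → ∃ l, Tendsto u (𝓝[<] t) (𝓝 l))

/-- Under `P`, the pair `(η, x)` is the càdlàg Markov process generated by `generator c R r n`,
started from `ν_ρ` in the first component and from the origin in the second. It is given as the
solution of the martingale problem for this generator. -/
structure IsWalkInExclusion (c : Config → ℝ) (R : Finset ℤ) (r : ℤ → Config → ℝ)
    (ρ : unitInterval) (n : ℕ) (P : Measure S)
    (η : ℝ≥0 → S → Config) (x : ℝ≥0 → S → ℤ) : Prop where
  measurable_env : ∀ t, Measurable (η t)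
  measurable_walk : ∀ t, Measurable (x t)
  cadlag_env : ∀ ω, IsCadlag fun t => η t ω
  cadlag_walk : ∀ ω, IsCadlag fun t => x t ω
  law_env_zero : P.map (η 0) = bernoulliProduct ρ
  walk_zero : ∀ᵐ ω ∂P, x 0 ω = 0
  martingale : ∀ f : Config → ℤ → ℝ, IsTestFunction f →
    Martingale
      (fun (t : ℝ≥0) (ω : S) => f (η t ω) (x t ω) - f (η 0 ω) (x 0 ω) -
        ∫ s in (0 : ℝ)..t, generator c R r n f (η s.toNNReal ω) (x s.toNNReal ω))
      (canonicalFiltration η x measurable_env measurable_walk) P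

/-- The environment as seen by the walk, `ξ_t(y) = η_t(y + x_t)`. -/
def environment (η : ℝ≥0 → S → Config) (x : ℝ≥0 → S → ℤ) (t : ℝ≥0) (ω : S) : Config :=
  fun y => η t ω (y + x t ω)

end Dynamics

/-- The hypotheses on the mollifier: smooth, nonnegative, compactly supported in `(0, 1)`, of
integral one. -/
structure IsMollifier (φ : ℝ → ℝ) : Prop where
  smooth : ContDiff ℝ (⊤ : ℕ∞) φ
  nonneg : ∀ u, 0 ≤ φ u
  hasCompactSupport : HasCompactSupport φ
  tsupport_subset : tsupport φ ⊆ Set.Ioo 0 1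
  integral_eq_one : ∫ u, φ u = 1

/-- The rescaled function `φ_ε(u) = ε⁻¹ φ(u / ε)`. -/
def rescale (φ : ℝ → ℝ) (ε : ℝ) (u : ℝ) : ℝ := ε⁻¹ * φ (u / ε)

/-- The discrete convolution at scale `n`,
`(ξ ⋆ ψ)(x) = (1 / n) ∑_y ψ(y / n) (ξ(x + y) - ρ)`; for `ψ` of compact support and `n ≥ 1`
the sum has only finitely many non-zero terms. -/
def convolve (ρ : ℝ) (n : ℕ) (ξ : Config) (ψ : ℝ → ℝ) (x : ℤ) : ℝ :=
  (1 / (n : ℝ)) * ∑' y : ℤ, ψ ((y : ℝ) / n) * (occ ξ (x + y) - ρ)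

end ExclusionWalk

end

/-!
The time integral is controlled without comparing the process with a stationary one: the walk is
not assumed to leave any measure of the environment invariant, so `ν_ρ` only serves as a reference
measure. The main points are the following.

* **Energy estimate** (`exists_energy_estimate`). In `L²(ν_ρ)` the exchange dynamics is reversible
  and dissipates `ε₀ n²` times the Dirichlet form. The jumps of the walk contribute at most
  `(n / 2) ∑_z ∫ (r_z ∘ τ_{-z} - r_z) F² dν_ρ`. A translation of a local function is a composition
  of finitely many nearest-neighbour exchanges, under which `ν_ρ` is invariant, so this is at most
  a constant times `n √(dirichlet F) ‖F‖`, which Young's inequality absorbs into the Dirichlet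
  form at the price `C ‖F‖²`, with `C` independent of `n`. A potential `K √n W` with an `H₋₁`
  bound `b` (`HMinusOneBound`) is absorbed in the same way at the price `K² b² / (4 ε₀ n)`.

* **From the quadratic form to the process** (`abs_integral_fkWeight_le`). The measures
  `m_t(g) = E[exp(∫₀ᵗ V(ξ_s) ds) g(ξ_t)]` solve the forward equation `∂ₜ m_t(g) = m_t(L g + V g)`
  for local `g`; this is all that the martingale problem gives, and no semigroup is available. For
  the density of `m_t` in a finite box, the time derivative of the squared `L²(ν_ρ)` norm is
  bounded by the quadratic form plus a boundary term, and the latter is controlled by the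
  increment of the squared norm between two boxes whose sizes differ by a constant
  (`exists_integral_generator_density_le`). Since these norms grow at most exponentially in the
  size of the box, the resulting hierarchy of differential inequalities can be iterated, and the
  boundary term disappears (`le_exp_of_hierarchy`). This gives `|m_t(g)| ≤ e^{(Γ + 1) t} ‖g‖` if
  the form of `L + V` is bounded by `Γ`. With `V = ±K √n W` one gets an exponential moment of the
  time integral of `W`, and with `V = 0` a bound on its first moment (`prob_abs_integral_gt_le`).

* **Decomposition** (`Replaceable`). A local function is a linear combination of the monomials
  `∏_{x ∈ B} (η(x) - ρ)`, whose mean under `ν_p` is `(p - ρ)^|B|`. The constant cancels against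
  `φ̄(ρ)`. A monomial of degree one is compared with the convolution by moving the particle to a
  site at distance at most `ε n`, which telescopes into exchanges and has a squared `H₋₁` bound of
  order `ε n`. In a monomial of degree at least two, the leftmost and the rightmost factor are
  replaced by averages over `ε n` sites to the left and to the right; the result has `L²(ν_ρ)`
  norm of order `1 / (ε n) = o(1 / √n)`.

The exponential Chebyshev inequality then bounds the probability by
`2 exp(-K δ / 2 + (C + O(K² ε) + 1) t) + o(1)`, and one lets `n → ∞`, `ε → 0` and `K → ∞` in this
order.
-/

namespace ExclusionWalk

noncomputable section

/-! ### Local functions -/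

lemma SupportedIn.mono {f : Config → ℝ} {A B : Set ℤ} (hf : SupportedIn f A) (h : A ⊆ B) :
    SupportedIn f B := fun η ξ hηξ => hf η ξ fun x hx => hηξ x (h hx)

lemma SupportedIn.comp₂ {f g : Config → ℝ} {A : Set ℤ} (hf : SupportedIn f A)
    (hg : SupportedIn g A) (F : ℝ → ℝ → ℝ) : SupportedIn (fun η => F (f η) (g η)) A :=
  fun η ξ h => by simp only [hf η ξ h, hg η ξ h]

/-- Relabelling the sites by `e` moves the support of a function by `e`. -/
lemma SupportedIn.comp_map {f : Config → ℝ} {A : Set ℤ} (hf : SupportedIn f A) (e : ℤ → ℤ) :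
    SupportedIn (fun η => f (fun y => η (e y))) (e '' A) :=
  fun _ _ h => hf _ _ fun x hx => h (e x) ⟨x, hx, rfl⟩

lemma SupportedIn.comp_swapAt {f : Config → ℝ} {A : Set ℤ} (hf : SupportedIn f A) (y : ℤ) :
    SupportedIn (fun η => f (swapAt y η)) (Equiv.swap y (y + 1) '' A) :=
  hf.comp_map _

lemma SupportedIn.comp_shift {f : Config → ℝ} {A : Set ℤ} (hf : SupportedIn f A) (z : ℤ) :
    SupportedIn (fun η => f (shift z η)) ((fun y => z + y) '' A) :=
  hf.comp_map _

lemma SupportedIn.isLocal {f : Config → ℝ} {A : Finset ℤ} (hf : SupportedIn f A) : IsLocal f :=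
  ⟨A, A.finite_toSet, hf⟩

lemma isLocal_const (a : ℝ) : IsLocal fun _ => a := ⟨∅, Set.finite_empty, fun _ _ _ => rfl⟩

lemma isLocal_occ (x : ℤ) : IsLocal fun η => occ η x :=
  ⟨{x}, Set.finite_singleton x, fun η ξ h => by simp only [occ, h x rfl]⟩

lemma IsLocal.comp₂ {f g : Config → ℝ} (hf : IsLocal f) (hg : IsLocal g) (F : ℝ → ℝ → ℝ) :
    IsLocal fun η => F (f η) (g η) := by
  obtain ⟨A, hA, hfA⟩ := hf
  obtain ⟨B, hB, hgB⟩ := hg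
  exact ⟨A ∪ B, hA.union hB, (hfA.mono Set.subset_union_left).comp₂
    (hgB.mono Set.subset_union_right) F⟩

lemma IsLocal.comp {f : Config → ℝ} (hf : IsLocal f) (F : ℝ → ℝ) : IsLocal fun η => F (f η) :=
  hf.comp₂ hf fun a _ => F a

lemma IsLocal.add {f g : Config → ℝ} (hf : IsLocal f) (hg : IsLocal g) :
    IsLocal fun η => f η + g η := hf.comp₂ hg (· + ·)

lemma IsLocal.sub {f g : Config → ℝ} (hf : IsLocal f) (hg : IsLocal g) :
    IsLocal fun η => f η - g η := hf.comp₂ hg (· - ·)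

lemma IsLocal.mul {f g : Config → ℝ} (hf : IsLocal f) (hg : IsLocal g) :
    IsLocal fun η => f η * g η := hf.comp₂ hg (· * ·)

lemma IsLocal.const_mul {f : Config → ℝ} (hf : IsLocal f) (a : ℝ) :
    IsLocal fun η => a * f η := hf.comp (a * ·)

lemma IsLocal.pow {f : Config → ℝ} (hf : IsLocal f) (k : ℕ) :
    IsLocal fun η => f η ^ k := hf.comp (· ^ k)

lemma IsLocal.swapAt {f : Config → ℝ} (hf : IsLocal f) (y : ℤ) :
    IsLocal fun η => f (swapAt y η) := by
  obtain ⟨A, hA, hfA⟩ := hf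
  exact ⟨_, hA.image _, hfA.comp_swapAt y⟩

lemma IsLocal.shift {f : Config → ℝ} (hf : IsLocal f) (z : ℤ) :
    IsLocal fun η => f (shift z η) := by
  obtain ⟨A, hA, hfA⟩ := hf
  exact ⟨_, hA.image _, hfA.comp_shift z⟩

lemma isLocal_finsetSum {ι : Type*} (s : Finset ι) {f : ι → Config → ℝ}
    (hf : ∀ i ∈ s, IsLocal (f i)) : IsLocal fun η => ∑ i ∈ s, f i η := by
  classical
  induction s using Finset.induction_on with
  | empty => simpa using isLocal_const 0
  | insert a s ha ih =>
    simp only [Finset.sum_insert ha]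
    exact (hf a (by simp)).add (ih fun i hi => hf i (by simp [hi]))

lemma isLocal_finsetProd {ι : Type*} (s : Finset ι) {f : ι → Config → ℝ}
    (hf : ∀ i ∈ s, IsLocal (f i)) : IsLocal fun η => ∏ i ∈ s, f i η := by
  classical
  induction s using Finset.induction_on with
  | empty => simpa using isLocal_const 1
  | insert a s ha ih =>
    simp only [Finset.prod_insert ha]
    exact (hf a (by simp)).mul (ih fun i hi => hf i (by simp [hi]))

/-- The configuration that agrees with the pattern `σ` on `Λ` and is empty elsewhere. -/
def extend (Λ : Finset ℤ) (σ : Λ → Bool) : Config := fun x => if h : x ∈ Λ then σ ⟨x, h⟩ else false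

lemma extend_restrict {Λ : Finset ℤ} (η : Config) {x : ℤ} (hx : x ∈ Λ) :
    extend Λ (Λ.restrict η) x = η x := by simp [extend, hx]

lemma SupportedIn.eq_extend {f : Config → ℝ} {Λ : Finset ℤ} (hf : SupportedIn f Λ) (η : Config) :
    f η = f (extend Λ (Λ.restrict η)) :=
  hf _ _ fun _ hx => (extend_restrict η (by simpa using hx)).symm

lemma IsLocal.exists_finset {f : Config → ℝ} (hf : IsLocal f) :
    ∃ Λ : Finset ℤ, SupportedIn f Λ := by
  obtain ⟨A, hA, hf⟩ := hf
  exact ⟨hA.toFinset, by simpa using hf⟩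

lemma IsLocal.continuous {f : Config → ℝ} (hf : IsLocal f) : Continuous f := by
  obtain ⟨Λ, hΛ⟩ := hf.exists_finset
  have : f = (fun σ : Λ → Bool => f (extend Λ σ)) ∘ Λ.restrict := funext hΛ.eq_extend
  rw [this]
  refine continuous_of_discreteTopology.comp ?_
  exact continuous_pi fun i => continuous_apply _

lemma IsLocal.measurable {f : Config → ℝ} (hf : IsLocal f) : Measurable f := by
  obtain ⟨Λ, hΛ⟩ := hf.exists_finset
  have : f = (fun σ : Λ → Bool => f (extend Λ σ)) ∘ Λ.restrict := funext hΛ.eq_extend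
  rw [this]
  exact (measurable_of_finite _).comp (Finset.measurable_restrict Λ)

lemma IsLocal.exists_bound {f : Config → ℝ} (hf : IsLocal f) :
    ∃ C : ℝ, 0 ≤ C ∧ ∀ η, |f η| ≤ C := by
  obtain ⟨Λ, hΛ⟩ := hf.exists_finset
  refine ⟨∑ σ : Λ → Bool, |f (extend Λ σ)|, Finset.sum_nonneg fun _ _ => abs_nonneg _,
    fun η => ?_⟩
  rw [hΛ.eq_extend η]
  exact Finset.single_le_sum (f := fun σ : Λ → Bool => |f (extend Λ σ)|)
    (fun _ _ => abs_nonneg _) (Finset.mem_univ _)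

lemma IsLocal.integrable {f : Config → ℝ} (hf : IsLocal f) (μ : Measure Config)
    [IsFiniteMeasure μ] : Integrable f μ := by
  obtain ⟨C, _, hC⟩ := hf.exists_bound
  exact Integrable.of_bound hf.measurable.aestronglyMeasurable C (ae_of_all _ hC)

/-- The function `1{η = σ on Λ}`. -/
def patternFun (Λ : Finset ℤ) (σ : Λ → Bool) (η : Config) : ℝ :=
  if Λ.restrict η = σ then 1 else 0

lemma supportedIn_patternFun (Λ : Finset ℤ) (σ : Λ → Bool) :
    SupportedIn (patternFun Λ σ) Λ := fun η ξ h => by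
  have : Λ.restrict η = Λ.restrict ξ := funext fun x => h x x.2
  simp only [patternFun, this]

lemma SupportedIn.eq_sum_patternFun {f : Config → ℝ} {Λ : Finset ℤ} (hf : SupportedIn f Λ)
    (η : Config) : f η = ∑ σ : Λ → Bool, f (extend Λ σ) * patternFun Λ σ η := by
  rw [hf.eq_extend η]
  simp [patternFun]

/-! ### The Bernoulli product measure -/

instance (p : unitInterval) : IsProbabilityMeasure (bernoulliProduct p) := by
  unfold bernoulliProduct; infer_instance

lemma measurePreserving_relabel (p : unitInterval) (e : Equiv.Perm ℤ) :
    MeasurePreserving (fun η : Config => fun y => η (e y)) (bernoulliProduct p)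
      (bernoulliProduct p) := by
  refine ⟨measurable_pi_lambda _ fun y => measurable_pi_apply _, ?_⟩
  have h := Measure.infinitePi_map_piCongrLeft (X := fun _ : ℤ => Bool)
    (fun _ : ℤ => bernoulliMeasure true false p) e.symm
  unfold bernoulliProduct
  convert h using 2
  ext η y
  simp only [MeasurableEquiv.coe_piCongrLeft]
  have := Equiv.piCongrLeft_apply_apply (P := fun _ : ℤ => Bool) e.symm η (e y)
  simpa using this.symm

lemma integral_relabel (p : unitInterval) (e : Equiv.Perm ℤ) {f : Config → ℝ} (hf : IsLocal f) :
    ∫ η, f (fun y => η (e y)) ∂bernoulliProduct p = ∫ η, f η ∂bernoulliProduct p := by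
  have h := measurePreserving_relabel p e
  conv_rhs => rw [← h.map_eq]
  rw [integral_map h.measurable.aemeasurable hf.measurable.aestronglyMeasurable]

lemma integral_swapAt (p : unitInterval) (y : ℤ) {f : Config → ℝ} (hf : IsLocal f) :
    ∫ η, f (swapAt y η) ∂bernoulliProduct p = ∫ η, f η ∂bernoulliProduct p :=
  integral_relabel p (Equiv.swap y (y + 1)) hf

lemma integral_shift (p : unitInterval) (z : ℤ) {f : Config → ℝ} (hf : IsLocal f) :
    ∫ η, f (shift z η) ∂bernoulliProduct p = ∫ η, f η ∂bernoulliProduct p :=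
  integral_relabel p (Equiv.addLeft z) hf

lemma integral_prod_site (p : unitInterval) (B : Finset ℤ) (g : ℤ → Bool → ℝ) :
    ∫ η : Config, ∏ x ∈ B, g x (η x) ∂bernoulliProduct p
      = ∏ x ∈ B, ((p : ℝ) * g x true + (1 - (p : ℝ)) * g x false) := by
  have h := integral_restrict_infinitePi (μ := fun _ : ℤ => bernoulliMeasure true false p)
    (s := B) (f := fun σ : B → Bool => ∏ x : B, g x (σ x))
    (measurable_of_finite _).aestronglyMeasurable
  have h2 : ∀ η : Config, ∏ x : B, g x (B.restrict η x) = ∏ x ∈ B, g x (η x) := fun η => by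
    rw [← Finset.prod_coe_sort B fun x => g x (η x)]; rfl
  simp only [h2] at h
  rw [bernoulliProduct, h, integral_fintype_prod_eq_prod (fun (x : B) b => g x b),
    ← Finset.prod_coe_sort B]
  refine Finset.prod_congr rfl fun x _ => ?_
  rw [integral_bernoulliMeasure]
  simp

/-- The weight `ν_p(η = σ on Λ)` of a pattern. -/
lemma integral_patternFun (p : unitInterval) (Λ : Finset ℤ) (σ : Λ → Bool) :
    ∫ η, patternFun Λ σ η ∂bernoulliProduct p
      = ∏ x : Λ, if σ x = true then (p : ℝ) else 1 - p := by
  have h := integral_prod_site p Λ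
    (fun x b => if b = extend Λ σ x then 1 else 0)
  have h2 : ∀ η : Config, ∏ x ∈ Λ, (if η x = extend Λ σ x then (1 : ℝ) else 0)
      = patternFun Λ σ η := fun η => by
    rw [Finset.prod_ite_zero]
    simp only [Finset.prod_const_one, patternFun]
    congr 1
    simp only [funext_iff, extend, eq_iff_iff]
    constructor
    · intro h x; simpa using h x x.2
    · intro h x hx; simpa [hx] using h ⟨x, hx⟩
  simp only [h2] at h
  rw [h, ← Finset.prod_coe_sort Λ]
  refine Finset.prod_congr rfl fun x _ => ?_
  have : extend Λ σ x = σ x := by simp [extend]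
  rw [this]
  cases σ x <;> simp

lemma pow_le_integral_patternFun (p : unitInterval) (Λ : Finset ℤ) (σ : Λ → Bool) :
    min (p : ℝ) (1 - p) ^ Λ.card ≤ ∫ η, patternFun Λ σ η ∂bernoulliProduct p := by
  rw [integral_patternFun, ← Finset.card_attach, ← Finset.prod_const]
  refine Finset.prod_le_prod (fun _ _ => le_min p.2.1 (by linarith [p.2.2])) fun x _ => ?_
  split_ifs
  · exact min_le_left _ _
  · exact min_le_right _ _

/-! ### Dirichlet form and `H₋₁` bounds -/

/-- The squared norm of `F` in `L²(ν_p)`. -/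
def sqNorm (p : unitInterval) (F : Config → ℝ) : ℝ := ∫ η, F η ^ 2 ∂bernoulliProduct p

/-- The Dirichlet form of the exclusion process with exchange rate `1` (without the factor `1/2`);
for local `F` only finitely many terms are non-zero. -/
def dirichlet (p : unitInterval) (F : Config → ℝ) : ℝ :=
  ∑' y : ℤ, ∫ η, (F (swapAt y η) - F η) ^ 2 ∂bernoulliProduct p

/-- `V` defines, by `F ↦ ∫ V F² dν_p`, a functional controlled by the geometric mean of
`dirichlet p F` and `sqNorm p F`, with constant `b`. The constant plays the role of the `H₋₁` norm
of `V` with respect to the exclusion dynamics. -/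
def HMinusOneBound (p : unitInterval) (V : Config → ℝ) (b : ℝ) : Prop :=
  ∀ F : Config → ℝ, IsLocal F →
    |∫ η, V η * F η ^ 2 ∂bernoulliProduct p| ≤ b * (√(dirichlet p F) * √(sqNorm p F))

lemma swapAt_swapAt (y : ℤ) (η : Config) : swapAt y (swapAt y η) = η := by
  funext z; simp [swapAt]

/-- The bonds `{y, y + 1}` that meet `Λ`. -/
def bonds (Λ : Finset ℤ) : Finset ℤ := Λ ∪ Λ.image (· - 1)

lemma SupportedIn.swapAt_eq {F : Config → ℝ} {Λ : Finset ℤ} (hF : SupportedIn F Λ) {y : ℤ}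
    (hy : y ∉ bonds Λ) (η : Config) : F (swapAt y η) = F η := by
  refine hF _ _ fun x hx => ?_
  have h1 : x ≠ y := by
    rintro rfl
    exact hy (Finset.mem_union_left _ (by simpa using hx))
  have h2 : x ≠ y + 1 := by
    rintro rfl
    exact hy (Finset.mem_union_right _ (Finset.mem_image.2 ⟨y + 1, by simpa using hx, by ring⟩))
  simp [swapAt, Equiv.swap_apply_of_ne_of_ne h1 h2]

lemma sqNorm_nonneg (p : unitInterval) (F : Config → ℝ) : 0 ≤ sqNorm p F :=
  integral_nonneg fun _ => sq_nonneg _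

lemma sqNorm_swapAt (p : unitInterval) {F : Config → ℝ} (hF : IsLocal F) (y : ℤ) :
    sqNorm p (fun η => F (swapAt y η)) = sqNorm p F :=
  integral_swapAt p y (hF.pow 2)

lemma sqNorm_shift (p : unitInterval) {F : Config → ℝ} (hF : IsLocal F) (z : ℤ) :
    sqNorm p (fun η => F (shift z η)) = sqNorm p F :=
  integral_shift p z (hF.pow 2)

lemma dirichlet_eq_sum (p : unitInterval) {F : Config → ℝ} {Λ T : Finset ℤ}
    (hF : SupportedIn F Λ) (hT : bonds Λ ⊆ T) :
    dirichlet p F = ∑ y ∈ T, ∫ η, (F (swapAt y η) - F η) ^ 2 ∂bernoulliProduct p := by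
  refine tsum_eq_sum fun y hy => ?_
  have : ∀ η, F (swapAt y η) - F η = 0 := fun η => by
    rw [hF.swapAt_eq (fun h => hy (hT h)) η, sub_self]
  simp [this]

lemma sum_le_dirichlet (p : unitInterval) {F : Config → ℝ} (hF : IsLocal F) (T : Finset ℤ) :
    ∑ y ∈ T, ∫ η, (F (swapAt y η) - F η) ^ 2 ∂bernoulliProduct p ≤ dirichlet p F := by
  obtain ⟨Λ, hΛ⟩ := hF.exists_finset
  rw [dirichlet_eq_sum p hΛ (T := bonds Λ ∪ T) Finset.subset_union_left]
  exact Finset.sum_le_sum_of_subset_of_nonneg Finset.subset_union_right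
    fun _ _ _ => integral_nonneg fun _ => sq_nonneg _

lemma dirichlet_nonneg (p : unitInterval) (F : Config → ℝ) : 0 ≤ dirichlet p F :=
  tsum_nonneg fun _ => integral_nonneg fun _ => sq_nonneg _

/-- The Cauchy–Schwarz inequality for local functions. -/
lemma abs_integral_mul_le (p : unitInterval) {f g : Config → ℝ} (hf : IsLocal f)
    (hg : IsLocal g) :
    |∫ η, f η * g η ∂bernoulliProduct p| ≤ √(sqNorm p f) * √(sqNorm p g) := by
  have key : ∀ x : ℝ, 0 ≤ sqNorm p f * (x * x)
      + 2 * (∫ η, f η * g η ∂bernoulliProduct p) * x + sqNorm p g := fun x => by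
    have h : ∫ η, (x * f η + g η) ^ 2 ∂bernoulliProduct p
        = sqNorm p f * (x * x) + 2 * (∫ η, f η * g η ∂bernoulliProduct p) * x + sqNorm p g := by
      have e : ∀ η, (x * f η + g η) ^ 2
          = (x * x) * f η ^ 2 + 2 * x * (f η * g η) + g η ^ 2 := fun η => by ring
      simp_rw [e]
      rw [integral_add (((hf.pow 2).const_mul _).add ((hf.mul hg).const_mul _)|>.integrable _)
        ((hg.pow 2).integrable _), integral_add (((hf.pow 2).const_mul _).integrable _)
        (((hf.mul hg).const_mul _).integrable _), integral_const_mul, integral_const_mul]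
      simp only [sqNorm]; ring
    rw [← h]
    exact integral_nonneg fun _ => sq_nonneg _
  have hd := discrim_le_zero key
  rw [discrim] at hd
  rw [← Real.sqrt_mul (sqNorm_nonneg p f)]
  refine Real.abs_le_sqrt ?_
  nlinarith

lemma HMinusOneBound.add {p : unitInterval} {V W : Config → ℝ} {a b : ℝ} (hV : IsLocal V)
    (hW : IsLocal W) (ha : HMinusOneBound p V a) (hb : HMinusOneBound p W b) :
    HMinusOneBound p (fun η => V η + W η) (a + b) := fun F hF => by
  simp_rw [add_mul]
  rw [integral_add ((hV.mul (hF.pow 2)).integrable _) ((hW.mul (hF.pow 2)).integrable _)]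
  exact (abs_add_le _ _).trans (add_le_add (ha F hF) (hb F hF))

lemma HMinusOneBound.const_mul {p : unitInterval} {V : Config → ℝ} {b : ℝ}
    (hb : HMinusOneBound p V b) (a : ℝ) :
    HMinusOneBound p (fun η => a * V η) (|a| * b) := fun F hF => by
  simp_rw [mul_assoc a]
  rw [integral_const_mul, abs_mul, mul_assoc]
  exact mul_le_mul_of_nonneg_left (hb F hF) (abs_nonneg _)

lemma HMinusOneBound.mono {p : unitInterval} {V : Config → ℝ} {a b : ℝ}
    (ha : HMinusOneBound p V a) (hab : a ≤ b) : HMinusOneBound p V b := fun F hF =>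
  (ha F hF).trans (mul_le_mul_of_nonneg_right hab (by positivity))

lemma HMinusOneBound.zero (p : unitInterval) : HMinusOneBound p (fun _ => 0) 0 := fun F _ => by
  simp

lemma HMinusOneBound.finsetSum {p : unitInterval} {ι : Type*} (s : Finset ι)
    {V : ι → Config → ℝ} {b : ι → ℝ} (hV : ∀ i ∈ s, IsLocal (V i))
    (hb : ∀ i ∈ s, HMinusOneBound p (V i) (b i)) :
    HMinusOneBound p (fun η => ∑ i ∈ s, V i η) (∑ i ∈ s, b i) := by
  classical
  induction s using Finset.induction_on with
  | empty => simpa using HMinusOneBound.zero p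
  | insert a s ha ih =>
    simp only [Finset.sum_insert ha]
    exact (hb a (by simp)).add (hV a (by simp))
      (isLocal_finsetSum s fun i hi => hV i (by simp [hi]))
      (ih (fun i hi => hV i (by simp [hi])) fun i hi => hb i (by simp [hi]))

/-- Integration by parts along one bond: if `w` changes sign under the exchange at `y`, then
`∫ w F²` only involves the increment of `F` at that bond. -/
lemma abs_integral_antisymm_le (p : unitInterval) {w F : Config → ℝ} {b : ℝ} {y : ℤ}
    (hw : IsLocal w) (hF : IsLocal F) (hanti : ∀ η, w (swapAt y η) = -w η) (hb : ∀ η, |w η| ≤ b) :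
    |∫ η, w η * F η ^ 2 ∂bernoulliProduct p|
      ≤ b * (√(∫ η, (F (swapAt y η) - F η) ^ 2 ∂bernoulliProduct p) * √(sqNorm p F)) := by
  have hb0 : 0 ≤ b := (abs_nonneg _).trans (hb fun _ => false)
  have hd := (hF.swapAt y).sub hF
  have ha := (hF.swapAt y).add hF
  have h1 : ∫ η, w η * F η ^ 2 ∂bernoulliProduct p
      = -∫ η, w η * F (swapAt y η) ^ 2 ∂bernoulliProduct p := by
    rw [← integral_swapAt p y (hw.mul (hF.pow 2)), ← integral_neg]
    simp_rw [hanti, neg_mul]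
  have h2 : ∫ η, w η * F η ^ 2 ∂bernoulliProduct p
      = -(1 / 2) * ∫ η, (w η * (F (swapAt y η) - F η)) * (F (swapAt y η) + F η)
        ∂bernoulliProduct p := by
    have e : ∀ η, (w η * (F (swapAt y η) - F η)) * (F (swapAt y η) + F η)
        = w η * F (swapAt y η) ^ 2 - w η * F η ^ 2 := fun η => by ring
    simp_rw [e]
    rw [integral_sub ((hw.mul ((hF.swapAt y).pow 2)).integrable _)
      ((hw.mul (hF.pow 2)).integrable _)]
    linarith
  have h3 : sqNorm p (fun η => w η * (F (swapAt y η) - F η))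
      ≤ b ^ 2 * ∫ η, (F (swapAt y η) - F η) ^ 2 ∂bernoulliProduct p := by
    rw [sqNorm, ← integral_const_mul]
    refine integral_mono (((hw.mul hd).pow 2).integrable _) (((hd.pow 2).const_mul _).integrable _)
      fun η => ?_
    simp only [mul_pow]
    refine mul_le_mul_of_nonneg_right ?_ (sq_nonneg _)
    rw [← sq_abs]
    exact pow_le_pow_left₀ (abs_nonneg _) (hb η) 2
  have h4 : sqNorm p (fun η => F (swapAt y η) + F η) ≤ 2 ^ 2 * sqNorm p F := by
    calc sqNorm p (fun η => F (swapAt y η) + F η)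
        ≤ ∫ η, (2 * F (swapAt y η) ^ 2 + 2 * F η ^ 2) ∂bernoulliProduct p := by
          refine integral_mono ((ha.pow 2).integrable _)
            (((((hF.swapAt y).pow 2).const_mul 2).add ((hF.pow 2).const_mul 2)).integrable _)
            fun η => ?_
          simp only
          nlinarith [sq_nonneg (F (swapAt y η) - F η)]
      _ = 2 ^ 2 * sqNorm p F := by
          rw [integral_add ((((hF.swapAt y).pow 2).const_mul 2).integrable _)
            (((hF.pow 2).const_mul 2).integrable _), integral_const_mul, integral_const_mul,
            integral_swapAt p y (hF.pow 2)]
          simp only [sqNorm]; ring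
  rw [h2, abs_mul, abs_neg, abs_of_pos (by norm_num : (0 : ℝ) < 1 / 2)]
  have h5 := abs_integral_mul_le p (hw.mul hd) ha
  have h6 := Real.sqrt_le_sqrt h3
  have h7 := Real.sqrt_le_sqrt h4
  rw [Real.sqrt_mul (sq_nonneg _), Real.sqrt_sq hb0] at h6
  rw [Real.sqrt_mul (sq_nonneg _), Real.sqrt_sq (by norm_num)] at h7
  have h8 := mul_le_mul h6 h7 (Real.sqrt_nonneg _) (by positivity)
  linarith

/-- A sum of functions that are antisymmetric under the exchange at one bond each, the bonds being
different, has an `H₋₁` bound given by the `ℓ²` norm of their suprema. -/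
lemma hMinusOneBound_sum_antisymm (p : unitInterval) (T : Finset ℤ) {w : ℤ → Config → ℝ}
    {b : ℤ → ℝ} (hw : ∀ y ∈ T, IsLocal (w y)) (hanti : ∀ y ∈ T, ∀ η, w y (swapAt y η) = -w y η)
    (hb : ∀ y ∈ T, ∀ η, |w y η| ≤ b y) :
    HMinusOneBound p (fun η => ∑ y ∈ T, w y η) (√(∑ y ∈ T, b y ^ 2)) := fun F hF => by
  simp_rw [Finset.sum_mul]
  rw [integral_finsetSum _ fun y hy => ((hw y hy).mul (hF.pow 2)).integrable _]
  calc |∑ y ∈ T, ∫ η, w y η * F η ^ 2 ∂bernoulliProduct p|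
      ≤ ∑ y ∈ T, |∫ η, w y η * F η ^ 2 ∂bernoulliProduct p| := Finset.abs_sum_le_sum_abs _ _
    _ ≤ ∑ y ∈ T, b y * (√(∫ η, (F (swapAt y η) - F η) ^ 2 ∂bernoulliProduct p)
          * √(sqNorm p F)) := Finset.sum_le_sum fun y hy =>
        abs_integral_antisymm_le p (hw y hy) hF (hanti y hy) (hb y hy)
    _ = (∑ y ∈ T, b y * √(∫ η, (F (swapAt y η) - F η) ^ 2 ∂bernoulliProduct p))
          * √(sqNorm p F) := by simp_rw [← mul_assoc, Finset.sum_mul]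
    _ ≤ (√(∑ y ∈ T, b y ^ 2) * √(dirichlet p F)) * √(sqNorm p F) := by
        refine mul_le_mul_of_nonneg_right ?_ (Real.sqrt_nonneg _)
        refine (Real.sum_mul_le_sqrt_mul_sqrt _ _ _).trans ?_
        refine mul_le_mul_of_nonneg_left (Real.sqrt_le_sqrt ?_) (Real.sqrt_nonneg _)
        simp_rw [Real.sq_sqrt (integral_nonneg fun _ => sq_nonneg _ : (0 : ℝ) ≤
          ∫ η, (F (swapAt _ η) - F η) ^ 2 ∂bernoulliProduct p)]
        exact sum_le_dirichlet p hF T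
    _ = _ := mul_assoc _ _ _

lemma exists_hMinusOneBound_swapAt (p : unitInterval) {g : Config → ℝ} (hg : IsLocal g) (y : ℤ) :
    ∃ b, HMinusOneBound p (fun η => g (swapAt y η) - g η) b := by
  have hl := (hg.swapAt y).sub hg
  obtain ⟨C, _, hC⟩ := hl.exists_bound
  have h := hMinusOneBound_sum_antisymm p {y}
    (w := fun y η => g (swapAt y η) - g η) (b := fun _ => C) (by simpa using hl)
    (by simp [swapAt_swapAt]) (by simpa using hC)
  simp only [Finset.sum_singleton] at h
  exact ⟨_, h⟩

/-- The configuration obtained by the successive exchanges at `a, a + 1, …, a + k - 1`. It shifts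
the values at `a + 1, …, a + k` by one site to the left. -/
def sweep (a : ℤ) : ℕ → Config → Config
  | 0, η => η
  | k + 1, η => swapAt (a + k) (sweep a k η)

lemma sweep_apply_of_gt (a : ℤ) (k : ℕ) (η : Config) {y : ℤ} (hy : a + k < y) :
    sweep a k η y = η y := by
  induction k generalizing y with
  | zero => rfl
  | succ k ih =>
    push_cast at hy
    simp only [sweep, swapAt]
    rw [Equiv.swap_apply_of_ne_of_ne (by omega) (by omega), ih (by omega)]

lemma sweep_apply_of_mem (a : ℤ) (k : ℕ) (η : Config) {y : ℤ} (h1 : a ≤ y) (h2 : y < a + k) :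
    sweep a k η y = η (1 + y) := by
  induction k with
  | zero => simp at h2; omega
  | succ k ih =>
    push_cast at h2
    simp only [sweep, swapAt]
    rcases eq_or_ne y (a + k) with rfl | h
    · rw [Equiv.swap_apply_left, sweep_apply_of_gt _ _ _ (by omega), add_comm]
    · rw [Equiv.swap_apply_of_ne_of_ne h (by omega), ih (by omega)]

lemma exists_hMinusOneBound_sweep (p : unitInterval) (a : ℤ) (k : ℕ) {g : Config → ℝ}
    (hg : IsLocal g) :
    IsLocal (fun η => g (sweep a k η)) ∧
      ∃ b, HMinusOneBound p (fun η => g (sweep a k η) - g η) b := by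
  induction k generalizing g with
  | zero => exact ⟨hg, 0, by simpa [sweep] using HMinusOneBound.zero p⟩
  | succ k ih =>
    obtain ⟨hl, b, hb⟩ := ih (hg.swapAt (a + k))
    obtain ⟨b', hb'⟩ := exists_hMinusOneBound_swapAt p hg (a + k)
    refine ⟨hl, b + b', ?_⟩
    have := hb.add (hl.sub (hg.swapAt _)) ((hg.swapAt _).sub hg) hb'
    simpa [sweep] using this

lemma SupportedIn.exists_Icc {f : Config → ℝ} {Λ : Finset ℤ} (hf : SupportedIn f Λ) :
    ∃ N : ℕ, ∀ M : ℕ, N ≤ M → SupportedIn f ↑(Finset.Icc (-(M : ℤ)) M) := by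
  refine ⟨Λ.sup Int.natAbs, fun M hM => hf.mono fun x hx => ?_⟩
  have h : x.natAbs ≤ M := (Finset.le_sup (f := Int.natAbs) (by simpa using hx)).trans hM
  simp only [Finset.coe_Icc, Set.mem_Icc]
  omega

lemma IsLocal.exists_Icc {f : Config → ℝ} (hf : IsLocal f) :
    ∃ N : ℕ, ∀ M : ℕ, N ≤ M → SupportedIn f ↑(Finset.Icc (-(M : ℤ)) M) := by
  obtain ⟨Λ, hΛ⟩ := hf.exists_finset
  exact hΛ.exists_Icc

/-- On functions supported in `[-N, N]`, the shift by one site is a sweep across the box. -/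
lemma exists_hMinusOneBound_shift_one (p : unitInterval) {g : Config → ℝ} (hg : IsLocal g) :
    ∃ b, HMinusOneBound p (fun η => g (shift 1 η) - g η) b := by
  obtain ⟨N, hN⟩ := hg.exists_Icc
  obtain ⟨_, b, hb⟩ := exists_hMinusOneBound_sweep p (-(N : ℤ)) (2 * N + 1) hg
  refine ⟨b, ?_⟩
  convert hb using 3 with η
  refine hN N le_rfl _ _ fun x hx => ?_
  simp only [Finset.coe_Icc, Set.mem_Icc] at hx
  rw [sweep_apply_of_mem _ _ _ hx.1 (by push_cast; omega), shift]

lemma shift_shift (x y : ℤ) (η : Config) : shift x (shift y η) = shift (x + y) η := by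
  funext z; simp [shift]; congr 1; ring

lemma shift_zero (η : Config) : shift 0 η = η := by funext z; simp [shift]

lemma exists_hMinusOneBound_shift_nat (p : unitInterval) (k : ℕ) {g : Config → ℝ}
    (hg : IsLocal g) : ∃ b, HMinusOneBound p (fun η => g (shift k η) - g η) b := by
  induction k with
  | zero => exact ⟨0, by simpa [shift_zero] using HMinusOneBound.zero p⟩
  | succ k ih =>
    obtain ⟨b, hb⟩ := ih
    obtain ⟨b', hb'⟩ := exists_hMinusOneBound_shift_one p (hg.shift k)
    refine ⟨b' + b, ?_⟩
    have := hb'.add (((hg.shift k).shift 1).sub (hg.shift k)) ((hg.shift k).sub hg) hb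
    simpa [shift_shift] using this

/-- The difference between a local function and its translate has an `H₋₁` bound: since the
Bernoulli measures are exchangeable, a translation can be performed by exchanges. -/
lemma exists_hMinusOneBound_shift (p : unitInterval) (z : ℤ) {g : Config → ℝ}
    (hg : IsLocal g) : ∃ b, HMinusOneBound p (fun η => g (shift z η) - g η) b := by
  obtain ⟨k, rfl | rfl⟩ := z.eq_nat_or_neg
  · exact exists_hMinusOneBound_shift_nat p k hg
  · obtain ⟨b, hb⟩ := exists_hMinusOneBound_shift_nat p k (hg.shift (-(k : ℤ)))
    have := hb.const_mul (-1)
    simp only [shift_shift, neg_add_cancel, shift_zero, neg_one_mul, neg_sub] at this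
    exact ⟨_, this⟩

/-! ### The generator of the environment process and the energy estimate -/

/-- The generator of the environment as seen by the walk, acting on local functions. -/
def envGenerator (c : Config → ℝ) (R : Finset ℤ) (r : ℤ → Config → ℝ) (n : ℕ)
    (g : Config → ℝ) (ξ : Config) : ℝ :=
  (n : ℝ) ^ 2 * ∑' y : ℤ, c (shift y ξ) * (g (swapAt y ξ) - g ξ) +
    (n : ℝ) * ∑ z ∈ R, r z ξ * (g (shift z ξ) - g ξ)

lemma envGenerator_eq_sum (c : Config → ℝ) (R : Finset ℤ) (r : ℤ → Config → ℝ) (n : ℕ)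
    {g : Config → ℝ} {Λ T : Finset ℤ} (hg : SupportedIn g Λ) (hT : bonds Λ ⊆ T) (ξ : Config) :
    envGenerator c R r n g ξ = (n : ℝ) ^ 2 * ∑ y ∈ T, c (shift y ξ) * (g (swapAt y ξ) - g ξ) +
      (n : ℝ) * ∑ z ∈ R, r z ξ * (g (shift z ξ) - g ξ) := by
  rw [envGenerator, tsum_eq_sum (s := T)]
  intro y hy
  rw [hg.swapAt_eq (fun h => hy (hT h)), sub_self, mul_zero]

lemma isLocal_envGenerator {c : Config → ℝ} (hc : IsLocal c) {R : Finset ℤ}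
    {r : ℤ → Config → ℝ} (hr : ∀ z ∈ R, IsLocal (r z)) (n : ℕ) {g : Config → ℝ}
    (hg : IsLocal g) : IsLocal (envGenerator c R r n g) := by
  obtain ⟨Λ, hΛ⟩ := hg.exists_finset
  have h := fun ξ => envGenerator_eq_sum c R r n hΛ (Finset.Subset.refl _) ξ
  rw [show ExclusionWalk.envGenerator c R r n g = _ from funext h]
  refine ((isLocal_finsetSum _ fun y _ => ?_).const_mul _).add
    ((isLocal_finsetSum _ fun z hz => ?_).const_mul _)
  · exact (hc.shift y).mul ((hg.swapAt y).sub hg)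
  · exact (hr z hz).mul ((hg.shift z).sub hg)

/-- The rate of a bond is not affected by the exchange at that bond. -/
lemma IsExchangeRate.shift_swapAt {c : Config → ℝ} (hc : IsExchangeRate c) (y : ℤ) (η : Config) :
    c (shift y (swapAt y η)) = c (shift y η) := by
  refine hc.reversible _ _ fun x hx => ?_
  obtain ⟨h0, h1⟩ := hx
  simp only [shift, swapAt]
  rw [Equiv.swap_apply_of_ne_of_ne (by omega) (by omega)]

/-- Reversibility of the exclusion dynamics, bond by bond. -/
lemma integral_mul_exchange (p : unitInterval) {c : Config → ℝ} (hc : IsExchangeRate c)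
    {F : Config → ℝ} (hF : IsLocal F) (y : ℤ) :
    ∫ η, F η * (c (shift y η) * (F (swapAt y η) - F η)) ∂bernoulliProduct p
      = -(1 / 2) * ∫ η, c (shift y η) * (F (swapAt y η) - F η) ^ 2 ∂bernoulliProduct p := by
  have hcl := hc.finiteRange.shift y
  have hd := (hF.swapAt y).sub hF
  have h1 := integral_swapAt p y (hF.mul (hcl.mul hd))
  simp only [hc.shift_swapAt, swapAt_swapAt] at h1
  have e : ∀ η, c (shift y η) * (F (swapAt y η) - F η) ^ 2
      = -(F (swapAt y η) * (c (shift y η) * (F η - F (swapAt y η)))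
        + F η * (c (shift y η) * (F (swapAt y η) - F η))) := fun η => by ring
  simp_rw [e]
  rw [integral_neg, integral_add
    (((hF.swapAt y).mul (hcl.mul (hF.sub (hF.swapAt y)))).integrable _)
    ((hF.mul (hcl.mul hd)).integrable _), h1]
  ring

/-- The jump part of the quadratic form: by convexity `F (F ∘ τ_z - F) ≤ (F² ∘ τ_z - F²) / 2`, and
the translation is moved to the rate by the invariance of `ν_p`. -/
lemma integral_mul_jump_le (p : unitInterval) {q : Config → ℝ} (hq : IsLocal q)
    (hq0 : ∀ η, 0 ≤ q η) {F : Config → ℝ} (hF : IsLocal F) (z : ℤ) :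
    ∫ η, F η * (q η * (F (shift z η) - F η)) ∂bernoulliProduct p
      ≤ 1 / 2 * ∫ η, (q (shift (-z) η) - q η) * F η ^ 2 ∂bernoulliProduct p := by
  have hs := hF.shift z
  have hqs := hq.shift (-z)
  calc ∫ η, F η * (q η * (F (shift z η) - F η)) ∂bernoulliProduct p
      ≤ ∫ η, 1 / 2 * (q η * F (shift z η) ^ 2 - q η * F η ^ 2) ∂bernoulliProduct p := by
        refine integral_mono ((hF.mul (hq.mul (hs.sub hF))).integrable _)
          ((((hq.mul (hs.pow 2)).sub (hq.mul (hF.pow 2))).const_mul _).integrable _) fun η => ?_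
        simp only
        nlinarith [mul_nonneg (hq0 η) (sq_nonneg (F (shift z η) - F η))]
    _ = 1 / 2 * ∫ η, (q (shift (-z) η) - q η) * F η ^ 2 ∂bernoulliProduct p := by
        rw [integral_const_mul]
        have h := integral_shift p z (hqs.mul (hF.pow 2))
        simp only [shift_shift, neg_add_cancel, shift_zero] at h
        simp_rw [sub_mul]
        rw [integral_sub ((hq.mul (hs.pow 2)).integrable _) ((hq.mul (hF.pow 2)).integrable _),
          integral_sub ((hqs.mul (hF.pow 2)).integrable _) ((hq.mul (hF.pow 2)).integrable _), h]

/-- Energy estimate: the exchange part of the generator dissipates `n²` times the Dirichlet form,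
which absorbs, up to a constant independent of `n`, the contribution of the jumps of the walk. -/
theorem exists_energy_estimate (p : unitInterval) {c : Config → ℝ} (hc : IsExchangeRate c)
    {R : Finset ℤ} {r : ℤ → Config → ℝ} (hr : IsJumpRate R r) :
    ∃ ε₀ C : ℝ, 0 < ε₀ ∧ 0 ≤ C ∧ ∀ (n : ℕ) (F : Config → ℝ), IsLocal F →
      ∫ η, F η * envGenerator c R r n F η ∂bernoulliProduct p
        ≤ -(ε₀ * (n : ℝ) ^ 2 * dirichlet p F) + C * sqNorm p F := by
  obtain ⟨e, he, hce⟩ := hc.elliptic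
  have hb : ∀ z, ∃ b, z ∈ R →
      HMinusOneBound p (fun η => r z (shift (-z) η) - r z η) b := fun z => by
    by_cases hz : z ∈ R
    · obtain ⟨b, hb⟩ := exists_hMinusOneBound_shift p (-z) (hr.isLocal z hz)
      exact ⟨b, fun _ => hb⟩
    · exact ⟨0, fun h => absurd h hz⟩
  choose b hb using hb
  set B := ∑ z ∈ R, b z with hB
  refine ⟨e / 4, B ^ 2 / (4 * e), by positivity, by positivity, fun n F hF => ?_⟩
  obtain ⟨Λ, hΛ⟩ := hF.exists_finset
  have hcl := hc.finiteRange
  have hex : ∀ y, IsLocal fun η => F η * (c (shift y η) * (F (swapAt y η) - F η)) := fun y =>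
    hF.mul ((hcl.shift y).mul ((hF.swapAt y).sub hF))
  have hju : ∀ z ∈ R, IsLocal fun η => F η * (r z η * (F (shift z η) - F η)) := fun z hz =>
    hF.mul ((hr.isLocal z hz).mul ((hF.shift z).sub hF))
  have h1 : ∫ η, F η * envGenerator c R r n F η ∂bernoulliProduct p
      = (n : ℝ) ^ 2 * ∑ y ∈ bonds Λ, ∫ η, F η * (c (shift y η) * (F (swapAt y η) - F η))
          ∂bernoulliProduct p
        + n * ∑ z ∈ R, ∫ η, F η * (r z η * (F (shift z η) - F η)) ∂bernoulliProduct p := by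
    have e : ∀ η, F η * envGenerator c R r n F η
        = (n : ℝ) ^ 2 * ∑ y ∈ bonds Λ, F η * (c (shift y η) * (F (swapAt y η) - F η))
          + n * ∑ z ∈ R, F η * (r z η * (F (shift z η) - F η)) := fun η => by
      rw [envGenerator_eq_sum c R r n hΛ (Finset.Subset.refl _), ← Finset.mul_sum,
        ← Finset.mul_sum]
      ring
    simp_rw [e]
    rw [integral_add (((isLocal_finsetSum _ fun y _ => hex y).const_mul _).integrable _)
      (((isLocal_finsetSum _ hju).const_mul _).integrable _), integral_const_mul,
      integral_const_mul, integral_finsetSum _ fun y _ => (hex y).integrable _,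
      integral_finsetSum _ fun z hz => (hju z hz).integrable _]
  have h2 : ∑ y ∈ bonds Λ, ∫ η, F η * (c (shift y η) * (F (swapAt y η) - F η))
      ∂bernoulliProduct p ≤ -(e / 2 * dirichlet p F) := by
    rw [dirichlet_eq_sum p hΛ (Finset.Subset.refl _), Finset.mul_sum, ← Finset.sum_neg_distrib]
    refine Finset.sum_le_sum fun y _ => ?_
    rw [integral_mul_exchange p hc hF y]
    have hd := ((hF.swapAt y).sub hF).pow 2
    have : e * ∫ η, (F (swapAt y η) - F η) ^ 2 ∂bernoulliProduct p
        ≤ ∫ η, c (shift y η) * (F (swapAt y η) - F η) ^ 2 ∂bernoulliProduct p := by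
      rw [← integral_const_mul]
      exact integral_mono ((hd.const_mul _).integrable _)
        (((hcl.shift y).mul hd).integrable _)
        fun η => mul_le_mul_of_nonneg_right (hce _) (sq_nonneg _)
    linarith
  have h3 : ∑ z ∈ R, ∫ η, F η * (r z η * (F (shift z η) - F η)) ∂bernoulliProduct p
      ≤ 1 / 2 * (B * (√(dirichlet p F) * √(sqNorm p F))) := by
    rw [hB, Finset.sum_mul, Finset.mul_sum]
    refine Finset.sum_le_sum fun z hz => ?_
    refine (integral_mul_jump_le p (hr.isLocal z hz) (hr.nonneg z hz) hF z).trans ?_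
    exact mul_le_mul_of_nonneg_left ((le_abs_self _).trans (hb z hz F hF)) (by norm_num)
  rw [h1]
  have h2' := mul_le_mul_of_nonneg_left h2 (sq_nonneg (n : ℝ))
  have h3' := mul_le_mul_of_nonneg_left h3 (Nat.cast_nonneg (α := ℝ) n)
  refine (add_le_add h2' h3').trans ?_
  have hD := Real.sq_sqrt (dirichlet_nonneg p F)
  have hS := Real.sq_sqrt (sqNorm_nonneg p F)
  set D := √(dirichlet p F)
  set S := √(sqNorm p F)
  rw [← hD, ← hS]
  -- Young's inequality: `n B D S / 2 ≤ (e / 4) n² D² + B² S² / (4 e)`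
  have key : 0 ≤ (e * n * D - B * S) ^ 2 / (4 * e) := by positivity
  have key2 : (e * n * D - B * S) ^ 2 / (4 * e)
      = e / 4 * n ^ 2 * D ^ 2 - n * (1 / 2 * (B * (D * S))) + B ^ 2 / (4 * e) * S ^ 2 := by
    field_simp; ring
  linarith

/-- The energy estimate for the generator perturbed by a potential `a W`, where `W` has an `H₋₁`
bound: the Dirichlet form also absorbs the potential. -/
lemma energy_estimate_with_potential {p : unitInterval} {c : Config → ℝ} {R : Finset ℤ}
    {r : ℤ → Config → ℝ} (hc : IsLocal c) (hr : ∀ z ∈ R, IsLocal (r z)) {ε₀ C : ℝ} (hε : 0 < ε₀)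
    {n : ℕ} (hn : 1 ≤ n)
    (hE : ∀ F : Config → ℝ, IsLocal F →
      ∫ η, F η * envGenerator c R r n F η ∂bernoulliProduct p
        ≤ -(ε₀ * (n : ℝ) ^ 2 * dirichlet p F) + C * sqNorm p F)
    {W : Config → ℝ} (hW : IsLocal W) {b : ℝ} (hb : HMinusOneBound p W b) (K : ℝ)
    {F : Config → ℝ} (hF : IsLocal F) :
    ∫ η, F η * (envGenerator c R r n F η + K * √n * W η * F η) ∂bernoulliProduct p
      ≤ (C + K ^ 2 * (b ^ 2 / n) / (4 * ε₀)) * sqNorm p F := by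
  have e : ∀ η, F η * (envGenerator c R r n F η + K * √n * W η * F η)
      = F η * envGenerator c R r n F η + K * √n * (W η * F η ^ 2) := fun η => by ring
  simp_rw [e]
  rw [integral_add ((hF.mul (isLocal_envGenerator hc hr n hF)).integrable _)
    (((hW.mul (hF.pow 2)).const_mul _).integrable _), integral_const_mul]
  have h1 := hE F hF
  have h2 := hb F hF
  have hn0 : (0 : ℝ) < n := by exact_mod_cast hn
  have h3 : K * √n * ∫ η, W η * F η ^ 2 ∂bernoulliProduct p
      ≤ |K| * √n * (b * (√(dirichlet p F) * √(sqNorm p F))) := by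
    refine (le_abs_self _).trans ?_
    rw [abs_mul, abs_mul, abs_of_nonneg (Real.sqrt_nonneg _)]
    exact mul_le_mul_of_nonneg_left h2 (by positivity)
  have hD := Real.sq_sqrt (dirichlet_nonneg p F)
  have hS := Real.sq_sqrt (sqNorm_nonneg p F)
  have hN := Real.sq_sqrt hn0.le
  have hs0 : 0 < √(n : ℝ) := Real.sqrt_pos.2 hn0
  set D := √(dirichlet p F)
  set S := √(sqNorm p F)
  set s := √(n : ℝ)
  rw [← hD, ← hS, ← hN] at h1
  rw [← hS, ← hN]
  have hK := sq_abs K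
  -- Young's inequality: `|K| √n b D S ≤ ε₀ n² D² + (K² b² / (4 ε₀ n)) S²`
  have key : 0 ≤ (2 * ε₀ * s ^ 2 * D - |K| * (b / s) * S) ^ 2 / (4 * ε₀) := by positivity
  have key2 : (2 * ε₀ * s ^ 2 * D - |K| * (b / s) * S) ^ 2 / (4 * ε₀)
      = ε₀ * (s ^ 2) ^ 2 * D ^ 2 - |K| * s * (b * (D * S))
        + |K| ^ 2 * (b ^ 2 / s ^ 2) / (4 * ε₀) * S ^ 2 := by
    field_simp; ring
  rw [hK] at key2
  linarith

/-! ### Densities in finite boxes -/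

/-- The density with respect to `ν_p` of the restriction of `μ` to the coordinates in `Λ`, as a
function on the whole configuration space. -/
def density (p : unitInterval) (Λ : Finset ℤ) (μ : Measure Config) (η : Config) : ℝ :=
  ∑ σ : Λ → Bool, (∫ ζ, patternFun Λ σ ζ ∂μ) / (∫ ζ, patternFun Λ σ ζ ∂bernoulliProduct p)
    * patternFun Λ σ η

lemma isLocal_patternFun (Λ : Finset ℤ) (σ : Λ → Bool) : IsLocal (patternFun Λ σ) :=
  (supportedIn_patternFun Λ σ).isLocal

lemma density_apply (p : unitInterval) (Λ : Finset ℤ) (μ : Measure Config) (η : Config) :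
    density p Λ μ η = (∫ ζ, patternFun Λ (Λ.restrict η) ζ ∂μ)
      / (∫ ζ, patternFun Λ (Λ.restrict η) ζ ∂bernoulliProduct p) := by
  simp [density, patternFun]

lemma supportedIn_density (p : unitInterval) (Λ : Finset ℤ) (μ : Measure Config) :
    SupportedIn (density p Λ μ) Λ := fun η ξ h => by
  simp only [density, supportedIn_patternFun Λ _ η ξ h]

lemma isLocal_density (p : unitInterval) (Λ : Finset ℤ) (μ : Measure Config) :
    IsLocal (density p Λ μ) := (supportedIn_density p Λ μ).isLocal

lemma integral_patternFun_pos {p : unitInterval} (h0 : 0 < (p : ℝ)) (h1 : (p : ℝ) < 1)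
    (Λ : Finset ℤ) (σ : Λ → Bool) : 0 < ∫ ζ, patternFun Λ σ ζ ∂bernoulliProduct p :=
  (pow_pos (lt_min h0 (by linarith)) _).trans_le (pow_le_integral_patternFun p Λ σ)

/-- A function supported in `Λ` is constant on each cylinder `{η = σ on Λ}`. -/
lemma patternFun_mul {Λ : Finset ℤ} {g : Config → ℝ} (hg : SupportedIn g Λ) (σ : Λ → Bool)
    (η : Config) : g η * patternFun Λ σ η = g (extend Λ σ) * patternFun Λ σ η := by
  by_cases h : Λ.restrict η = σ
  · rw [hg.eq_extend η, h]
  · simp [patternFun, h]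

lemma integral_mul_density {p : unitInterval} (h0 : 0 < (p : ℝ)) (h1 : (p : ℝ) < 1)
    {Λ : Finset ℤ} (μ : Measure Config) [IsFiniteMeasure μ] {g : Config → ℝ}
    (hg : SupportedIn g Λ) :
    ∫ η, g η * density p Λ μ η ∂bernoulliProduct p = ∫ η, g η ∂μ := by
  have e : ∀ η, g η * density p Λ μ η
      = ∑ σ : Λ → Bool, g (extend Λ σ) * ((∫ ζ, patternFun Λ σ ζ ∂μ)
        / (∫ ζ, patternFun Λ σ ζ ∂bernoulliProduct p)) * patternFun Λ σ η := fun η => by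
    rw [density, Finset.mul_sum]
    refine Finset.sum_congr rfl fun σ _ => ?_
    rw [mul_left_comm, patternFun_mul hg]; ring
  simp_rw [e]
  rw [integral_finsetSum _ fun σ _ => ((isLocal_patternFun Λ σ).const_mul _).integrable _,
    integral_congr_ae (ae_of_all μ hg.eq_sum_patternFun),
    integral_finsetSum _ fun σ _ => ((isLocal_patternFun Λ σ).const_mul _).integrable _]
  refine Finset.sum_congr rfl fun σ _ => ?_
  rw [integral_const_mul, integral_const_mul, mul_assoc,
    div_mul_cancel₀ _ (integral_patternFun_pos h0 h1 Λ σ).ne']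

lemma sqNorm_density {p : unitInterval} (h0 : 0 < (p : ℝ)) (h1 : (p : ℝ) < 1)
    (Λ : Finset ℤ) (μ : Measure Config) [IsFiniteMeasure μ] :
    sqNorm p (density p Λ μ) = ∫ η, density p Λ μ η ∂μ := by
  rw [← integral_mul_density h0 h1 μ (supportedIn_density p Λ μ)]
  simp only [sqNorm, sq]

lemma sqNorm_density_eq_sum {p : unitInterval} (h0 : 0 < (p : ℝ)) (h1 : (p : ℝ) < 1)
    (Λ : Finset ℤ) (μ : Measure Config) [IsFiniteMeasure μ] :
    sqNorm p (density p Λ μ) = ∑ σ : Λ → Bool, (∫ ζ, patternFun Λ σ ζ ∂μ) ^ 2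
      / (∫ ζ, patternFun Λ σ ζ ∂bernoulliProduct p) := by
  rw [sqNorm_density h0 h1]
  simp_rw [density]
  rw [integral_finsetSum _ fun σ _ => ((isLocal_patternFun Λ σ).const_mul _).integrable _]
  refine Finset.sum_congr rfl fun σ _ => ?_
  rw [integral_const_mul]; ring

/-- Densities in increasing boxes form a martingale: increments are orthogonal to functions of the
smaller box. -/
lemma integral_density_sub_mul {p : unitInterval} (h0 : 0 < (p : ℝ)) (h1 : (p : ℝ) < 1)
    {Λ Λ' : Finset ℤ} (hΛ : Λ ⊆ Λ') (μ : Measure Config) [IsFiniteMeasure μ] {g : Config → ℝ}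
    (hg : SupportedIn g Λ) :
    ∫ η, (density p Λ' μ η - density p Λ μ η) * g η ∂bernoulliProduct p = 0 := by
  have hgl := hg.isLocal
  have h2 := integral_mul_density h0 h1 μ (hg.mono (Finset.coe_subset.2 hΛ))
  have h3 := integral_mul_density h0 h1 μ hg
  simp_rw [mul_comm _ (g _), mul_sub]
  rw [integral_sub ((hgl.mul (isLocal_density _ _ _)).integrable _)
    ((hgl.mul (isLocal_density _ _ _)).integrable _), h2, h3, sub_self]

lemma sqNorm_density_sub {p : unitInterval} (h0 : 0 < (p : ℝ)) (h1 : (p : ℝ) < 1)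
    {Λ Λ' : Finset ℤ} (hΛ : Λ ⊆ Λ') (μ : Measure Config) [IsFiniteMeasure μ] :
    sqNorm p (fun η => density p Λ' μ η - density p Λ μ η)
      = sqNorm p (density p Λ' μ) - sqNorm p (density p Λ μ) := by
  have h2 := integral_density_sub_mul h0 h1 hΛ μ (supportedIn_density p Λ μ)
  have hl := isLocal_density p Λ μ
  have hl' := isLocal_density p Λ' μ
  have e : ∀ η, (density p Λ' μ η - density p Λ μ η) ^ 2 = density p Λ' μ η ^ 2
      - density p Λ μ η ^ 2 - 2 * ((density p Λ' μ η - density p Λ μ η) * density p Λ μ η) :=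
    fun η => by ring
  simp only [sqNorm]
  simp_rw [e]
  rw [integral_sub (((hl'.pow 2).sub (hl.pow 2)).integrable _)
    ((((hl'.sub hl).mul hl).const_mul 2).integrable _), integral_const_mul, h2,
    integral_sub ((hl'.pow 2).integrable _) ((hl.pow 2).integrable _)]
  ring

lemma sqNorm_density_self {p : unitInterval} (h0 : 0 < (p : ℝ)) (h1 : (p : ℝ) < 1)
    (Λ : Finset ℤ) : sqNorm p (density p Λ (bernoulliProduct p)) = 1 := by
  have : ∀ η, density p Λ (bernoulliProduct p) η = 1 := fun η => by
    rw [density_apply, div_self (integral_patternFun_pos h0 h1 Λ _).ne']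
  simp [sqNorm, this]

/-- A priori bound, in which the densities grow at most exponentially with the size of the box. -/
lemma sqNorm_density_le {p : unitInterval} (h0 : 0 < (p : ℝ)) (h1 : (p : ℝ) < 1)
    (Λ : Finset ℤ) (μ : Measure Config) [IsFiniteMeasure μ] :
    sqNorm p (density p Λ μ) ≤ μ.real Set.univ ^ 2 / min (p : ℝ) (1 - p) ^ Λ.card := by
  have hm : 0 < min (p : ℝ) (1 - p) := lt_min h0 (by linarith)
  have hp : ∀ σ, ∫ ζ, patternFun Λ σ ζ ∂μ ≤ μ.real Set.univ := fun σ => by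
    calc ∫ ζ, patternFun Λ σ ζ ∂μ ≤ ∫ _, (1 : ℝ) ∂μ :=
          integral_mono ((isLocal_patternFun Λ σ).integrable _) (integrable_const _) fun ζ => by
            simp only [patternFun]; split_ifs <;> norm_num
      _ = μ.real Set.univ := by simp
  rw [sqNorm_density h0 h1]
  calc ∫ η, density p Λ μ η ∂μ
      ≤ ∫ _, μ.real Set.univ / min (p : ℝ) (1 - p) ^ Λ.card ∂μ := by
        refine integral_mono ((isLocal_density _ _ _).integrable _) (integrable_const _)
          fun η => ?_
        rw [density_apply]
        exact div_le_div₀ (by positivity) (hp _) (by positivity)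
          (pow_le_integral_patternFun p Λ _)
    _ = _ := by simp; ring

/-! ### Differential inequality for the densities -/

/-- Cauchy–Schwarz and Young for one term of the generator. -/
lemma integral_mul_increment_le (p : unitInterval) {h q F F' : Config → ℝ} (hh : IsLocal h)
    (hq : IsLocal q) (hF : IsLocal F) (hF' : IsLocal F') (hFF' : sqNorm p F' = sqNorm p F)
    {M κ : ℝ} (hM : ∀ η, |q η| ≤ M) (hκ : 0 < κ) :
    ∫ η, h η * (q η * (F' η - F η)) ∂bernoulliProduct p
      ≤ M * (κ * sqNorm p h + sqNorm p F / κ) := by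
  have hM0 : 0 ≤ M := (abs_nonneg _).trans (hM fun _ => false)
  calc ∫ η, h η * (q η * (F' η - F η)) ∂bernoulliProduct p
      ≤ ∫ η, M * (κ * h η ^ 2 + (1 / (2 * κ)) * (F' η ^ 2 + F η ^ 2)) ∂bernoulliProduct p := by
        refine integral_mono ((hh.mul (hq.mul (hF'.sub hF))).integrable _)
          (((((hh.pow 2).const_mul _).add (((hF'.pow 2).add (hF.pow 2)).const_mul _)).const_mul
            _).integrable _) fun η => ?_
        have h1 : h η * (q η * (F' η - F η)) ≤ M * (|h η| * |F' η - F η|) := by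
          refine (le_abs_self _).trans ?_
          rw [abs_mul, abs_mul, mul_left_comm]
          exact mul_le_mul_of_nonneg_right (hM η) (by positivity)
        refine h1.trans (mul_le_mul_of_nonneg_left ?_ hM0)
        have h2 : 0 ≤ (2 * κ * |h η| - |F' η - F η|) ^ 2 / (4 * κ) := by positivity
        have h3 : (2 * κ * |h η| - |F' η - F η|) ^ 2 / (4 * κ)
            = κ * |h η| ^ 2 - |h η| * |F' η - F η| + |F' η - F η| ^ 2 / (4 * κ) := by
          field_simp; ring
        rw [sq_abs, sq_abs] at h3
        have h4 : (F' η - F η) ^ 2 / (4 * κ) ≤ 1 / (2 * κ) * (F' η ^ 2 + F η ^ 2) := by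
          rw [div_mul_eq_mul_div, div_le_div_iff₀ (by positivity) (by positivity)]
          nlinarith [mul_nonneg hκ.le (sq_nonneg (F' η + F η))]
        linarith
    _ = M * (κ * sqNorm p h + sqNorm p F / κ) := by
        rw [integral_const_mul, integral_add (((hh.pow 2).const_mul _).integrable _)
          ((((hF'.pow 2).add (hF.pow 2)).const_mul _).integrable _), integral_const_mul,
          integral_const_mul, integral_add ((hF'.pow 2).integrable _) ((hF.pow 2).integrable _)]
        simp only [sqNorm] at hFF' ⊢
        rw [hFF']
        field_simp
        ring

/-- The box `{-N, …, N}`. -/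
def box (N : ℕ) : Finset ℤ := Finset.Icc (-(N : ℤ)) N

lemma mem_box {N : ℕ} {x : ℤ} : x ∈ box N ↔ -(N : ℤ) ≤ x ∧ x ≤ N := Finset.mem_Icc

lemma IsLocal.exists_box {f : Config → ℝ} (hf : IsLocal f) :
    ∃ N : ℕ, ∀ M : ℕ, N ≤ M → SupportedIn f ↑(box M) := hf.exists_Icc

lemma exists_common_box {ι : Type*} (s : Finset ι) {f : ι → Config → ℝ}
    (hf : ∀ i ∈ s, IsLocal (f i)) :
    ∃ N : ℕ, ∀ M : ℕ, N ≤ M → ∀ i ∈ s, SupportedIn (f i) ↑(box M) := by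
  classical
  induction s using Finset.induction_on with
  | empty => exact ⟨0, by simp⟩
  | insert a s ha ih =>
    obtain ⟨N, hN⟩ := ih fun i hi => hf i (by simp [hi])
    obtain ⟨N', hN'⟩ := (hf a (by simp)).exists_box
    refine ⟨max N N', fun M hM i hi => ?_⟩
    rcases Finset.mem_insert.1 hi with rfl | hi
    · exact hN' M ((le_max_right _ _).trans hM)
    · exact hN M ((le_max_left _ _).trans hM) i hi

lemma exists_common_bound {ι : Type*} (s : Finset ι) {f : ι → Config → ℝ}
    (hf : ∀ i ∈ s, IsLocal (f i)) : ∃ C : ℝ, 0 ≤ C ∧ ∀ i ∈ s, ∀ η, |f i η| ≤ C := by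
  classical
  induction s using Finset.induction_on with
  | empty => exact ⟨0, le_rfl, by simp⟩
  | insert a s ha ih =>
    obtain ⟨C, hC0, hC⟩ := ih fun i hi => hf i (by simp [hi])
    obtain ⟨C', hC0', hC'⟩ := (hf a (by simp)).exists_bound
    refine ⟨max C C', hC0.trans (le_max_left _ _), fun i hi η => ?_⟩
    rcases Finset.mem_insert.1 hi with rfl | hi
    · exact (hC' η).trans (le_max_right _ _)
    · exact (hC i hi η).trans (le_max_left _ _)

lemma supportedIn_finsetSum {ι : Type*} {s : Finset ι} {f : ι → Config → ℝ} {A : Set ℤ}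
    (hf : ∀ i ∈ s, SupportedIn (f i) A) : SupportedIn (fun η => ∑ i ∈ s, f i η) A :=
  fun η ξ h => Finset.sum_congr rfl fun i hi => hf i hi η ξ h

/-- The density in a box evolves, up to a boundary effect, by the quadratic form of the generator
in `L²(ν_p)`. The boundary effect is controlled by the increment of the squared norm between two
boxes, with a constant that does not depend on the size of the box. -/
theorem exists_integral_generator_density_le {p : unitInterval} (h0 : 0 < (p : ℝ))
    (h1 : (p : ℝ) < 1) {c : Config → ℝ} (hc : IsLocal c) {R : Finset ℤ} {r : ℤ → Config → ℝ}
    (hr : ∀ z ∈ R, IsLocal (r z)) (n : ℕ) {V : Config → ℝ} (hV : IsLocal V) :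
    ∃ (k N₀ : ℕ) (C : ℝ), 0 ≤ C ∧ ∀ N : ℕ, N₀ ≤ N → ∀ (μ : Measure Config) [IsFiniteMeasure μ],
      ∫ η, (envGenerator c R r n (density p (box N) μ) η + V η * density p (box N) μ η) ∂μ
        ≤ ∫ η, density p (box N) μ η * (envGenerator c R r n (density p (box N) μ) η
            + V η * density p (box N) μ η) ∂bernoulliProduct p
          + sqNorm p (density p (box N) μ)
          + C * (sqNorm p (density p (box (N + k)) μ) - sqNorm p (density p (box N) μ)) := by
  -- `k₀` bounds the range of the rates and of the jumps
  obtain ⟨k₁, hk₁⟩ := hc.exists_box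
  obtain ⟨k₂, hk₂⟩ := exists_common_box R hr
  obtain ⟨Mc, hMc0, hMc⟩ := hc.exists_bound
  obtain ⟨Mr, hMr0, hMr⟩ := exists_common_bound R hr
  obtain ⟨NV, hNV⟩ := hV.exists_box
  set k₀ := max (max k₁ k₂) (R.sup Int.natAbs) with hk₀
  have hcs : SupportedIn c ↑(box k₀) := hk₁ _ (by omega)
  have hrs : ∀ z ∈ R, SupportedIn (r z) ↑(box k₀) := hk₂ _ (by omega)
  have hRs : ∀ z ∈ R, z.natAbs ≤ k₀ := fun z hz =>
    (Finset.le_sup (f := Int.natAbs) hz).trans (le_max_right _ _)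
  -- `S` bounds the total rate of the boundary exchanges and of the jumps
  set S : ℝ := (n : ℝ) ^ 2 * ((2 * k₀ + 4 : ℕ) * Mc) + n * (R.card * Mr) with hS
  have hS0 : 0 ≤ S := by positivity
  refine ⟨2 * k₀ + 2, max NV (k₀ + 1), S * (S + 1), by positivity, fun N hN μ _ => ?_⟩
  have hNV' : NV ≤ N := (le_max_left _ _).trans hN
  have hNk : k₀ + 1 ≤ N := (le_max_right _ _).trans hN
  have hsub : box N ⊆ box (N + (2 * k₀ + 2)) := fun x hx => by
    rw [mem_box] at hx ⊢; push_cast; omega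
  set F := density p (box N) μ with hFdef
  set G := density p (box (N + (2 * k₀ + 2))) μ with hGdef
  have hF : SupportedIn F ↑(box N) := supportedIn_density _ _ _
  have hFl : IsLocal F := isLocal_density _ _ _
  have hGl : IsLocal G := isLocal_density _ _ _
  have hhl := hGl.sub hFl
  -- `T` contains the bonds that meet the box; the exchanges at the bonds in `I` have their rates
  -- supported in the box
  set T := Finset.Icc (-(N : ℤ) - 1) (N + 1) with hT
  have hbT : bonds (box N) ⊆ T := fun y hy => by
    simp only [bonds, Finset.mem_union, Finset.mem_image, mem_box] at hy
    rw [hT, Finset.mem_Icc]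
    rcases hy with hy | ⟨a, ha, rfl⟩ <;> omega
  set I := Finset.Icc (-(N : ℤ) + k₀ + 1) (N - k₀ - 1) with hI
  have hIT : I ⊆ T := Finset.Icc_subset_Icc (by omega) (by omega)
  have hcard : ((T \ I).card : ℝ) = ((2 * k₀ + 4 : ℕ) : ℝ) := by
    rw [Finset.card_sdiff_of_subset hIT]
    simp only [hT, hI, Int.card_Icc]
    congr 1
    omega
  have hexS : ∀ (y : ℤ) (L : ℕ), -(L : ℤ) ≤ y - k₀ → y + k₀ ≤ L → N ≤ L → -(L : ℤ) ≤ y →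
      y + 1 ≤ L → SupportedIn (fun η => c (shift y η) * (F (swapAt y η) - F η)) ↑(box L) := by
    intro y L h2 h3 h4 h5 h6 η ξ h
    have e1 : c (shift y η) = c (shift y ξ) := hcs _ _ fun x hx => by
      have hx' := mem_box.1 (Finset.mem_coe.1 hx)
      exact h _ (Finset.mem_coe.2 (mem_box.2 (by omega)))
    have e2 : F (swapAt y η) = F (swapAt y ξ) := hF _ _ fun x hx => by
      have hx' := mem_box.1 (Finset.mem_coe.1 hx)
      refine h _ (Finset.mem_coe.2 (mem_box.2 ?_))
      rw [Equiv.swap_apply_def]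
      split_ifs <;> omega
    have e3 : F η = F ξ := hF _ _ fun x hx => by
      have hx' := mem_box.1 (Finset.mem_coe.1 hx)
      exact h _ (Finset.mem_coe.2 (mem_box.2 (by omega)))
    simp only [e1, e2, e3]
  have hjuS : ∀ z ∈ R, SupportedIn (fun η => r z η * (F (shift z η) - F η))
      ↑(box (N + (2 * k₀ + 2))) := by
    intro z hz η ξ h
    have hzk := hRs z hz
    have e1 : r z η = r z ξ := hrs z hz _ _ fun x hx => by
      have hx' := mem_box.1 (Finset.mem_coe.1 hx)
      exact h _ (Finset.mem_coe.2 (mem_box.2 (by push_cast; omega)))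
    have e2 : F (shift z η) = F (shift z ξ) := hF _ _ fun x hx => by
      have hx' := mem_box.1 (Finset.mem_coe.1 hx)
      exact h _ (Finset.mem_coe.2 (mem_box.2 (by push_cast; omega)))
    have e3 : F η = F ξ := hF _ _ fun x hx => by
      have hx' := mem_box.1 (Finset.mem_coe.1 hx)
      exact h _ (Finset.mem_coe.2 (mem_box.2 (by push_cast; omega)))
    simp only [e1, e2, e3]
  have hVS : SupportedIn (fun η => V η * F η) ↑(box N) := (hNV N hNV').comp₂ hF (· * ·)
  have hgen : ∀ η, envGenerator c R r n F η + V η * F η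
      = (n : ℝ) ^ 2 * ∑ y ∈ T, c (shift y η) * (F (swapAt y η) - F η)
        + (n : ℝ) * ∑ z ∈ R, r z η * (F (shift z η) - F η) + V η * F η := fun η => by
    rw [envGenerator_eq_sum c R r n hF hbT]
  have hAl : IsLocal fun η => envGenerator c R r n F η + V η * F η :=
    (isLocal_envGenerator hc hr n hFl).add (hV.mul hFl)
  have hAS : SupportedIn (fun η => envGenerator c R r n F η + V η * F η)
      ↑(box (N + (2 * k₀ + 2))) := by
    intro η ξ h
    simp only [hgen]
    have e1 := hVS.mono (Finset.coe_subset.2 hsub) η ξ h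
    have e2 := supportedIn_finsetSum hjuS η ξ h
    have e3 := supportedIn_finsetSum (s := T)
      (f := fun y η => c (shift y η) * (F (swapAt y η) - F η)) (fun y hy => by
        rw [hT, Finset.mem_Icc] at hy
        exact hexS y (N + (2 * k₀ + 2)) (by push_cast; omega) (by push_cast; omega) (by omega)
          (by push_cast; omega) (by push_cast; omega)) η ξ h
    simp only at e1 e2 e3
    rw [e1, e2, e3]
  have hexl : ∀ y, IsLocal fun η => c (shift y η) * (F (swapAt y η) - F η) := fun y =>
    (hc.shift y).mul ((hFl.swapAt y).sub hFl)
  have hjul : ∀ z ∈ R, IsLocal fun η => r z η * (F (shift z η) - F η) := fun z hz =>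
    (hr z hz).mul ((hFl.shift z).sub hFl)
  -- the integrand is supported in the larger box, where `μ` has density `G = F + (G - F)`
  have h2 : ∫ η, (envGenerator c R r n F η + V η * F η) ∂μ
      = ∫ η, F η * (envGenerator c R r n F η + V η * F η) ∂bernoulliProduct p
        + ∫ η, (G η - F η) * (envGenerator c R r n F η + V η * F η) ∂bernoulliProduct p := by
    rw [← integral_mul_density h0 h1 μ hAS, ← integral_add ((hFl.mul hAl).integrable _)
      ((hhl.mul hAl).integrable _)]
    exact integral_congr_ae (ae_of_all _ fun η => by ring)
  have h3 : ∫ η, (G η - F η) * (envGenerator c R r n F η + V η * F η) ∂bernoulliProduct p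
      = (n : ℝ) ^ 2 * ∑ y ∈ T, ∫ η, (G η - F η) * (c (shift y η) * (F (swapAt y η) - F η))
          ∂bernoulliProduct p
        + n * ∑ z ∈ R, ∫ η, (G η - F η) * (r z η * (F (shift z η) - F η))
          ∂bernoulliProduct p := by
    have e : ∀ η, (G η - F η) * (envGenerator c R r n F η + V η * F η)
        = ((n : ℝ) ^ 2 * ∑ y ∈ T, (G η - F η) * (c (shift y η) * (F (swapAt y η) - F η))
          + n * ∑ z ∈ R, (G η - F η) * (r z η * (F (shift z η) - F η)))
          + (G η - F η) * (V η * F η) := fun η => by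
      rw [hgen, ← Finset.mul_sum, ← Finset.mul_sum]; ring
    have hl1 := isLocal_finsetSum T fun y _ => hhl.mul (hexl y)
    have hl2 := isLocal_finsetSum R fun z hz => hhl.mul (hjul z hz)
    simp_rw [e]
    rw [integral_add (((hl1.const_mul _).add (hl2.const_mul _)).integrable _)
      ((hhl.mul (hV.mul hFl)).integrable _), integral_density_sub_mul h0 h1 hsub μ hVS, add_zero,
      integral_add ((hl1.const_mul _).integrable _) ((hl2.const_mul _).integrable _),
      integral_const_mul, integral_const_mul,
      integral_finsetSum _ fun y _ => (hhl.mul (hexl y)).integrable _,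
      integral_finsetSum _ fun z hz => (hhl.mul (hjul z hz)).integrable _]
  -- only the bonds close to the boundary contribute
  have h4 : ∑ y ∈ T, ∫ η, (G η - F η) * (c (shift y η) * (F (swapAt y η) - F η))
        ∂bernoulliProduct p
      = ∑ y ∈ T \ I, ∫ η, (G η - F η) * (c (shift y η) * (F (swapAt y η) - F η))
        ∂bernoulliProduct p := by
    rw [← Finset.sum_sdiff hIT, add_eq_left]
    refine Finset.sum_eq_zero fun y hy => ?_
    rw [hI, Finset.mem_Icc] at hy
    exact integral_density_sub_mul h0 h1 hsub μ
      (hexS y N (by omega) (by omega) le_rfl (by omega) (by omega))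
  -- the weight `S + 1` in Young's inequality makes the total coefficient of `‖F‖²` at most `1`
  set Q : ℝ := (S + 1) * sqNorm p (fun η => G η - F η) + sqNorm p F / (S + 1) with hQ
  have hS1 : 0 < S + 1 := by positivity
  have h5 : ∑ y ∈ T \ I, ∫ η, (G η - F η) * (c (shift y η) * (F (swapAt y η) - F η))
      ∂bernoulliProduct p ≤ (2 * k₀ + 4 : ℕ) * Mc * Q := by
    rw [← hcard, mul_assoc, ← nsmul_eq_mul]
    exact Finset.sum_le_card_nsmul _ _ _ fun y _ => integral_mul_increment_le p hhl (hc.shift y)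
      hFl (hFl.swapAt y) (sqNorm_swapAt p hFl y) (fun η => hMc _) hS1
  have h6 : ∑ z ∈ R, ∫ η, (G η - F η) * (r z η * (F (shift z η) - F η)) ∂bernoulliProduct p
      ≤ R.card * Mr * Q := by
    rw [mul_assoc, ← nsmul_eq_mul]
    exact Finset.sum_le_card_nsmul _ _ _ fun z hz => integral_mul_increment_le p hhl (hr z hz)
      hFl (hFl.shift z) (sqNorm_shift p hFl z) (fun η => hMr z hz _) hS1
  have h7 : ∫ η, (G η - F η) * (envGenerator c R r n F η + V η * F η) ∂bernoulliProduct p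
      ≤ S * Q := by
    rw [h3, h4]
    have := add_le_add (mul_le_mul_of_nonneg_left h5 (sq_nonneg (n : ℝ)))
      (mul_le_mul_of_nonneg_left h6 (Nat.cast_nonneg (α := ℝ) n))
    refine this.trans (le_of_eq ?_)
    rw [hS]; ring
  have h8 : S * (sqNorm p F / (S + 1)) ≤ sqNorm p F := by
    rw [mul_div_assoc', div_le_iff₀ hS1]
    nlinarith [sqNorm_nonneg p F]
  have h9 := sqNorm_density_sub h0 h1 hsub μ
  rw [h2]
  rw [← hGdef, ← hFdef] at h9
  have h10 : S * Q ≤ sqNorm p F + S * (S + 1) * (sqNorm p G - sqNorm p F) := by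
    rw [hQ, mul_add, h9]
    linarith
  linarith

/-- A hierarchy of differential inequalities, in which each function is controlled by a later one,
with an a priori exponential growth in the index. -/
theorem le_exp_of_hierarchy {a a' : ℕ → ℝ → ℝ} {T Γ C M A : ℝ} {N₀ k : ℕ} (hC : 0 ≤ C)
    (hM : 0 ≤ M) (hA : 0 ≤ A)
    (hcont : ∀ N, N₀ ≤ N → ContinuousOn (a N) (Set.Icc 0 T))
    (hderiv : ∀ N, N₀ ≤ N → ∀ t ∈ Set.Ico 0 T,
      HasDerivWithinAt (a N) (a' N t) (Set.Ici t) t)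
    (hineq : ∀ N, N₀ ≤ N → ∀ t ∈ Set.Ico 0 T,
      a' N t ≤ Γ * a N t + C * (a (N + k) t - a N t))
    (hzero : ∀ N, N₀ ≤ N → a N 0 ≤ 1)
    (hgrow : ∀ N, N₀ ≤ N → ∀ t ∈ Set.Icc 0 T, a N t ≤ M * A ^ N)
    {N : ℕ} (hN : N₀ ≤ N) {t : ℝ} (ht : t ∈ Set.Icc 0 T) : a N t ≤ Real.exp (Γ * t) := by
  set M' := M * Real.exp (|C - Γ| * T) with hM'
  -- iterating `J` times the inequality `(e^{(C - Γ) t} a N)' ≤ C e^{(C - Γ) t} a (N + k)`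
  have key : ∀ J N : ℕ, N₀ ≤ N → ∀ t ∈ Set.Icc 0 T,
      Real.exp ((C - Γ) * t) * a N t ≤ ∑ j ∈ Finset.range J, (C * t) ^ j / (j.factorial : ℝ)
        + (C * t) ^ J / (J.factorial : ℝ) * (M' * A ^ (N + J * k)) := by
    intro J
    induction J with
    | zero =>
      intro N hN t ht
      simp only [Finset.range_zero, Finset.sum_empty, pow_zero, Nat.factorial_zero, Nat.cast_one,
        div_one, one_mul, zero_add, zero_mul, add_zero]
      have e1 : Real.exp ((C - Γ) * t) ≤ Real.exp (|C - Γ| * T) := by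
        refine Real.exp_le_exp.2 ?_
        exact (mul_le_mul_of_nonneg_right (le_abs_self _) ht.1).trans
          (mul_le_mul_of_nonneg_left ht.2 (abs_nonneg _))
      calc Real.exp ((C - Γ) * t) * a N t ≤ Real.exp ((C - Γ) * t) * (M * A ^ N) :=
            mul_le_mul_of_nonneg_left (hgrow N hN t ht) (Real.exp_pos _).le
        _ ≤ Real.exp (|C - Γ| * T) * (M * A ^ N) :=
            mul_le_mul_of_nonneg_right e1 (by positivity)
        _ = M' * A ^ N := by rw [hM']; ring
    | succ J ih =>
      intro N hN
      have hmono : ∀ (j : ℕ) (s : ℝ), HasDerivAt (fun s : ℝ => (C * s) ^ (j + 1)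
          / ((j + 1).factorial : ℝ)) (C * ((C * s) ^ j / (j.factorial : ℝ))) s := by
        intro j s
        have := (((hasDerivAt_id s).const_mul C).pow (j + 1)).div_const ((j + 1).factorial : ℝ)
        refine this.congr_deriv ?_
        rw [Nat.factorial_succ]
        push_cast
        have h1 : (j.factorial : ℝ) ≠ 0 := by positivity
        have h2 : (j : ℝ) + 1 ≠ 0 := by positivity
        simp only [id]
        field_simp
      have hB : ∀ s, HasDerivAt (fun s : ℝ =>
          ∑ j ∈ Finset.range (J + 1), (C * s) ^ j / (j.factorial : ℝ)
            + (C * s) ^ (J + 1) / ((J + 1).factorial : ℝ) * (M' * A ^ (N + (J + 1) * k)))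
          (C * (∑ j ∈ Finset.range J, (C * s) ^ j / (j.factorial : ℝ)
            + (C * s) ^ J / (J.factorial : ℝ) * (M' * A ^ (N + k + J * k)))) s := by
        intro s
        simp_rw [Finset.sum_range_succ', pow_zero]
        have := ((HasDerivAt.fun_sum fun j (_ : j ∈ Finset.range J) => hmono j s).add_const
          (1 / ((Nat.factorial 0 : ℕ) : ℝ))).add
          ((hmono J s).mul_const (M' * A ^ (N + (J + 1) * k)))
        refine this.congr_deriv ?_
        rw [← Finset.mul_sum, show N + k + J * k = N + (J + 1) * k by ring]
        ring
      have he : ∀ s, HasDerivAt (fun s => Real.exp ((C - Γ) * s))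
          ((C - Γ) * Real.exp ((C - Γ) * s)) s := fun s => by
        have := ((hasDerivAt_id s).const_mul (C - Γ)).exp
        simpa [mul_comm] using this
      refine image_le_of_deriv_right_le_deriv_boundary
        (f' := fun s => (C - Γ) * Real.exp ((C - Γ) * s) * a N s
          + Real.exp ((C - Γ) * s) * a' N s)
        (B' := fun s => C * (∑ j ∈ Finset.range J, (C * s) ^ j / (j.factorial : ℝ)
            + (C * s) ^ J / (J.factorial : ℝ) * (M' * A ^ (N + k + J * k))))
        ?_ ?_ ?_ (fun s _ => (hB s).continuousAt.continuousWithinAt)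
        (fun s _ => (hB s).hasDerivWithinAt) ?_
      · exact (Continuous.continuousOn (by fun_prop)).mul (hcont N hN)
      · exact fun s hs => (he s).hasDerivWithinAt.mul (hderiv N hN s hs)
      · simp only [mul_zero, Real.exp_zero, one_mul, Finset.sum_range_succ', pow_succ]
        simpa using hzero N hN
      · intro s hs
        have h1 := ih (N + k) (by omega) s ⟨hs.1, hs.2.le⟩
        have h2 := mul_le_mul_of_nonneg_left (hineq N hN s hs) (Real.exp_pos ((C - Γ) * s)).le
        have h3 := mul_le_mul_of_nonneg_left h1 hC
        refine le_trans ?_ h3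
        linarith
  have hlim : Tendsto (fun J : ℕ => Real.exp (C * t)
      + (C * t * A ^ k) ^ J / (J.factorial : ℝ) * (M' * A ^ N)) atTop
      (𝓝 (Real.exp (C * t) + 0 * (M' * A ^ N))) :=
    ((FloorSemiring.tendsto_pow_div_factorial_atTop (C * t * A ^ k)).mul_const _).const_add _
  have hle : Real.exp ((C - Γ) * t) * a N t ≤ Real.exp (C * t) := by
    rw [zero_mul, add_zero] at hlim
    refine ge_of_tendsto' hlim fun J => (key J N hN t ht).trans ?_
    have h1 := Real.sum_le_exp_of_nonneg (mul_nonneg hC ht.1) J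
    have h2 : (C * t) ^ J / (J.factorial : ℝ) * (M' * A ^ (N + J * k))
        = (C * t * A ^ k) ^ J / (J.factorial : ℝ) * (M' * A ^ N) := by
      rw [pow_add, mul_comm J k, pow_mul, mul_pow]; ring
    linarith
  have h3 : Real.exp (C * t) = Real.exp ((C - Γ) * t) * Real.exp (Γ * t) := by
    rw [← Real.exp_add]; congr 1; ring
  rw [h3] at hle
  exact le_of_mul_le_mul_left hle (Real.exp_pos _)

lemma envGenerator_sum {c : Config → ℝ} {R : Finset ℤ} {r : ℤ → Config → ℝ} (n : ℕ)
    {ι : Type*} [Fintype ι] {g : ι → Config → ℝ} {Λ : Finset ℤ}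
    (hg : ∀ i, SupportedIn (g i) Λ) (a : ι → ℝ) (η : Config) :
    envGenerator c R r n (fun η => ∑ i, a i * g i η) η
      = ∑ i, a i * envGenerator c R r n (g i) η := by
  have hs : SupportedIn (fun η => ∑ i, a i * g i η) Λ :=
    supportedIn_finsetSum fun i _ ξ ζ h => by simp only [hg i ξ ζ h]
  rw [envGenerator_eq_sum c R r n hs (Finset.Subset.refl _)]
  simp_rw [fun i => envGenerator_eq_sum c R r n (hg i) (Finset.Subset.refl _) η, mul_add,
    Finset.sum_add_distrib, ← Finset.sum_sub_distrib, Finset.mul_sum]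
  congr 1
  · rw [Finset.sum_comm]
    exact Finset.sum_congr rfl fun i _ => Finset.sum_congr rfl fun y _ => by ring
  · rw [Finset.sum_comm]
    exact Finset.sum_congr rfl fun i _ => Finset.sum_congr rfl fun y _ => by ring

/-- `L²` bound for weak solutions of the forward equation `∂ₜ mₜ(g) = mₜ(L g + V g)` started from
`ν_p`: if the quadratic form of `L + V` in `L²(ν_p)` is bounded by `Γ`, then so is, up to an
additive constant, the exponential growth rate of the norm of `mₜ` as a functional on `L²(ν_p)`.
The measures `mₜ` are not assumed to be absolutely continuous with respect to `ν_p`: the bound is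
proved for their densities in finite boxes. -/
theorem abs_integral_le_of_forward_equation {p : unitInterval} (h0 : 0 < (p : ℝ))
    (h1 : (p : ℝ) < 1) {c : Config → ℝ} (hc : IsLocal c) {R : Finset ℤ} {r : ℤ → Config → ℝ}
    (hr : ∀ z ∈ R, IsLocal (r z)) (n : ℕ) {V : Config → ℝ} (hV : IsLocal V) {Γ : ℝ}
    (hΓ : ∀ F : Config → ℝ, IsLocal F →
      ∫ η, F η * (envGenerator c R r n F η + V η * F η) ∂bernoulliProduct p ≤ Γ * sqNorm p F)
    {T M : ℝ} (m : ℝ → Measure Config) [∀ t, IsFiniteMeasure (m t)] (hm0 : m 0 = bernoulliProduct p)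
    (hM : ∀ t ∈ Set.Icc 0 T, (m t).real Set.univ ≤ M)
    (hcont : ∀ g, IsLocal g → ContinuousOn (fun t => ∫ η, g η ∂m t) (Set.Icc 0 T))
    (hderiv : ∀ g, IsLocal g → ∀ t ∈ Set.Ico 0 T, HasDerivWithinAt (fun t => ∫ η, g η ∂m t)
      (∫ η, (envGenerator c R r n g η + V η * g η) ∂m t) (Set.Ici t) t)
    {g : Config → ℝ} (hg : IsLocal g) {t : ℝ} (ht : t ∈ Set.Icc 0 T) :
    |∫ η, g η ∂m t| ≤ Real.exp ((Γ + 1) * t) * √(sqNorm p g) := by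
  obtain ⟨k, N₀, C, hC, hk⟩ := exists_integral_generator_density_le h0 h1 hc hr n hV
  set q := min (p : ℝ) (1 - p) with hq
  have hq0 : 0 < q := lt_min h0 (by linarith)
  have hbound : ∀ N, N₀ ≤ N → sqNorm p (density p (box N) (m t)) ≤ Real.exp (2 * (Γ + 1) * t) := by
    intro N hN
    refine le_exp_of_hierarchy (a := fun N t => sqNorm p (density p (box N) (m t)))
      (a' := fun N t => 2 * ∫ η, (envGenerator c R r n (density p (box N) (m t)) η
        + V η * density p (box N) (m t) η) ∂m t) (T := T) (C := 2 * C) (M := M ^ 2 / q)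
        (A := (1 / q) ^ 2) (N₀ := N₀) (k := k) (by positivity) (by positivity) (by positivity)
        ?_ ?_ ?_ ?_ ?_ hN ht
    · intro N _
      simp_rw [sqNorm_density_eq_sum h0 h1]
      exact continuousOn_finsetSum _ fun σ _ =>
        ((hcont _ (isLocal_patternFun _ σ)).pow 2).div_const _
    · intro N _ s hs
      simp_rw [sqNorm_density_eq_sum h0 h1]
      have hd := HasDerivWithinAt.fun_sum (u := (Finset.univ : Finset (box N → Bool)))
        fun σ _ => ((hderiv _ (isLocal_patternFun (box N) σ) s hs).pow 2).div_const
          (∫ ζ, patternFun (box N) σ ζ ∂bernoulliProduct p)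
      refine hd.congr_deriv (Eq.symm ?_)
      have e : ∀ η, envGenerator c R r n (density p (box N) (m s)) η
            + V η * density p (box N) (m s) η
          = ∑ σ : box N → Bool, (∫ ζ, patternFun (box N) σ ζ ∂m s)
            / (∫ ζ, patternFun (box N) σ ζ ∂bernoulliProduct p)
            * (envGenerator c R r n (patternFun (box N) σ) η
              + V η * patternFun (box N) σ η) := fun η => by
        have := envGenerator_sum (c := c) (R := R) (r := r) n (supportedIn_patternFun (box N))
          (fun σ => (∫ ζ, patternFun (box N) σ ζ ∂m s)
            / (∫ ζ, patternFun (box N) σ ζ ∂bernoulliProduct p)) η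
        simp_rw [mul_add, Finset.sum_add_distrib]
        rw [← this]
        simp only [density, Finset.mul_sum]
        congr 1
        exact Finset.sum_congr rfl fun σ _ => by ring
      simp_rw [e]
      rw [integral_finsetSum _ fun σ _ => ((((isLocal_envGenerator hc hr n
        (isLocal_patternFun _ σ)).add (hV.mul (isLocal_patternFun _ σ))).const_mul _).integrable _),
        Finset.mul_sum]
      refine Finset.sum_congr rfl fun σ _ => ?_
      rw [integral_const_mul]
      simp
      ring
    · intro N hN s hs
      have h2 := hk N hN (m s)
      have h3 := hΓ _ (isLocal_density p (box N) (m s))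
      linarith
    · intro N _
      simp only [hm0]
      exact (sqNorm_density_self h0 h1 _).le
    · intro N _ s hs
      refine (sqNorm_density_le h0 h1 _ _).trans ?_
      have e : (box N).card = 2 * N + 1 := by simp [box]; omega
      rw [e, ← hq]
      calc (m s).real Set.univ ^ 2 / q ^ (2 * N + 1) ≤ M ^ 2 / q ^ (2 * N + 1) := by
            gcongr; exact hM s hs
        _ = M ^ 2 / q * ((1 / q) ^ 2) ^ N := by
            rw [← pow_mul, one_div, inv_pow, pow_succ]; field_simp; ring
  -- in a box that contains the support of `g`, apply the Cauchy–Schwarz inequality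
  obtain ⟨N₁, hN₁⟩ := hg.exists_box
  set N := max N₀ N₁
  rw [← integral_mul_density h0 h1 (m t) (hN₁ N (le_max_right _ _))]
  refine (abs_integral_mul_le p hg (isLocal_density _ _ _)).trans ?_
  rw [mul_comm]
  refine mul_le_mul_of_nonneg_right ?_ (Real.sqrt_nonneg _)
  refine (Real.sqrt_le_sqrt (hbound N (le_max_left _ _))).trans (le_of_eq ?_)
  rw [Real.sqrt_eq_iff_mul_self_eq (Real.exp_pos _).le (Real.exp_pos _).le, ← Real.exp_add]
  congr 1; ring

/-! ### Right-continuous processes -/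

/-- A right-continuous process is jointly measurable, as the limit of the processes that are
evaluated at the next point of the grid `k⁻¹ ℤ`. -/
lemma measurable_uncurry_of_rightContinuous {S : Type*} [MeasurableSpace S] {Z : ℝ → S → ℝ}
    (hm : ∀ u, Measurable (Z u))
    (hrc : ∀ ω u, ContinuousWithinAt (fun v => Z v ω) (Set.Ici u) u) :
    Measurable (Function.uncurry Z) := by
  have hgrid : ∀ u : ℝ, Tendsto (fun k : ℕ => ((⌊(k + 1 : ℝ) * u⌋ : ℝ) + 1) / (k + 1)) atTop
      (𝓝[Set.Ici u] u) := by
    intro u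
    refine tendsto_nhdsWithin_iff.2 ⟨?_, Eventually.of_forall fun k => ?_⟩
    · have h1 : Tendsto (fun k : ℕ => u + 1 / ((k : ℝ) + 1)) atTop (𝓝 (u + 0)) :=
        tendsto_one_div_add_atTop_nhds_zero_nat.const_add u
      rw [add_zero] at h1
      refine tendsto_of_tendsto_of_tendsto_of_le_of_le tendsto_const_nhds h1 (fun k => ?_)
        fun k => ?_
      · have hk : (0 : ℝ) < k + 1 := by positivity
        rw [le_div_iff₀ hk]
        nlinarith [Int.lt_floor_add_one ((k + 1 : ℝ) * u)]
      · have hk : (0 : ℝ) < k + 1 := by positivity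
        simp only
        rw [div_le_iff₀ hk, add_mul u, one_div, inv_mul_cancel₀ hk.ne']
        nlinarith [Int.floor_le ((k + 1 : ℝ) * u)]
    · have hk : (0 : ℝ) < k + 1 := by positivity
      rw [Set.mem_Ici, le_div_iff₀ hk]
      nlinarith [Int.lt_floor_add_one ((k + 1 : ℝ) * u)]
  refine measurable_of_tendsto_metrizable
    (f := fun (k : ℕ) (q : ℝ × S) => Z (((⌊(k + 1 : ℝ) * q.1⌋ : ℝ) + 1) / (k + 1)) q.2)
    (fun k => ?_) ?_
  · have h1 : Measurable fun q : ℤ × S => Z (((q.1 : ℝ) + 1) / ((k : ℝ) + 1)) q.2 :=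
      measurable_from_prod_countable_right fun j => by simpa using hm _
    exact h1.comp ((Int.measurable_floor.comp (measurable_fst.const_mul _)).prodMk measurable_snd)
  · rw [tendsto_pi_nhds]
    rintro ⟨u, ω⟩
    exact (hrc ω u).tendsto.comp (hgrid u)

lemma ContinuousWithinAt.comp_monotone {f : ℝ → ℝ} {Z : ℝ → ℝ} (hf : Continuous f)
    (hmono : Monotone f) (hZ : ∀ u, ContinuousWithinAt Z (Set.Ici u) u) (u : ℝ) :
    ContinuousWithinAt (fun v => Z (f v)) (Set.Ici u) u :=
  (hZ (f u)).comp hf.continuousWithinAt fun _ hv => hmono hv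

lemma intervalIntegrable_of_bound {Z : ℝ → ℝ} (hm : Measurable Z) {C : ℝ} (hC : ∀ u, |Z u| ≤ C)
    (a b : ℝ) : IntervalIntegrable Z volume a b := by
  rw [intervalIntegrable_iff]
  exact Measure.integrableOn_of_bounded (by simp) hm.aestronglyMeasurable
    (ae_of_all _ hC)

lemma measurable_of_rightContinuous {Z : ℝ → ℝ}
    (hrc : ∀ u, ContinuousWithinAt Z (Set.Ici u) u) : Measurable Z := by
  have h := measurable_uncurry_of_rightContinuous (S := Unit) (Z := fun u _ => Z u)
    (fun _ => measurable_const) fun _ u => hrc u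
  exact h.comp (measurable_id.prodMk (measurable_const (a := ())))

lemma hasDerivWithinAt_integral_of_rightContinuous {Z : ℝ → ℝ}
    (hrc : ∀ u, ContinuousWithinAt Z (Set.Ici u) u) {C : ℝ} (hC : ∀ u, |Z u| ≤ C) (a t : ℝ) :
    HasDerivWithinAt (fun s => ∫ u in a..s, Z u) (Z t) (Set.Ici t) t :=
  intervalIntegral.integral_hasDerivWithinAt_right
    (intervalIntegrable_of_bound (measurable_of_rightContinuous hrc) hC a t)
    ((measurable_of_rightContinuous hrc).stronglyMeasurable.stronglyMeasurableAtFilter)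
    ((hrc t).mono Set.Ioi_subset_Ici_self)

/-! ### The environment process and test functions with cut-off -/

/-- The environment process at real times; it is constant on `(-∞, 0]`. -/
def envAt {S : Type*} (η : ℝ≥0 → S → Config) (x : ℝ≥0 → S → ℤ) (u : ℝ) (ω : S) : Config :=
  environment η x u.toNNReal ω

lemma environment_eq_shift {S : Type*} (η : ℝ≥0 → S → Config) (x : ℝ≥0 → S → ℤ) (t : ℝ≥0)
    (ω : S) :
    environment η x t ω = shift (x t ω) (η t ω) := by
  funext y; simp [environment, shift, add_comm]

lemma measurable_pair {S : Type*} {m : MeasurableSpace S} {η : ℝ≥0 → S → Config}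
    {x : ℝ≥0 → S → ℤ} {f : Config → ℤ → ℝ}
    (hf : ∀ z, IsLocal fun ζ => f ζ z) {t : ℝ≥0} (hη : Measurable[m] (η t))
    (hx : Measurable[m] (x t)) : Measurable[m] fun ω => f (η t ω) (x t ω) := by
  have h1 : Measurable fun q : Config × ℤ => f q.1 q.2 :=
    measurable_from_prod_countable_left fun z => (hf z).measurable
  exact h1.comp (hη.prodMk hx)

/-- A local function of the environment, cut off when the walk leaves `[-M, M]`. This is a test
function of the pair, unlike the function without cut-off. -/
def cutoff (g : Config → ℝ) (M : ℕ) (ζ : Config) (z : ℤ) : ℝ :=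
  if |z| ≤ M then g (shift z ζ) else 0

lemma isTestFunction_cutoff {g : Config → ℝ} (hg : IsLocal g) (M : ℕ) :
    IsTestFunction (cutoff g M) := by
  obtain ⟨N, hN⟩ := hg.exists_box
  obtain ⟨C, hC0, hC⟩ := hg.exists_bound
  refine ⟨⟨box (N + M), (box (N + M)).finite_toSet, fun z ζ ξ hζ => ?_⟩, C, fun ζ z => ?_⟩
  · by_cases hz : |z| ≤ M
    · simp only [cutoff, if_pos hz]
      refine hN N le_rfl _ _ fun y hy => hζ _ ?_
      have hy' := mem_box.1 (Finset.mem_coe.1 hy)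
      have := abs_le.1 hz
      exact Finset.mem_coe.2 (mem_box.2 (by push_cast; omega))
    · simp only [cutoff, if_neg hz]
  · by_cases hz : |z| ≤ M
    · simpa only [cutoff, if_pos hz] using hC _
    · simpa only [cutoff, if_neg hz, abs_zero] using hC0

lemma shift_swapAt_comm (z y : ℤ) (ζ : Config) :
    shift z (swapAt y ζ) = swapAt (y - z) (shift z ζ) := by
  funext w
  simp only [shift, swapAt]
  congr 1
  simp only [Equiv.swap_apply_def]
  split_ifs <;> omega

/-- The exchange part of `generator` is the generator without jumps `envGenerator c ∅ r n`, seen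
from the walk. -/
lemma generator_cutoff (c : Config → ℝ) (R : Finset ℤ) (r : ℤ → Config → ℝ) (n : ℕ)
    (g : Config → ℝ) (M : ℕ) (ζ : Config) (z : ℤ) :
    generator c R r n (cutoff g M) ζ z
      = (if |z| ≤ M then (1 : ℝ) else 0) * envGenerator c ∅ r n g (shift z ζ)
        + n * ∑ w ∈ R, r w (shift z ζ) * (cutoff g M ζ (z + w) - cutoff g M ζ z) := by
  rw [generator, envGenerator, Finset.sum_empty, mul_zero, add_zero]
  congr 1
  rw [mul_left_comm]
  congr 1
  rw [← tsum_mul_left]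
  rw [← (Equiv.subRight z).tsum_eq fun y => (if |z| ≤ M then (1 : ℝ) else 0) *
    (c (shift y (shift z ζ)) * (g (swapAt y (shift z ζ)) - g (shift z ζ)))]
  refine tsum_congr fun y => ?_
  simp only [cutoff, Equiv.subRight_apply, shift_swapAt_comm, shift_shift, sub_add_cancel]
  split_ifs <;> simp

lemma generator_cutoff_eq_envGenerator (c : Config → ℝ) (R : Finset ℤ) (r : ℤ → Config → ℝ)
    (n : ℕ) (g : Config → ℝ) (ζ : Config) (z : ℤ) :
    ∀ᶠ M : ℕ in atTop,
      generator c R r n (cutoff g M) ζ z = envGenerator c R r n g (shift z ζ) := by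
  filter_upwards [eventually_ge_atTop (z.natAbs + R.sup Int.natAbs)] with M hM
  have hz : |z| ≤ M := abs_le.2 (by omega)
  have hzw : ∀ w ∈ R, |z + w| ≤ M := fun w hw => by
    have : w.natAbs ≤ R.sup Int.natAbs := Finset.le_sup (f := Int.natAbs) hw
    exact abs_le.2 (by omega)
  rw [generator_cutoff, if_pos hz, one_mul, envGenerator, envGenerator, Finset.sum_empty, mul_zero,
    add_zero]
  congr 2
  refine Finset.sum_congr rfl fun w hw => ?_
  simp only [cutoff, if_pos hz, if_pos (hzw w hw), shift_shift, add_comm]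

/-! ### The forward equation for the environment process -/

section

variable {S : Type*} [mS : MeasurableSpace S] {P : Measure S} {c : Config → ℝ} {R : Finset ℤ}
  {r : ℤ → Config → ℝ} {ρ : unitInterval} {n : ℕ} {η : ℝ≥0 → S → Config} {x : ℝ≥0 → S → ℤ}

/-- Local functions are continuous and `ℤ` is discrete, so that functions of the pair inherit the
right-continuity of the paths. -/
lemma rightContinuous_pair (h : IsWalkInExclusion c R r ρ n P η x) {f : Config → ℤ → ℝ}
    (hf : ∀ z, IsLocal fun ζ => f ζ z) (ω : S) (u : ℝ) :
    ContinuousWithinAt (fun v : ℝ => f (η v.toNNReal ω) (x v.toNNReal ω)) (Set.Ici u) u := by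
  have h1 : ContinuousWithinAt (fun t => η t ω) (Set.Ici u.toNNReal) u.toNNReal :=
    (h.cadlag_env ω _).1
  have h2 : ContinuousWithinAt (fun t => x t ω) (Set.Ici u.toNNReal) u.toNNReal :=
    (h.cadlag_walk ω _).1
  have h3 : ContinuousWithinAt Real.toNNReal (Set.Ici u) u :=
    continuous_real_toNNReal.continuousWithinAt
  have h4 : Set.MapsTo Real.toNNReal (Set.Ici u) (Set.Ici u.toNNReal) :=
    fun v hv => Real.toNNReal_mono hv
  have hη := h1.comp h3 h4
  have hx := h2.comp h3 h4
  have hfη : ContinuousWithinAt (fun v : ℝ => f (η v.toNNReal ω) (x u.toNNReal ω))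
      (Set.Ici u) u := (hf (x u.toNNReal ω)).continuous.continuousAt.comp_continuousWithinAt hη
  refine hfη.congr_of_eventuallyEq ?_ rfl
  have : ∀ᶠ v in 𝓝[Set.Ici u] u, x v.toNNReal ω = x u.toNNReal ω :=
    hx.eventually (show ∀ᶠ z in 𝓝 (x u.toNNReal ω), z = x u.toNNReal ω by simp)
  filter_upwards [this] with v hv
  rw [hv]

lemma measurable_pair_filtration (h : IsWalkInExclusion c R r ρ n P η x) {f : Config → ℤ → ℝ}
    (hf : ∀ z, IsLocal fun ζ => f ζ z) {s t : ℝ≥0} (hst : s ≤ t) :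
    Measurable[canonicalFiltration η x h.measurable_env h.measurable_walk t]
      fun ω => f (η s ω) (x s ω) := by
  have hle : MeasurableSpace.comap (η s) inferInstance ⊔ MeasurableSpace.comap (x s) inferInstance
      ≤ canonicalFiltration η x h.measurable_env h.measurable_walk t :=
    le_iSup₂_of_le s hst le_rfl
  refine measurable_pair hf ?_ ?_
  · exact Measurable.of_comap_le (le_sup_left.trans hle)
  · exact Measurable.of_comap_le (le_sup_right.trans hle)

lemma measurable_environment (h : IsWalkInExclusion c R r ρ n P η x) (t : ℝ≥0) :
    Measurable (environment η x t) := by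
  refine measurable_pi_lambda _ fun y => ?_
  have h1 : Measurable fun q : Config × ℤ => q.1 (y + q.2) :=
    measurable_from_prod_countable_left fun z => measurable_pi_apply (y + z)
  exact h1.comp ((h.measurable_env t).prodMk (h.measurable_walk t))

variable [IsProbabilityMeasure P]

/-- The martingale problem, tested against a bounded random variable `Z` from the past. -/
lemma integral_mul_martingale (h : IsWalkInExclusion c R r ρ n P η x) {f : Config → ℤ → ℝ}
    (hf : IsTestFunction f) {Gf : Config → ℤ → ℝ} (hG : generator c R r n f = Gf)
    (hGl : ∀ z, IsLocal fun ζ => Gf ζ z) {CG : ℝ} (hGb : ∀ ζ z, |Gf ζ z| ≤ CG)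
    {s t : ℝ} (hs : 0 ≤ s) (hst : s ≤ t) {Z : S → ℝ} {CZ : ℝ} (hZb : ∀ ω, |Z ω| ≤ CZ)
    (hZ : StronglyMeasurable[canonicalFiltration η x h.measurable_env h.measurable_walk
      s.toNNReal] Z) :
    ∫ ω, Z ω * f (η t.toNNReal ω) (x t.toNNReal ω) ∂P
      = ∫ ω, Z ω * f (η s.toNNReal ω) (x s.toNNReal ω) ∂P
        + ∫ u in s..t, ∫ ω, Z ω * Gf (η u.toNNReal ω) (x u.toNNReal ω) ∂P := by
  subst hG
  set 𝓕 := canonicalFiltration η x h.measurable_env h.measurable_walk with h𝓕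
  have hfl : ∀ z, IsLocal fun ζ => f ζ z := fun z => by
    obtain ⟨⟨A, hA, hfA⟩, _⟩ := hf; exact ⟨A, hA, hfA z⟩
  obtain ⟨Cf, hCf⟩ := hf.2
  have hst' : s.toNNReal ≤ t.toNNReal := Real.toNNReal_mono hst
  set Mt : ℝ≥0 → S → ℝ := fun t ω => f (η t ω) (x t ω) - f (η 0 ω) (x 0 ω) -
    ∫ u in (0 : ℝ)..t, generator c R r n f (η u.toNNReal ω) (x u.toNNReal ω) with hMt
  have hmart : Martingale Mt 𝓕 P := h.martingale f hf
  have hZm : Measurable Z := (hZ.mono (𝓕.le _)).measurable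
  have hZi : ∀ Y : S → ℝ, Integrable Y P → Integrable (fun ω => Z ω * Y ω) P := fun Y hY =>
    hY.bdd_mul hZm.aestronglyMeasurable (ae_of_all _ hZb)
  have h1 : ∫ ω, Z ω * Mt t.toNNReal ω ∂P = ∫ ω, Z ω * Mt s.toNNReal ω ∂P := by
    have h2 := condExp_mul_of_stronglyMeasurable_left (μ := P) (m := 𝓕 s.toNNReal) hZ
      (hZi _ (hmart.integrable t.toNNReal)) (hmart.integrable t.toNNReal)
    rw [← integral_condExp (𝓕.le s.toNNReal)]
    refine integral_congr_ae ?_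
    filter_upwards [h2, hmart.condExp_ae_eq hst'] with ω h3 h4
    change (P[Z * Mt t.toNNReal | 𝓕 s.toNNReal]) ω = _
    rw [h3, Pi.mul_apply, h4]
  have hjoint : Measurable (Function.uncurry fun (u : ℝ) (ω : S) =>
      generator c R r n f (η u.toNNReal ω) (x u.toNNReal ω)) :=
    measurable_uncurry_of_rightContinuous
      (fun u => measurable_pair hGl (h.measurable_env _) (h.measurable_walk _))
      fun ω u => rightContinuous_pair h hGl ω u
  have hii : ∀ (ω : S) (a b : ℝ), IntervalIntegrable
      (fun u : ℝ => generator c R r n f (η u.toNNReal ω) (x u.toNNReal ω)) volume a b :=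
    fun ω a b => intervalIntegrable_of_bound
      (hjoint.comp (measurable_id.prodMk measurable_const)) (fun u => hGb _ _) a b
  have hft : ∀ t, Measurable fun ω => f (η t ω) (x t ω) := fun t =>
    measurable_pair hfl (h.measurable_env _) (h.measurable_walk _)
  have hfi : ∀ t, Integrable (fun ω => f (η t ω) (x t ω)) P := fun t =>
    Integrable.of_bound (hft t).aestronglyMeasurable Cf (ae_of_all _ fun ω => hCf _ _)
  have hdiff : ∀ ω, Z ω * Mt t.toNNReal ω - Z ω * Mt s.toNNReal ω
      = Z ω * f (η t.toNNReal ω) (x t.toNNReal ω) - Z ω * f (η s.toNNReal ω) (x s.toNNReal ω)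
        - ∫ u in s..t, Z ω * generator c R r n f (η u.toNNReal ω) (x u.toNNReal ω) := fun ω => by
    rw [intervalIntegral.integral_const_mul, ← intervalIntegral.integral_interval_sub_left
      (hii ω 0 t) (hii ω 0 s)]
    simp only [hMt, Real.coe_toNNReal s hs, Real.coe_toNNReal t (hs.trans hst)]
    ring
  have hprod : Integrable (Function.uncurry fun (u : ℝ) (ω : S) =>
      Z ω * generator c R r n f (η u.toNNReal ω) (x u.toNNReal ω))
      ((volume.restrict (Set.Ioc s t)).prod P) := by
    refine Integrable.of_bound
      ((hZm.comp measurable_snd).mul hjoint).aestronglyMeasurable (CZ * CG)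
      (ae_of_all _ fun q => ?_)
    simp only [Function.uncurry, Real.norm_eq_abs, abs_mul]
    exact mul_le_mul (hZb _) (hGb _ _) (abs_nonneg _) ((abs_nonneg _).trans (hZb q.2))
  have hint : Integrable (fun ω => ∫ u in s..t,
      Z ω * generator c R r n f (η u.toNNReal ω) (x u.toNNReal ω)) P := by
    simp_rw [intervalIntegral.integral_of_le hst]
    exact hprod.integral_prod_right
  have h5 : ∫ ω, (Z ω * Mt t.toNNReal ω - Z ω * Mt s.toNNReal ω) ∂P = 0 := by
    rw [integral_sub (hZi _ (hmart.integrable _)) (hZi _ (hmart.integrable _)), h1, sub_self]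
  simp_rw [hdiff] at h5
  have hsub : Integrable (fun ω => Z ω * f (η t.toNNReal ω) (x t.toNNReal ω)
      - Z ω * f (η s.toNNReal ω) (x s.toNNReal ω)) P := (hZi _ (hfi _)).sub (hZi _ (hfi _))
  rw [integral_sub hsub hint,
    integral_sub (hZi _ (hfi _)) (hZi _ (hfi _))] at h5
  have h6 : ∫ ω, (∫ u in s..t, Z ω * generator c R r n f (η u.toNNReal ω) (x u.toNNReal ω)) ∂P
      = ∫ u in s..t, ∫ ω, Z ω * generator c R r n f (η u.toNNReal ω) (x u.toNNReal ω) ∂P := by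
    simp_rw [intervalIntegral.integral_of_le hst]
    exact (integral_integral_swap hprod).symm
  rw [h6] at h5
  linarith

/-- The forward equation for the environment process, tested against a bounded random variable
from the past. -/
lemma integral_mul_environment (hc : IsLocal c) (hr : ∀ z ∈ R, IsLocal (r z))
    (h : IsWalkInExclusion c R r ρ n P η x) {g : Config → ℝ} (hg : IsLocal g)
    {s t : ℝ} (hs : 0 ≤ s) (hst : s ≤ t) {Z : S → ℝ} {CZ : ℝ} (hZb : ∀ ω, |Z ω| ≤ CZ)
    (hZ : StronglyMeasurable[canonicalFiltration η x h.measurable_env h.measurable_walk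
      s.toNNReal] Z) :
    ∫ ω, Z ω * g (envAt η x t ω) ∂P = ∫ ω, Z ω * g (envAt η x s ω) ∂P
        + ∫ u in s..t, ∫ ω, Z ω * envGenerator c R r n g (envAt η x u ω) ∂P := by
  obtain ⟨Cg, hCg0, hCg⟩ := hg.exists_bound
  obtain ⟨Cr, hCr0, hCr⟩ := exists_common_bound R hr
  have hel := isLocal_envGenerator hc (R := ∅) (r := r) (by simp) n hg
  obtain ⟨Ce, hCe0, hCe⟩ := hel.exists_bound
  have hcb : ∀ M ζ z, |cutoff g M ζ z| ≤ Cg := fun M ζ z => by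
    simp only [cutoff]; split_ifs
    · exact hCg _
    · simpa using hCg0
  have hcl : ∀ M z, IsLocal fun ζ => cutoff g M ζ z := fun M z => by
    simp only [cutoff]; split_ifs
    · exact hg.shift z
    · exact isLocal_const 0
  have hGl : ∀ M z, IsLocal fun ζ => generator c R r n (cutoff g M) ζ z := fun M z => by
    simp_rw [generator_cutoff]
    exact ((hel.shift z).const_mul _).add ((isLocal_finsetSum _ fun w hw =>
      ((hr w hw).shift z).mul ((hcl M _).sub (hcl M _))).const_mul _)
  set CG : ℝ := Ce + n * (R.card * (Cr * (Cg + Cg))) with hCG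
  have hGb : ∀ M ζ z, |generator c R r n (cutoff g M) ζ z| ≤ CG := fun M ζ z => by
    rw [generator_cutoff]
    refine (abs_add_le _ _).trans (add_le_add ?_ ?_)
    · split_ifs
      · simpa using hCe _
      · simpa using hCe0
    · rw [abs_mul, Nat.abs_cast]
      refine mul_le_mul_of_nonneg_left ((Finset.abs_sum_le_sum_abs _ _).trans ?_) (by positivity)
      rw [← nsmul_eq_mul]
      refine Finset.sum_le_card_nsmul _ _ _ fun w hw => ?_
      rw [abs_mul]
      exact mul_le_mul (hCr w hw _) ((abs_sub _ _).trans (add_le_add (hcb _ _ _) (hcb _ _ _)))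
        (abs_nonneg _) hCr0
  have hZm : Measurable Z := (hZ.mono (Filtration.le _ _)).measurable
  have hkey : ∀ M : ℕ, _ := fun M => integral_mul_martingale h (isTestFunction_cutoff hg M) rfl
    (hGl M) (hGb M) hs hst hZb hZ
  -- the cut-off is removed by dominated convergence
  have hCZ : ∀ ω : S, 0 ≤ CZ := fun ω => (abs_nonneg _).trans (hZb ω)
  have hlimf : ∀ u : ℝ, Tendsto (fun M : ℕ =>
      ∫ ω, Z ω * cutoff g M (η u.toNNReal ω) (x u.toNNReal ω) ∂P) atTop
      (𝓝 (∫ ω, Z ω * g (envAt η x u ω) ∂P)) := fun u => by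
    refine tendsto_integral_of_dominated_convergence (fun _ => CZ * Cg) (fun M => ?_)
      (integrable_const _) (fun M => ae_of_all _ fun ω => ?_) (ae_of_all _ fun ω => ?_)
    · exact (hZm.mul (measurable_pair (hcl M) (h.measurable_env _)
        (h.measurable_walk _))).aestronglyMeasurable
    · rw [Real.norm_eq_abs, abs_mul]
      exact mul_le_mul (hZb _) (hcb _ _ _) (abs_nonneg _) (hCZ ω)
    · refine tendsto_const_nhds.congr' ?_
      filter_upwards [eventually_ge_atTop (x u.toNNReal ω).natAbs] with M hM
      have : |x u.toNNReal ω| ≤ M := abs_le.2 (by omega)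
      simp only [cutoff, if_pos this, envAt, environment_eq_shift]
  have hlimG : ∀ u : ℝ, Tendsto (fun M : ℕ =>
      ∫ ω, Z ω * generator c R r n (cutoff g M) (η u.toNNReal ω) (x u.toNNReal ω) ∂P) atTop
      (𝓝 (∫ ω, Z ω * envGenerator c R r n g (envAt η x u ω) ∂P)) := fun u => by
    refine tendsto_integral_of_dominated_convergence (fun _ => CZ * CG) (fun M => ?_)
      (integrable_const _) (fun M => ae_of_all _ fun ω => ?_) (ae_of_all _ fun ω => ?_)
    · exact (hZm.mul (measurable_pair (hGl M) (h.measurable_env _)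
        (h.measurable_walk _))).aestronglyMeasurable
    · rw [Real.norm_eq_abs, abs_mul]
      exact mul_le_mul (hZb _) (hGb _ _ _) (abs_nonneg _) (hCZ ω)
    · refine tendsto_const_nhds.congr' ?_
      filter_upwards [generator_cutoff_eq_envGenerator c R r n g (η u.toNNReal ω)
        (x u.toNNReal ω)] with M hM
      rw [hM, envAt, environment_eq_shift]
  have hlimI : Tendsto (fun M : ℕ => ∫ u in s..t,
      ∫ ω, Z ω * generator c R r n (cutoff g M) (η u.toNNReal ω) (x u.toNNReal ω) ∂P) atTop
      (𝓝 (∫ u in s..t, ∫ ω, Z ω * envGenerator c R r n g (envAt η x u ω) ∂P)) := by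
    refine intervalIntegral.tendsto_integral_filter_of_dominated_convergence
      (fun _ => ∫ _, CZ * CG ∂P) (Eventually.of_forall fun M => ?_)
      (Eventually.of_forall fun M => ae_of_all _ fun u _ => ?_)
      intervalIntegrable_const (ae_of_all _ fun u _ => hlimG u)
    · have hj : Measurable (Function.uncurry fun (u : ℝ) (ω : S) =>
          generator c R r n (cutoff g M) (η u.toNNReal ω) (x u.toNNReal ω)) :=
        measurable_uncurry_of_rightContinuous
          (fun u => measurable_pair (hGl M) (h.measurable_env _) (h.measurable_walk _))
          fun ω u => rightContinuous_pair h (hGl M) ω u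
      exact (((hZm.comp measurable_snd).mul hj).stronglyMeasurable.integral_prod_right
        (f := fun (u : ℝ) (ω : S) => Z ω *
          generator c R r n (cutoff g M) (η u.toNNReal ω) (x u.toNNReal ω))).aestronglyMeasurable
    · refine norm_integral_le_of_norm_le (integrable_const _) (ae_of_all _ fun ω => ?_)
      rw [Real.norm_eq_abs, abs_mul]
      exact mul_le_mul (hZb _) (hGb _ _ _) (abs_nonneg _) (hCZ ω)
  exact tendsto_nhds_unique (hlimf t) (((hlimf s).add hlimI).congr fun M => (hkey M).symm)

end

/-! ### Feynman–Kac weights -/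

lemma measurable_integral_of_rightContinuous {S : Type*} [MeasurableSpace S] {Z : ℝ → S → ℝ}
    (hm : ∀ u, Measurable (Z u))
    (hrc : ∀ ω u, ContinuousWithinAt (fun v => Z v ω) (Set.Ici u) u) (a b : ℝ) :
    Measurable fun ω => ∫ u in a..b, Z u ω := by
  have h := (measurable_uncurry_of_rightContinuous hm hrc).stronglyMeasurable
  simp only [intervalIntegral]
  exact (h.integral_prod_left (μ := volume.restrict (Set.Ioc a b))).measurable.sub
    (h.integral_prod_left (μ := volume.restrict (Set.Ioc b a))).measurable

lemma abs_exp_sub_exp_le {a b C : ℝ} (ha : a ≤ C) (hb : b ≤ C) :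
    |Real.exp a - Real.exp b| ≤ Real.exp C * |a - b| := by
  have key : ∀ a b : ℝ, a ≤ C → Real.exp a - Real.exp b ≤ Real.exp C * |a - b| := by
    intro a b ha
    have h1 : Real.exp b = Real.exp a * Real.exp (b - a) := by rw [← Real.exp_add]; congr 1; ring
    have h2 := Real.add_one_le_exp (b - a)
    have h3 : Real.exp a - Real.exp b ≤ Real.exp a * (a - b) := by
      rw [h1]; nlinarith [Real.exp_pos a]
    exact h3.trans ((mul_le_mul_of_nonneg_left (le_abs_self _) (Real.exp_pos a).le).trans
      (mul_le_mul_of_nonneg_right (Real.exp_le_exp.2 ha) (abs_nonneg _)))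
  rw [abs_le]
  have h1 := key a b ha
  have h2 := key b a hb
  rw [abs_sub_comm b a] at h2
  constructor <;> linarith

/-- The Feynman–Kac weight `exp (∫₀ᵗ V(ξ_u) du)`. -/
def fkWeight {S : Type*} (η : ℝ≥0 → S → Config) (x : ℝ≥0 → S → ℤ) (V : Config → ℝ) (t : ℝ)
    (ω : S) : ℝ := Real.exp (∫ u in (0 : ℝ)..t, V (envAt η x u ω))

section

variable {S : Type*} [mS : MeasurableSpace S] {P : Measure S} {c : Config → ℝ} {R : Finset ℤ}
  {r : ℤ → Config → ℝ} {ρ : unitInterval} {n : ℕ} {η : ℝ≥0 → S → Config} {x : ℝ≥0 → S → ℤ}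

lemma rightContinuous_env (h : IsWalkInExclusion c R r ρ n P η x) {g : Config → ℝ}
    (hg : IsLocal g) (ω : S) (u : ℝ) :
    ContinuousWithinAt (fun v => g (envAt η x v ω)) (Set.Ici u) u := by
  simp only [envAt, environment_eq_shift]
  exact rightContinuous_pair h (f := fun ζ z => g (shift z ζ)) (fun z => hg.shift z) ω u

lemma measurable_env (h : IsWalkInExclusion c R r ρ n P η x) {g : Config → ℝ}
    (hg : IsLocal g) (u : ℝ) : Measurable fun ω => g (envAt η x u ω) :=
  hg.measurable.comp (measurable_environment h _)

lemma intervalIntegrable_env (h : IsWalkInExclusion c R r ρ n P η x) {g : Config → ℝ}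
    (hg : IsLocal g) (ω : S) (a b : ℝ) :
    IntervalIntegrable (fun u => g (envAt η x u ω)) volume a b := by
  obtain ⟨C, _, hC⟩ := hg.exists_bound
  exact intervalIntegrable_of_bound
    (measurable_of_rightContinuous fun u => rightContinuous_env h hg ω u) (fun u => hC _) a b

lemma measurable_integral_env (h : IsWalkInExclusion c R r ρ n P η x) {g : Config → ℝ}
    (hg : IsLocal g) (a b : ℝ) : Measurable fun ω => ∫ u in a..b, g (envAt η x u ω) :=
  measurable_integral_of_rightContinuous (fun u => measurable_env h hg u)
    (fun ω u => rightContinuous_env h hg ω u) a b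

lemma abs_integral_env_le {S : Type*} {η : ℝ≥0 → S → Config} {x : ℝ≥0 → S → ℤ} {V : Config → ℝ}
    {C : ℝ} (hC : ∀ ζ, |V ζ| ≤ C) (ω : S) (s t : ℝ) :
    |∫ u in s..t, V (envAt η x u ω)| ≤ C * |t - s| := by
  rw [← Real.norm_eq_abs]
  exact intervalIntegral.norm_integral_le_of_norm_le_const fun u _ => hC _

lemma measurable_fkWeight (h : IsWalkInExclusion c R r ρ n P η x) {V : Config → ℝ}
    (hV : IsLocal V) (t : ℝ) : Measurable (fkWeight η x V t) :=
  (measurable_integral_env h hV 0 t).exp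

/-- The weight up to time `t` is determined by the path up to time `t`. -/
lemma stronglyMeasurable_fkWeight (h : IsWalkInExclusion c R r ρ n P η x) {V : Config → ℝ}
    (hV : IsLocal V) {t : ℝ} (ht : 0 ≤ t) :
    StronglyMeasurable[canonicalFiltration η x h.measurable_env h.measurable_walk t.toNNReal]
      (fkWeight η x V t) := by
  have h1 : ∀ ω, ∫ u in (0 : ℝ)..t, V (envAt η x u ω)
      = ∫ u in (0 : ℝ)..t, V (envAt η x (min u t) ω) := fun ω => by
    refine intervalIntegral.integral_congr fun u hu => ?_
    rw [Set.uIcc_of_le ht] at hu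
    simp only [min_eq_left hu.2]
  have h2 := @measurable_integral_of_rightContinuous S
    (canonicalFiltration η x h.measurable_env h.measurable_walk t.toNNReal)
    (fun u ω => V (envAt η x (min u t) ω))
    (fun u => by
      simp only [envAt, environment_eq_shift]
      exact measurable_pair_filtration h (f := fun ζ z => V (shift z ζ)) (fun z => hV.shift z)
        (Real.toNNReal_mono (min_le_right u t)))
    (fun ω u => ContinuousWithinAt.comp_monotone (f := fun u => min u t) (by fun_prop)
      (fun a b hab => min_le_min_right t hab) (fun u => rightContinuous_env h hV ω u) u) 0 t
  simp only [← h1] at h2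
  exact (Real.measurable_exp.comp h2).stronglyMeasurable

lemma fkWeight_le {S : Type*} {η : ℝ≥0 → S → Config} {x : ℝ≥0 → S → ℤ} {V : Config → ℝ}
    {C : ℝ} (hC : ∀ ζ, |V ζ| ≤ C) (ω : S) {t T : ℝ} (ht : |t| ≤ T) :
    fkWeight η x V t ω ≤ Real.exp (C * T) := by
  have hC0 : 0 ≤ C := (abs_nonneg _).trans (hC fun _ => false)
  have := abs_integral_env_le (η := η) (x := x) hC ω 0 t
  rw [sub_zero] at this
  exact Real.exp_le_exp.2 ((le_abs_self _).trans (this.trans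
    (mul_le_mul_of_nonneg_left ht hC0)))

lemma abs_fkWeight_le {S : Type*} {η : ℝ≥0 → S → Config} {x : ℝ≥0 → S → ℤ} {V : Config → ℝ}
    {C : ℝ} (hC : ∀ ζ, |V ζ| ≤ C) (ω : S) {t T : ℝ} (ht : |t| ≤ T) :
    |fkWeight η x V t ω| ≤ Real.exp (C * T) := by
  rw [fkWeight, abs_of_pos (Real.exp_pos _)]
  exact fkWeight_le hC ω ht

lemma abs_fkWeight_sub_le (h : IsWalkInExclusion c R r ρ n P η x) {V : Config → ℝ}
    (hV : IsLocal V) {C : ℝ} (hC : ∀ ζ, |V ζ| ≤ C) (ω : S) {s t T : ℝ} (hs : |s| ≤ T)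
    (ht : |t| ≤ T) :
    |fkWeight η x V t ω - fkWeight η x V s ω| ≤ Real.exp (C * T) * (C * |t - s|) := by
  have hC0 : 0 ≤ C := (abs_nonneg _).trans (hC fun _ => false)
  have hb : ∀ u, |u| ≤ T → ∫ v in (0 : ℝ)..u, V (envAt η x v ω) ≤ C * T := fun u hu => by
    have := abs_integral_env_le (η := η) (x := x) hC ω 0 u
    rw [sub_zero] at this
    exact (le_abs_self _).trans (this.trans (mul_le_mul_of_nonneg_left hu hC0))
  refine (abs_exp_sub_exp_le (hb t ht) (hb s hs)).trans ?_
  rw [intervalIntegral.integral_interval_sub_left (intervalIntegrable_env h hV ω _ _)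
    (intervalIntegrable_env h hV ω _ _)]
  exact mul_le_mul_of_nonneg_left (abs_integral_env_le hC ω s t) (Real.exp_pos _).le

lemma hasDerivWithinAt_fkWeight (h : IsWalkInExclusion c R r ρ n P η x) {V : Config → ℝ}
    (hV : IsLocal V) (ω : S) (t : ℝ) :
    HasDerivWithinAt (fun s => fkWeight η x V s ω) (fkWeight η x V t ω * V (envAt η x t ω))
      (Set.Ici t) t := by
  obtain ⟨C, _, hC⟩ := hV.exists_bound
  exact (hasDerivWithinAt_integral_of_rightContinuous (fun u => rightContinuous_env h hV ω u)
    (fun u => hC _) 0 t).exp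

variable [IsProbabilityMeasure P]

lemma integrable_fkWeight_mul (h : IsWalkInExclusion c R r ρ n P η x) {V g : Config → ℝ}
    (hV : IsLocal V) (hg : IsLocal g) (s t : ℝ) :
    Integrable (fun ω => fkWeight η x V s ω * g (envAt η x t ω)) P := by
  obtain ⟨C, _, hC⟩ := hV.exists_bound
  obtain ⟨Cg, _, hCg⟩ := hg.exists_bound
  refine Integrable.of_bound ((measurable_fkWeight h hV s).mul
    (measurable_env h hg t)).aestronglyMeasurable (Real.exp (C * |s|) * Cg)
    (ae_of_all _ fun ω => ?_)
  rw [Real.norm_eq_abs, abs_mul]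
  exact mul_le_mul (abs_fkWeight_le hC ω le_rfl) (hCg _) (abs_nonneg _) (Real.exp_pos _).le

lemma abs_integral_fkWeight_mul_le {V g : Config → ℝ} {C Cg : ℝ} (hC : ∀ ζ, |V ζ| ≤ C)
    (hCg : ∀ ζ, |g ζ| ≤ Cg) {s T : ℝ} (hs : |s| ≤ T) (t : ℝ) :
    |∫ ω, fkWeight η x V s ω * g (envAt η x t ω) ∂P| ≤ Real.exp (C * T) * Cg := by
  have h := norm_integral_le_of_norm_le (μ := P) (f := fun ω => fkWeight η x V s ω *
    g (envAt η x t ω)) (g := fun _ => Real.exp (C * T) * Cg) (integrable_const _)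
    (ae_of_all _ fun ω => by
      rw [Real.norm_eq_abs, abs_mul]
      exact mul_le_mul (abs_fkWeight_le hC ω hs) (hCg _) (abs_nonneg _) (Real.exp_pos _).le)
  simpa using h

lemma rightContinuous_integral_fkWeight_mul (h : IsWalkInExclusion c R r ρ n P η x)
    {V g : Config → ℝ} (hV : IsLocal V) (hg : IsLocal g) (s u : ℝ) :
    ContinuousWithinAt (fun v => ∫ ω, fkWeight η x V s ω * g (envAt η x v ω) ∂P)
      (Set.Ici u) u := by
  obtain ⟨C, _, hC⟩ := hV.exists_bound
  obtain ⟨Cg, _, hCg⟩ := hg.exists_bound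
  refine tendsto_integral_filter_of_dominated_convergence (fun _ => Real.exp (C * |s|) * Cg)
    (Eventually.of_forall fun v => (integrable_fkWeight_mul h hV hg s v).aestronglyMeasurable)
    (Eventually.of_forall fun v => ae_of_all _ fun ω => ?_) (integrable_const _)
    (ae_of_all _ fun ω => (rightContinuous_env h hg ω u).tendsto.const_mul _)
  rw [Real.norm_eq_abs, abs_mul]
  exact mul_le_mul (abs_fkWeight_le hC ω le_rfl) (hCg _) (abs_nonneg _) (Real.exp_pos _).le

/-- Splitting of an increment of `E[A_t g(ξ_t)]`, where `A` is the weight: either the weight is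
increased, or the environment moves under the weight of the past. -/
lemma integral_fkWeight_eq (hc : IsLocal c) (hr : ∀ z ∈ R, IsLocal (r z))
    (h : IsWalkInExclusion c R r ρ n P η x) {V g : Config → ℝ} (hV : IsLocal V) (hg : IsLocal g)
    {t s : ℝ} (ht : 0 ≤ t) (hts : t ≤ s) :
    ∫ ω, fkWeight η x V s ω * g (envAt η x s ω) ∂P
      = ∫ ω, fkWeight η x V t ω * g (envAt η x t ω) ∂P
        + ∫ ω, (fkWeight η x V s ω - fkWeight η x V t ω) * g (envAt η x s ω) ∂P
        + ∫ u in t..s, ∫ ω, fkWeight η x V t ω * envGenerator c R r n g (envAt η x u ω) ∂P := by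
  obtain ⟨C, _, hC⟩ := hV.exists_bound
  have h1 := integral_mul_environment hc hr h hg ht hts
    (fun ω => abs_fkWeight_le (η := η) (x := x) hC ω (le_refl |t|))
    (stronglyMeasurable_fkWeight h hV ht)
  simp_rw [sub_mul]
  rw [integral_sub (integrable_fkWeight_mul h hV hg s s) (integrable_fkWeight_mul h hV hg t s)]
  linarith

/-- The Feynman–Kac forward equation. -/
theorem hasDerivWithinAt_integral_fkWeight (hc : IsLocal c) (hr : ∀ z ∈ R, IsLocal (r z))
    (h : IsWalkInExclusion c R r ρ n P η x) {V g : Config → ℝ} (hV : IsLocal V) (hg : IsLocal g)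
    {t : ℝ} (ht : 0 ≤ t) :
    HasDerivWithinAt (fun s => ∫ ω, fkWeight η x V s ω * g (envAt η x s ω) ∂P)
      (∫ ω, fkWeight η x V t ω * (envGenerator c R r n g (envAt η x t ω)
        + V (envAt η x t ω) * g (envAt η x t ω)) ∂P) (Set.Ici t) t := by
  obtain ⟨C, hC0, hC⟩ := hV.exists_bound
  obtain ⟨Cg, hCg0, hCg⟩ := hg.exists_bound
  have hLg := isLocal_envGenerator hc hr n hg
  obtain ⟨CL, _, hCL⟩ := hLg.exists_bound
  have h2 : HasDerivWithinAt (fun s => ∫ u in t..s, ∫ ω, fkWeight η x V t ω *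
      envGenerator c R r n g (envAt η x u ω) ∂P)
      (∫ ω, fkWeight η x V t ω * envGenerator c R r n g (envAt η x t ω) ∂P) (Set.Ici t) t :=
    hasDerivWithinAt_integral_of_rightContinuous
      (fun u => rightContinuous_integral_fkWeight_mul h hV hLg t u)
      (fun u => abs_integral_fkWeight_mul_le hC hCL le_rfl u) t t
  have h1 : HasDerivWithinAt (fun s => ∫ ω, (fkWeight η x V s ω - fkWeight η x V t ω)
      * g (envAt η x s ω) ∂P)
      (∫ ω, fkWeight η x V t ω * V (envAt η x t ω) * g (envAt η x t ω) ∂P) (Set.Ici t) t := by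
    rw [hasDerivWithinAt_iff_tendsto_slope, Set.Ici_sdiff_left]
    have e : ∀ s, slope (fun s => ∫ ω, (fkWeight η x V s ω - fkWeight η x V t ω)
        * g (envAt η x s ω) ∂P) t s
        = ∫ ω, slope (fun s => fkWeight η x V s ω) t s * g (envAt η x s ω) ∂P := fun s => by
      simp only [slope_def_field, sub_self, zero_mul, integral_zero, sub_zero]
      rw [← integral_div]
      exact integral_congr_ae (ae_of_all _ fun ω => by ring)
    rw [funext e]
    have hev : ∀ᶠ s in 𝓝[>] t, s ∈ Set.Ioc t (t + 1) :=
      Ioc_mem_nhdsGT (by linarith)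
    refine tendsto_integral_filter_of_dominated_convergence
      (fun _ => Real.exp (C * (t + 1)) * C * Cg) ?_ ?_ (integrable_const _)
      (ae_of_all _ fun ω => ?_)
    · refine Eventually.of_forall fun s => ?_
      simp only [slope_def_field]
      exact ((((measurable_fkWeight h hV s).sub (measurable_fkWeight h hV t)).div_const _).mul
        (measurable_env h hg s)).aestronglyMeasurable
    · filter_upwards [hev] with s hs
      refine ae_of_all _ fun ω => ?_
      have hpos : 0 < s - t := sub_pos.2 hs.1
      have hb := abs_fkWeight_sub_le h hV hC ω (s := t) (t := s) (T := t + 1)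
        (by rw [abs_of_nonneg ht]; linarith)
        (by rw [abs_of_nonneg (ht.trans hs.1.le)]; exact hs.2)
      rw [Real.norm_eq_abs, abs_mul, slope_def_field, abs_div, abs_of_pos hpos]
      refine mul_le_mul ?_ (hCg _) (abs_nonneg _) (by positivity)
      rw [div_le_iff₀ hpos, mul_assoc]
      rwa [abs_of_pos hpos] at hb
    · have hd := hasDerivWithinAt_fkWeight h hV ω t
      rw [hasDerivWithinAt_iff_tendsto_slope, Set.Ici_sdiff_left] at hd
      exact hd.mul ((rightContinuous_env h hg ω t).mono Set.Ioi_subset_Ici_self).tendsto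
  have h3 := (h1.const_add (∫ ω, fkWeight η x V t ω * g (envAt η x t ω) ∂P)).add h2
  have hVg := hV.mul hg
  refine (h3.congr_deriv ?_).congr
    (fun s hs => integral_fkWeight_eq hc hr h hV hg ht hs)
    (integral_fkWeight_eq hc hr h hV hg ht le_rfl)
  simp_rw [mul_add, mul_assoc]
  rw [integral_add (integrable_fkWeight_mul h hV hLg t t) (integrable_fkWeight_mul h hV hVg t t),
    add_comm]

lemma continuousOn_integral_fkWeight (hc : IsLocal c) (hr : ∀ z ∈ R, IsLocal (r z))
    (h : IsWalkInExclusion c R r ρ n P η x) {V g : Config → ℝ} (hV : IsLocal V) (hg : IsLocal g)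
    (T : ℝ) :
    ContinuousOn (fun s => ∫ ω, fkWeight η x V s ω * g (envAt η x s ω) ∂P) (Set.Icc 0 T) := by
  obtain ⟨C, hC0, hC⟩ := hV.exists_bound
  obtain ⟨Cg, hCg0, hCg⟩ := hg.exists_bound
  have hLg := isLocal_envGenerator hc hr n hg
  obtain ⟨CL, hCL0, hCL⟩ := hLg.exists_bound
  set K : ℝ := Real.exp (C * T) * C * Cg + Real.exp (C * T) * CL with hK
  have hK0 : 0 ≤ K := by positivity
  have key : ∀ t ∈ Set.Icc 0 T, ∀ s ∈ Set.Icc 0 T, t ≤ s →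
      dist (∫ ω, fkWeight η x V s ω * g (envAt η x s ω) ∂P)
        (∫ ω, fkWeight η x V t ω * g (envAt η x t ω) ∂P) ≤ K * dist s t := by
    intro t ht s hs hts
    have hta : |t| ≤ T := by rw [abs_of_nonneg ht.1]; exact ht.2
    have hsa : |s| ≤ T := by rw [abs_of_nonneg hs.1]; exact hs.2
    have h1 : |∫ ω, (fkWeight η x V s ω - fkWeight η x V t ω) * g (envAt η x s ω) ∂P|
        ≤ Real.exp (C * T) * (C * |s - t|) * Cg := by
      have h := norm_integral_le_of_norm_le (μ := P)
        (f := fun ω => (fkWeight η x V s ω - fkWeight η x V t ω) * g (envAt η x s ω))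
        (g := fun _ => Real.exp (C * T) * (C * |s - t|) * Cg) (integrable_const _)
        (ae_of_all _ fun ω => by
          rw [Real.norm_eq_abs, abs_mul]
          exact mul_le_mul (abs_fkWeight_sub_le h hV hC ω hta hsa) (hCg _) (abs_nonneg _)
            (by positivity))
      simpa using h
    have h2 : |∫ u in t..s, ∫ ω, fkWeight η x V t ω *
        envGenerator c R r n g (envAt η x u ω) ∂P| ≤ Real.exp (C * T) * CL * |s - t| := by
      rw [← Real.norm_eq_abs]
      exact intervalIntegral.norm_integral_le_of_norm_le_const fun u _ =>
        abs_integral_fkWeight_mul_le hC hCL hta u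
    rw [Real.dist_eq, Real.dist_eq, integral_fkWeight_eq hc hr h hV hg ht.1 hts, add_assoc,
      add_sub_cancel_left]
    refine (abs_add_le _ _).trans ((add_le_add h1 h2).trans (le_of_eq ?_))
    rw [hK]; ring
  refine LipschitzOnWith.continuousOn (K := K.toNNReal)
    (LipschitzOnWith.of_dist_le_mul fun s hs t ht => ?_)
  rw [Real.coe_toNNReal K hK0]
  rcases le_total t s with hts | hst
  · exact key t ht s hs hts
  · rw [dist_comm, dist_comm s t]; exact key s hs t ht hst

/-- Feynman–Kac bound: the expectation of a local function of the environment at time `t`, weighted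
by `exp (∫₀ᵗ V)`, is controlled by its `L²(ν_ρ)` norm. -/
theorem abs_integral_fkWeight_le (hρ0 : 0 < (ρ : ℝ)) (hρ1 : (ρ : ℝ) < 1) (hc : IsLocal c)
    (hr : ∀ z ∈ R, IsLocal (r z)) (h : IsWalkInExclusion c R r ρ n P η x) {V g : Config → ℝ}
    (hV : IsLocal V) {Γ : ℝ}
    (hΓ : ∀ F : Config → ℝ, IsLocal F →
      ∫ η, F η * (envGenerator c R r n F η + V η * F η) ∂bernoulliProduct ρ ≤ Γ * sqNorm ρ F)
    (hg : IsLocal g) {t : ℝ} (ht : 0 ≤ t) :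
    |∫ ω, fkWeight η x V t ω * g (envAt η x t ω) ∂P|
      ≤ Real.exp ((Γ + 1) * t) * √(sqNorm ρ g) := by
  obtain ⟨C, hC0, hC⟩ := hV.exists_bound
  -- the law of the environment at time `t`, weighted by the Feynman–Kac weight
  set m : ℝ → Measure Config := fun t => Measure.map (envAt η x t)
    (P.withDensity fun ω => ENNReal.ofReal (fkWeight η x V t ω)) with hm
  have hwi : ∀ t, Integrable (fkWeight η x V t) P := fun t => by
    simpa using integrable_fkWeight_mul h hV (isLocal_const 1) t t
  have hfin : ∀ t, IsFiniteMeasure (m t) := fun t => by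
    have := isFiniteMeasure_withDensity_ofReal (hwi t).2
    simp only [hm]; infer_instance
  have hint : ∀ g, IsLocal g → ∀ t, ∫ ζ, g ζ ∂m t
      = ∫ ω, fkWeight η x V t ω * g (envAt η x t ω) ∂P := fun g hg t => by
    simp only [hm]
    rw [integral_map (φ := envAt η x t) (measurable_environment h _).aemeasurable
      hg.measurable.aestronglyMeasurable,
      integral_withDensity_eq_integral_toReal_smul
        (measurable_fkWeight h hV t).ennreal_ofReal (by simp)]
    refine integral_congr_ae (ae_of_all _ fun ω => ?_)
    simp only [smul_eq_mul]
    rw [fkWeight, ENNReal.toReal_ofReal (Real.exp_pos _).le]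
  have hm0 : m 0 = bernoulliProduct ρ := by
    have e : ∀ ω, ENNReal.ofReal (fkWeight η x V 0 ω) = 1 := fun ω => by simp [fkWeight]
    simp only [hm, e]
    rw [show (fun _ : S => (1 : ℝ≥0∞)) = 1 from rfl, withDensity_one, ← h.law_env_zero]
    refine Measure.map_congr ?_
    filter_upwards [h.walk_zero] with ω hω
    rw [envAt, environment_eq_shift, Real.toNNReal_zero, hω, shift_zero]
  rw [← hint g hg t]
  refine abs_integral_le_of_forward_equation hρ0 hρ1 hc hr n hV hΓ (T := t)
    (M := Real.exp (C * t)) m hm0 (fun s hs => ?_) (fun g hg => ?_) (fun g hg s hs => ?_) hg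
    ⟨ht, le_rfl⟩
  · have h1 := hint _ (isLocal_const 1) s
    have h2 := abs_integral_fkWeight_mul_le (P := P) (η := η) (x := x) hC (g := fun _ => 1)
      (Cg := 1) (by simp) (s := s) (T := t) (by rw [abs_of_nonneg hs.1]; exact hs.2) s
    rw [← h1] at h2
    exact le_trans (le_of_eq (by simp)) ((le_abs_self _).trans (h2.trans (mul_one _).le))
  · simp_rw [hint g hg]
    exact continuousOn_integral_fkWeight hc hr h hV hg t
  · simp_rw [hint g hg]
    rw [hint _ ((isLocal_envGenerator hc hr n hg).add (hV.mul hg))]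
    exact hasDerivWithinAt_integral_fkWeight hc hr h hV hg hs.1

/-! ### Bounds for time integrals of the environment -/

/-- Exponential Chebyshev bound for the time integral of a function with an `H₋₁` bound. -/
theorem prob_abs_integral_ge_le_exp (hρ0 : 0 < (ρ : ℝ)) (hρ1 : (ρ : ℝ) < 1) (hc : IsLocal c)
    (hr : ∀ z ∈ R, IsLocal (r z)) (hn : 1 ≤ n) {ε₀ C : ℝ} (hε : 0 < ε₀)
    (hE : ∀ F : Config → ℝ, IsLocal F →
      ∫ η, F η * envGenerator c R r n F η ∂bernoulliProduct ρ
        ≤ -(ε₀ * (n : ℝ) ^ 2 * dirichlet ρ F) + C * sqNorm ρ F)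
    (h : IsWalkInExclusion c R r ρ n P η x) {W : Config → ℝ} (hW : IsLocal W) {b : ℝ}
    (hb : HMinusOneBound ρ W b) {K : ℝ} (hK : 0 ≤ K) (δ : ℝ) {t : ℝ} (ht : 0 ≤ t) :
    P.real {ω | δ ≤ |√(n : ℝ) * ∫ u in (0 : ℝ)..t, W (envAt η x u ω)|}
      ≤ 2 * Real.exp (-(K * δ) + (C + K ^ 2 * (b ^ 2 / n) / (4 * ε₀) + 1) * t) := by
  set Γ := C + K ^ 2 * (b ^ 2 / n) / (4 * ε₀) with hΓ
  -- one-sided bound, for both signs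
  have key : ∀ a : ℝ, |a| = 1 →
      P.real {ω | δ ≤ a * (√(n : ℝ) * ∫ u in (0 : ℝ)..t, W (envAt η x u ω))}
        ≤ Real.exp (-(K * δ) + (Γ + 1) * t) := by
    intro a ha
    have ha2 : (a * K) ^ 2 = K ^ 2 := by
      rw [mul_pow, ← sq_abs a, ha]; ring
    have h1 := abs_integral_fkWeight_le (P := P) (η := η) (x := x) (g := fun _ => 1)
      (V := fun ζ => a * K * √n * W ζ) (Γ := Γ) hρ0 hρ1 hc hr h
      (hW.const_mul _)
      (fun F hF => by
        have := energy_estimate_with_potential hc hr hε hn hE hW hb (a * K) hF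
        rwa [ha2] at this)
      (isLocal_const 1) ht
    have e1 : sqNorm ρ (fun _ => 1) = 1 := by simp [sqNorm]
    rw [e1, Real.sqrt_one, mul_one] at h1
    simp only [mul_one] at h1
    have hwi : Integrable (fkWeight η x (fun ζ => a * K * √n * W ζ) t) P := by
      simpa using integrable_fkWeight_mul h (hW.const_mul (a * K * √n)) (isLocal_const 1) t t
    have h2 := mul_meas_ge_le_integral_of_nonneg (μ := P)
      (f := fkWeight η x (fun ζ => a * K * √n * W ζ) t)
      (ae_of_all _ fun ω => (Real.exp_pos _).le) hwi (Real.exp (K * δ))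
    have h3 : P.real {ω | δ ≤ a * (√(n : ℝ) * ∫ u in (0 : ℝ)..t, W (envAt η x u ω))}
        ≤ P.real {ω | Real.exp (K * δ) ≤ fkWeight η x (fun ζ => a * K * √n * W ζ) t ω} := by
      refine measureReal_mono fun ω hω => ?_
      simp only [Set.mem_ofPred_eq, fkWeight, intervalIntegral.integral_const_mul] at hω ⊢
      refine Real.exp_le_exp.2 ((mul_le_mul_of_nonneg_left hω hK).trans (le_of_eq ?_))
      ring
    have h4 := h2.trans ((le_abs_self _).trans h1)
    rw [Real.exp_add, Real.exp_neg, ← div_eq_inv_mul, le_div_iff₀ (Real.exp_pos _), mul_comm]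
    exact (mul_le_mul_of_nonneg_left h3 (Real.exp_pos _).le).trans h4
  have hsub : {ω | δ ≤ |√(n : ℝ) * ∫ u in (0 : ℝ)..t, W (envAt η x u ω)|}
      ⊆ {ω | δ ≤ 1 * (√(n : ℝ) * ∫ u in (0 : ℝ)..t, W (envAt η x u ω))}
        ∪ {ω | δ ≤ -1 * (√(n : ℝ) * ∫ u in (0 : ℝ)..t, W (envAt η x u ω))} := by
    intro ω hω
    simp only [Set.mem_ofPred_eq, Set.mem_union, one_mul, neg_one_mul] at hω ⊢
    exact le_abs.1 hω
  calc _ ≤ _ := measureReal_mono hsub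
    _ ≤ _ := measureReal_union_le _ _
    _ ≤ _ := by linarith [key 1 (by simp), key (-1) (by simp)]

/-- Markov's inequality for the time integral of a function that is small in `L²(ν_ρ)`. -/
theorem prob_abs_integral_ge_le_sqNorm (hρ0 : 0 < (ρ : ℝ)) (hρ1 : (ρ : ℝ) < 1) (hc : IsLocal c)
    (hr : ∀ z ∈ R, IsLocal (r z)) {C : ℝ} (hC : 0 ≤ C)
    (hE : ∀ F : Config → ℝ, IsLocal F →
      ∫ η, F η * envGenerator c R r n F η ∂bernoulliProduct ρ ≤ C * sqNorm ρ F)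
    (h : IsWalkInExclusion c R r ρ n P η x) {U : Config → ℝ} (hU : IsLocal U) {δ : ℝ}
    (hδ : 0 < δ) {t : ℝ} (ht : 0 ≤ t) :
    P.real {ω | δ ≤ |√(n : ℝ) * ∫ u in (0 : ℝ)..t, U (envAt η x u ω)|}
      ≤ t * Real.exp ((C + 1) * t) / δ * √(n * sqNorm ρ U) := by
  have hUa : IsLocal fun ζ => |U ζ| := hU.comp fun a => |a|
  have hsq : sqNorm ρ (fun ζ => |U ζ|) = sqNorm ρ U := by simp [sqNorm]
  obtain ⟨CU, hCU0, hCU⟩ := hUa.exists_bound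
  have h1 : ∀ u, 0 ≤ u → ∫ ω, |U (envAt η x u ω)| ∂P
      ≤ Real.exp ((C + 1) * u) * √(sqNorm ρ U) := fun u hu => by
    have := abs_integral_fkWeight_le (P := P) (η := η) (x := x) (V := fun _ => 0) hρ0 hρ1 hc hr h
      (isLocal_const 0) (Γ := C) (by simpa using hE) hUa hu
    rw [hsq] at this
    refine (le_abs_self _).trans (le_trans (le_of_eq ?_) this)
    simp [fkWeight]
  have hjoint := measurable_uncurry_of_rightContinuous (fun u => measurable_env h hUa u)
    (fun ω u => rightContinuous_env h hUa ω u)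
  have hprod : Integrable (Function.uncurry fun (u : ℝ) (ω : S) => |U (envAt η x u ω)|)
      ((volume.restrict (Set.Ioc 0 t)).prod P) :=
    Integrable.of_bound hjoint.aestronglyMeasurable CU (ae_of_all _ fun q => hCU _)
  have h2 : ∫ ω, (∫ u in (0 : ℝ)..t, |U (envAt η x u ω)|) ∂P
      ≤ t * (Real.exp ((C + 1) * t) * √(sqNorm ρ U)) := by
    have e : ∫ ω, (∫ u in (0 : ℝ)..t, |U (envAt η x u ω)|) ∂P
        = ∫ u in (0 : ℝ)..t, (∫ ω, |U (envAt η x u ω)| ∂P) := by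
      simp_rw [intervalIntegral.integral_of_le ht]
      exact (integral_integral_swap hprod).symm
    rw [e]
    have h3 := intervalIntegral.norm_integral_le_of_norm_le_const (a := 0) (b := t)
      (f := fun u => ∫ ω, |U (envAt η x u ω)| ∂P)
      (C := Real.exp ((C + 1) * t) * √(sqNorm ρ U)) (fun u hu => by
        rw [Set.uIoc_of_le ht] at hu
        rw [Real.norm_eq_abs, abs_of_nonneg (integral_nonneg fun _ => abs_nonneg _)]
        refine (h1 u hu.1.le).trans (mul_le_mul_of_nonneg_right (Real.exp_le_exp.2 ?_)
          (Real.sqrt_nonneg _))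
        exact mul_le_mul_of_nonneg_left hu.2 (by linarith))
    rw [sub_zero, abs_of_nonneg ht, mul_comm] at h3
    exact (le_abs_self _).trans h3
  have hint : Integrable (fun ω => √(n : ℝ) * ∫ u in (0 : ℝ)..t, |U (envAt η x u ω)|) P := by
    simp_rw [intervalIntegral.integral_of_le ht]
    exact hprod.integral_prod_right.const_mul _
  have hnn : ∀ ω, 0 ≤ √(n : ℝ) * ∫ u in (0 : ℝ)..t, |U (envAt η x u ω)| := fun ω =>
    mul_nonneg (Real.sqrt_nonneg _)
      (intervalIntegral.integral_nonneg ht fun u _ => abs_nonneg _)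
  have h4 := mul_meas_ge_le_integral_of_nonneg (ae_of_all _ hnn) hint δ
  have h5 : P.real {ω | δ ≤ |√(n : ℝ) * ∫ u in (0 : ℝ)..t, U (envAt η x u ω)|}
      ≤ P.real {ω | δ ≤ √(n : ℝ) * ∫ u in (0 : ℝ)..t, |U (envAt η x u ω)|} := by
    refine measureReal_mono fun ω hω => ?_
    simp only [Set.mem_ofPred_eq] at hω ⊢
    refine hω.trans ?_
    rw [abs_mul, abs_of_nonneg (Real.sqrt_nonneg _)]
    exact mul_le_mul_of_nonneg_left (intervalIntegral.abs_integral_le_integral_abs ht)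
      (Real.sqrt_nonneg _)
  rw [integral_const_mul] at h4
  rw [Real.sqrt_mul (Nat.cast_nonneg n), div_mul_eq_mul_div, le_div_iff₀ hδ, mul_comm]
  calc _ ≤ _ := mul_le_mul_of_nonneg_left h5 hδ.le
    _ ≤ _ := h4
    _ ≤ _ := mul_le_mul_of_nonneg_left h2 (Real.sqrt_nonneg _)
    _ = _ := by ring

/-- Bound for the time integral of `V = W + U`, where `W` has an `H₋₁` bound and `U` is small in
`L²(ν_ρ)`. -/
theorem prob_abs_integral_gt_le (hρ0 : 0 < (ρ : ℝ)) (hρ1 : (ρ : ℝ) < 1) (hc : IsLocal c)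
    (hr : ∀ z ∈ R, IsLocal (r z)) (hn : 1 ≤ n) {ε₀ C : ℝ} (hε : 0 < ε₀) (hC : 0 ≤ C)
    (hE : ∀ F : Config → ℝ, IsLocal F →
      ∫ η, F η * envGenerator c R r n F η ∂bernoulliProduct ρ
        ≤ -(ε₀ * (n : ℝ) ^ 2 * dirichlet ρ F) + C * sqNorm ρ F)
    (h : IsWalkInExclusion c R r ρ n P η x) {V W U : Config → ℝ} (hW : IsLocal W)
    (hU : IsLocal U) (hV : ∀ ζ, V ζ = W ζ + U ζ) {b : ℝ}
    (hb : HMinusOneBound ρ W b) {K : ℝ} (hK : 0 ≤ K) {δ : ℝ} (hδ : 0 < δ) {t : ℝ} (ht : 0 ≤ t) :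
    P.real {ω | δ < |√(n : ℝ) * ∫ u in (0 : ℝ)..t, V (envAt η x u ω)|}
      ≤ 2 * Real.exp (-(K * (δ / 2)) + (C + K ^ 2 * (b ^ 2 / n) / (4 * ε₀) + 1) * t)
        + t * Real.exp ((C + 1) * t) / (δ / 2) * √(n * sqNorm ρ U) := by
  have h1 := prob_abs_integral_ge_le_exp hρ0 hρ1 hc hr hn hε hE h hW hb hK (δ / 2) ht
  have h2 := prob_abs_integral_ge_le_sqNorm hρ0 hρ1 hc hr hC (fun F hF => (hE F hF).trans
    (by
      have := mul_nonneg (mul_nonneg hε.le (sq_nonneg (n : ℝ))) (dirichlet_nonneg ρ F)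
      linarith)) h hU (half_pos hδ) ht
  refine le_trans ?_ (add_le_add h1 h2)
  refine le_trans (measureReal_mono ?_) (measureReal_union_le _ _)
  intro ω hω
  simp only [Set.mem_ofPred_eq, Set.mem_union] at hω ⊢
  simp_rw [hV] at hω
  rw [intervalIntegral.integral_add (intervalIntegrable_env h hW ω 0 t)
    (intervalIntegrable_env h hU ω 0 t), mul_add] at hω
  by_contra hcon
  push Not at hcon
  have := abs_add_le (√(n : ℝ) * ∫ u in (0 : ℝ)..t, W (envAt η x u ω))
    (√(n : ℝ) * ∫ u in (0 : ℝ)..t, U (envAt η x u ω))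
  linarith [hcon.1, hcon.2]

end

/-! ### Centred monomials -/

/-- The monomial `∏_{x ∈ B} (η(x) - ρ)`. -/
def monomial (ρ : ℝ) (B : Finset ℤ) (η : Config) : ℝ := ∏ x ∈ B, (occ η x - ρ)

lemma isLocal_monomial (ρ : ℝ) (B : Finset ℤ) : IsLocal (monomial ρ B) :=
  isLocal_finsetProd B fun x _ => (isLocal_occ x).sub (isLocal_const ρ)

lemma abs_occ_sub_le (ρ : unitInterval) (η : Config) (x : ℤ) : |occ η x - ρ| ≤ 1 := by
  have h0 := ρ.2.1
  have h1 := ρ.2.2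
  rw [abs_le]
  simp only [occ]
  split_ifs <;> constructor <;> linarith

lemma abs_monomial_le (ρ : unitInterval) (B : Finset ℤ) (η : Config) :
    |monomial ρ B η| ≤ 1 := by
  rw [monomial, Finset.abs_prod]
  exact Finset.prod_le_one (fun _ _ => abs_nonneg _) fun x _ => abs_occ_sub_le ρ η x

lemma monomial_swapAt (ρ : ℝ) {B : Finset ℤ} {y : ℤ} (hy : y ∉ B) (hy' : y + 1 ∉ B)
    (η : Config) : monomial ρ B (swapAt y η) = monomial ρ B η := by
  refine Finset.prod_congr rfl fun x hx => ?_
  have h1 : x ≠ y := fun h => hy (h ▸ hx)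
  have h2 : x ≠ y + 1 := fun h => hy' (h ▸ hx)
  simp only [occ, swapAt, Equiv.swap_apply_of_ne_of_ne h1 h2]

/-- A local function is a polynomial in the centred occupation numbers. -/
lemma SupportedIn.exists_eq_sum_monomial (ρ : ℝ) (Λ : Finset ℤ) {f : Config → ℝ}
    (hf : SupportedIn f Λ) :
    ∃ a : Finset ℤ → ℝ, ∀ η, f η = ∑ B ∈ Λ.powerset, a B * monomial ρ B η := by
  induction Λ using Finset.induction_on generalizing f with
  | empty =>
    refine ⟨fun _ => f fun _ => false, fun η => ?_⟩
    simp only [Finset.powerset_empty, Finset.sum_singleton, monomial, Finset.prod_empty, mul_one]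
    exact hf _ _ (by simp)
  | insert x Λ hx ih =>
    have hup : ∀ v : Bool, SupportedIn (fun η => f (Function.update η x v)) Λ := by
      intro v η ξ h
      refine hf _ _ fun y hy => ?_
      rcases eq_or_ne y x with rfl | hyx
      · simp
      · rw [Function.update_of_ne hyx, Function.update_of_ne hyx]
        refine h y ?_
        rw [Finset.coe_insert] at hy
        exact hy.resolve_left hyx
    -- with `f₁`, `f₀` the restrictions of `f` to `η(x) = 1` and `η(x) = 0`,
    -- `f = (f₀ + ρ (f₁ - f₀)) + (η(x) - ρ) (f₁ - f₀)`
    obtain ⟨e, he⟩ := ih (((hup true).comp₂ (hup false)) fun a b => b + ρ * (a - b))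
    obtain ⟨d, hd⟩ := ih (((hup true).comp₂ (hup false)) fun a b => a - b)
    refine ⟨fun B => if x ∈ B then d (B.erase x) else e B, fun η => ?_⟩
    rw [Finset.sum_powerset_insert hx]
    have h1 : ∑ B ∈ Λ.powerset, (if x ∈ B then d (B.erase x) else e B) * monomial ρ B η
        = f (Function.update η x false)
          + ρ * (f (Function.update η x true) - f (Function.update η x false)) := by
      rw [he η]
      refine Finset.sum_congr rfl fun B hB => ?_
      rw [if_neg fun h => hx (Finset.mem_powerset.1 hB h)]
    have h2 : ∑ B ∈ Λ.powerset, (if x ∈ insert x B then d ((insert x B).erase x)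
          else e (insert x B)) * monomial ρ (insert x B) η
        = (occ η x - ρ) * (f (Function.update η x true) - f (Function.update η x false)) := by
      rw [hd η, Finset.mul_sum]
      refine Finset.sum_congr rfl fun B hB => ?_
      have hxB : x ∉ B := fun h => hx (Finset.mem_powerset.1 hB h)
      rw [if_pos (Finset.mem_insert_self _ _), Finset.erase_insert hxB, monomial,
        Finset.prod_insert hxB, monomial]
      ring
    rw [h1, h2]
    by_cases hηx : η x = true
    · have : Function.update η x true = η := by rw [← hηx, Function.update_eq_self]
      simp only [occ, hηx, if_true, this]
      ring
    · have hηx' : η x = false := by simpa using hηx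
      have : Function.update η x false = η := by rw [← hηx', Function.update_eq_self]
      simp only [occ, hηx', Bool.false_eq_true, if_false, this]
      ring

lemma integral_monomial (ρ : ℝ) (p : unitInterval) (B : Finset ℤ) :
    ∫ η, monomial ρ B η ∂bernoulliProduct p = ((p : ℝ) - ρ) ^ B.card := by
  have h := integral_prod_site p B fun _ b => (if b = true then 1 else 0) - ρ
  simp only [monomial, occ]
  rw [h, ← Finset.prod_const]
  refine Finset.prod_congr rfl fun _ _ => ?_
  simp
  ring

lemma integral_monomial_mul_monomial (ρ : unitInterval) {B B' : Finset ℤ} (h : B ≠ B') :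
    ∫ η, monomial ρ B η * monomial ρ B' η ∂bernoulliProduct ρ = 0 := by
  have h1 := integral_prod_site ρ (B ∪ B') fun x b =>
    (if x ∈ B then (if b = true then 1 else 0) - (ρ : ℝ) else 1)
      * (if x ∈ B' then (if b = true then 1 else 0) - (ρ : ℝ) else 1)
  have h2 : ∀ η : Config, ∏ x ∈ B ∪ B',
      ((if x ∈ B then (if η x = true then 1 else 0) - (ρ : ℝ) else 1)
        * (if x ∈ B' then (if η x = true then 1 else 0) - (ρ : ℝ) else 1))
      = monomial ρ B η * monomial ρ B' η := fun η => by
    rw [Finset.prod_mul_distrib, Finset.prod_ite_mem, Finset.prod_ite_mem,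
      Finset.inter_eq_right.2 Finset.subset_union_left,
      Finset.inter_eq_right.2 Finset.subset_union_right]
    rfl
  simp only [h2] at h1
  rw [h1]
  have h3 : ∃ x, ¬(x ∈ B ↔ x ∈ B') := by
    by_contra hcon
    push Not at hcon
    exact h (Finset.ext hcon)
  obtain ⟨x, hx⟩ := h3
  have hxu : x ∈ B ∪ B' := by
    rw [Finset.mem_union]
    tauto
  refine Finset.prod_eq_zero hxu ?_
  by_cases hB : x ∈ B
  · have hB' : x ∉ B' := fun h => hx ⟨fun _ => h, fun _ => hB⟩
    simp [hB, hB']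
    ring
  · have hB' : x ∈ B' := (Finset.mem_union.1 hxu).resolve_left hB
    simp [hB, hB']
    ring

lemma sqNorm_monomial_le (ρ : unitInterval) (B : Finset ℤ) : sqNorm ρ (monomial ρ B) ≤ 1 := by
  calc sqNorm ρ (monomial ρ B) ≤ ∫ _, (1 : ℝ) ∂bernoulliProduct ρ :=
        integral_mono (((isLocal_monomial _ B).pow 2).integrable _) (integrable_const _)
          fun η => by
            simp only
            rw [← sq_abs]
            exact pow_le_one₀ (abs_nonneg _) (abs_monomial_le ρ B η)
    _ = 1 := by simp

/-- Distinct monomials are orthogonal in `L²(ν_ρ)`. -/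
lemma sqNorm_sum_monomial_le (ρ : unitInterval) {ι : Type*} (s : Finset ι) {B : ι → Finset ℤ}
    (hB : Set.InjOn B s) (a : ℝ) :
    sqNorm ρ (fun η => ∑ i ∈ s, a * monomial ρ (B i) η) ≤ a ^ 2 * s.card := by
  classical
  have hl : ∀ i j, IsLocal fun η => (a * monomial ρ (B i) η) * (a * monomial ρ (B j) η) :=
    fun i j => ((isLocal_monomial _ _).const_mul a).mul ((isLocal_monomial _ _).const_mul a)
  have h1 : sqNorm ρ (fun η => ∑ i ∈ s, a * monomial ρ (B i) η)
      = ∑ i ∈ s, ∑ j ∈ s, ∫ η, (a * monomial ρ (B i) η) * (a * monomial ρ (B j) η)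
        ∂bernoulliProduct ρ := by
    simp only [sqNorm, sq, Finset.sum_mul_sum]
    rw [integral_finsetSum _ fun i _ => (isLocal_finsetSum s fun j _ => hl i j).integrable _]
    refine Finset.sum_congr rfl fun i _ => ?_
    rw [integral_finsetSum _ fun j _ => (hl i j).integrable _]
  rw [h1, mul_comm, ← nsmul_eq_mul]
  refine Finset.sum_le_card_nsmul _ _ _ fun i hi => ?_
  rw [Finset.sum_eq_single i]
  · have e : ∀ η, (a * monomial ρ (B i) η) * (a * monomial ρ (B i) η)
        = a ^ 2 * monomial ρ (B i) η ^ 2 := fun η => by ring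
    simp_rw [e]
    rw [integral_const_mul]
    exact (mul_le_mul_of_nonneg_left (sqNorm_monomial_le ρ (B i)) (sq_nonneg a)).trans
      (mul_one _).le
  · intro j hj hji
    have e : ∀ η, (a * monomial ρ (B i) η) * (a * monomial ρ (B j) η)
        = a ^ 2 * (monomial ρ (B i) η * monomial ρ (B j) η) := fun η => by ring
    simp_rw [e]
    rw [integral_const_mul, integral_monomial_mul_monomial ρ fun h => hji (hB hj hi h.symm),
      mul_zero]
  · exact fun h => absurd hi h

lemma hasDerivAt_meanUnder_monomial {ρ : unitInterval} (hρ0 : 0 < (ρ : ℝ)) (hρ1 : (ρ : ℝ) < 1)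
    (B : Finset ℤ) :
    HasDerivAt (meanUnder (monomial ρ B)) (if B.card = 1 then 1 else 0) (ρ : ℝ) := by
  have h1 : (fun p : ℝ => (p - ρ) ^ B.card) =ᶠ[𝓝 (ρ : ℝ)] meanUnder (monomial ρ B) := by
    filter_upwards [Icc_mem_nhds hρ0 hρ1] with p hp
    rw [meanUnder, integral_monomial, Set.projIcc_of_mem _ hp]
  have h2 : HasDerivAt (fun p : ℝ => (p - ρ) ^ B.card)
      (B.card * ((ρ : ℝ) - ρ) ^ (B.card - 1) * 1) (ρ : ℝ) :=
    ((hasDerivAt_id (ρ : ℝ)).sub_const (ρ : ℝ)).pow B.card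
  refine (h2.congr_of_eventuallyEq h1.symm).congr_deriv ?_
  rw [sub_self, mul_one]
  rcases Nat.lt_trichotomy B.card 1 with h | h | h
  · have : B.card = 0 := by omega
    simp [this]
  · simp [h]
  · rw [if_neg h.ne', zero_pow (by omega), mul_zero]

lemma meanUnder_monomial_self (ρ : unitInterval) (B : Finset ℤ) :
    meanUnder (monomial ρ B) ρ = if B.card = 0 then 1 else 0 := by
  rw [meanUnder, integral_monomial, Set.projIcc_of_mem _ ρ.2]
  simp [zero_pow_eq]

/-! ### Moving a particle -/

/-- Moving one factor `η(x) - ρ` from `x` to `y`, in the presence of a factor `g` that is not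
affected by the exchanges between `x` and `y`, costs the square root of the distance. -/
lemma hMinusOneBound_move_of_le (ρ : unitInterval) {x y : ℤ} (hxy : x ≤ y) {g : Config → ℝ}
    (hg : IsLocal g) (hg1 : ∀ η, |g η| ≤ 1)
    (hinv : ∀ j, x ≤ j → j < y → ∀ η, g (swapAt j η) = g η) :
    HMinusOneBound ρ (fun η => ((occ η x - ρ) - (occ η y - ρ)) * g η) (√|(x : ℝ) - y|) := by
  have h := hMinusOneBound_sum_antisymm ρ (Finset.Ico x y)
    (w := fun j η => (occ η j - occ η (j + 1)) * g η) (b := fun _ => 1)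
    (fun j _ => ((isLocal_occ j).sub (isLocal_occ (j + 1))).mul hg)
    (fun j hj η => by
      rw [Finset.mem_Ico] at hj
      rw [hinv j hj.1 hj.2]
      simp only [occ, swapAt, Equiv.swap_apply_left, Equiv.swap_apply_right]
      ring)
    (fun j _ η => by
      rw [abs_mul]
      refine mul_le_one₀ ?_ (abs_nonneg _) (hg1 η)
      rw [abs_le]
      simp only [occ]
      split_ifs <;> norm_num)
  have htel : ∀ (k : ℕ) (η : Config),
      ∑ j ∈ Finset.Ico x (x + k), (occ η j - occ η (j + 1)) * g η
        = ((occ η x - ρ) - (occ η (x + k) - ρ)) * g η := by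
    intro k η
    induction k with
    | zero => simp
    | succ k ih =>
      have e : Finset.Ico x (x + (k + 1 : ℕ)) = insert (x + k) (Finset.Ico x (x + k)) := by
        ext j
        simp only [Finset.mem_Ico, Finset.mem_insert]
        push_cast
        omega
      rw [e, Finset.sum_insert (by simp), ih]
      push_cast
      rw [← add_assoc]
      ring
  obtain ⟨k, rfl⟩ := Int.le.dest hxy
  simp only [htel] at h
  convert h using 2
  simp

lemma hMinusOneBound_move (ρ : unitInterval) (x y : ℤ) {g : Config → ℝ}
    (hg : IsLocal g) (hg1 : ∀ η, |g η| ≤ 1)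
    (hinv : ∀ j, min x y ≤ j → j < max x y → ∀ η, g (swapAt j η) = g η) :
    HMinusOneBound ρ (fun η => ((occ η x - ρ) - (occ η y - ρ)) * g η) (√|(x : ℝ) - y|) := by
  rcases le_total x y with hxy | hxy
  · rw [min_eq_left hxy, max_eq_right hxy] at hinv
    exact hMinusOneBound_move_of_le ρ hxy hg hg1 hinv
  · rw [min_eq_right hxy, max_eq_left hxy] at hinv
    have h := (hMinusOneBound_move_of_le ρ hxy hg hg1 hinv).const_mul (-1)
    rw [abs_neg, abs_one, one_mul, abs_sub_comm] at h
    convert h using 2 with η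
    ring

/-- Replacing a factor `η(x) - ρ` by a weighted sum of `η(y i) - ρ` over sites at distance at most
`D` costs at most `√D` times the total weight. The weights need not sum to one, so what is
replaced is `(∑ i, w i) (η(x) - ρ)`. -/
lemma hMinusOneBound_average (ρ : unitInterval) {ι : Type*} (s : Finset ι) (x : ℤ) (y : ι → ℤ)
    {w : ι → ℝ} (hw : ∀ i ∈ s, 0 ≤ w i) {D : ℝ}
    (hD : ∀ i ∈ s, w i ≠ 0 → |(x : ℝ) - y i| ≤ D) {g : Config → ℝ} (hg : IsLocal g)
    (hg1 : ∀ η, |g η| ≤ 1)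
    (hinv : ∀ i ∈ s, ∀ j, min x (y i) ≤ j → j < max x (y i) → ∀ η, g (swapAt j η) = g η) :
    HMinusOneBound ρ (fun η => ∑ i ∈ s, w i * (((occ η x - ρ) - (occ η (y i) - ρ)) * g η))
      ((∑ i ∈ s, w i) * √D) := by
  have h := HMinusOneBound.finsetSum (p := ρ) s
    (V := fun i η => w i * (((occ η x - ρ) - (occ η (y i) - ρ)) * g η))
    (b := fun i => |w i| * √|(x : ℝ) - y i|)
    (fun i _ => ((((isLocal_occ x).sub (isLocal_const ρ)).sub
      ((isLocal_occ (y i)).sub (isLocal_const ρ))).mul hg).const_mul _)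
    (fun i hi => (hMinusOneBound_move ρ x (y i) hg hg1 (hinv i hi)).const_mul _)
  refine h.mono ?_
  rw [Finset.sum_mul]
  refine Finset.sum_le_sum fun i hi => ?_
  rw [abs_of_nonneg (hw i hi)]
  rcases eq_or_ne (w i) 0 with h0 | h0
  · simp [h0]
  · exact mul_le_mul_of_nonneg_left (Real.sqrt_le_sqrt (hD i hi h0)) (hw i hi)

/-! ### Decomposition of the fluctuation -/

/-- The family `V n ε` splits into a part whose squared `H₋₁` bound is at most of order `ε n` and a
part whose squared `L²(ν_ρ)` norm is `o(1 / n)`. -/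
def Replaceable (ρ : unitInterval) (V : ℕ → ℝ → Config → ℝ) : Prop :=
  ∃ C₀ : ℝ, 0 ≤ C₀ ∧ ∀ ε : ℝ, 0 < ε → ε ≤ 1 →
    ∃ (W U : ℕ → Config → ℝ) (b : ℕ → ℝ),
      (∀ᶠ n : ℕ in atTop, IsLocal (W n) ∧ IsLocal (U n) ∧ HMinusOneBound ρ (W n) (b n) ∧
        (∀ ζ, V n ε ζ = W n ζ + U n ζ) ∧ b n ^ 2 / n ≤ C₀ * ε) ∧
      Tendsto (fun n : ℕ => n * sqNorm ρ (U n)) atTop (𝓝 0)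

lemma Replaceable.zero (ρ : unitInterval) : Replaceable ρ fun _ _ _ => 0 :=
  ⟨0, le_rfl, fun _ _ _ => ⟨fun _ _ => 0, fun _ _ => 0, fun _ => 0,
    Eventually.of_forall fun _ => ⟨isLocal_const 0, isLocal_const 0, HMinusOneBound.zero ρ,
      by simp, by simp⟩, by simp [sqNorm]⟩⟩

lemma sqNorm_const_mul (p : unitInterval) (a : ℝ) (f : Config → ℝ) :
    sqNorm p (fun η => a * f η) = a ^ 2 * sqNorm p f := by
  simp only [sqNorm, mul_pow, integral_const_mul]

lemma sqNorm_add_le (p : unitInterval) {f g : Config → ℝ} (hf : IsLocal f) (hg : IsLocal g) :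
    sqNorm p (fun η => f η + g η) ≤ 2 * sqNorm p f + 2 * sqNorm p g := by
  simp only [sqNorm]
  rw [← integral_const_mul, ← integral_const_mul, ← integral_add
    (((hf.pow 2).const_mul 2).integrable _) (((hg.pow 2).const_mul 2).integrable _)]
  refine integral_mono (((hf.add hg).pow 2).integrable _)
    ((((hf.pow 2).const_mul 2).add ((hg.pow 2).const_mul 2)).integrable _) fun η => ?_
  simp only
  nlinarith [sq_nonneg (f η - g η)]

lemma Replaceable.const_mul {ρ : unitInterval} {V : ℕ → ℝ → Config → ℝ} (h : Replaceable ρ V)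
    (a : ℝ) : Replaceable ρ fun n ε ζ => a * V n ε ζ := by
  obtain ⟨C₀, hC₀, h⟩ := h
  refine ⟨a ^ 2 * C₀, by positivity, fun ε hε hε1 => ?_⟩
  obtain ⟨W, U, b, hev, hlim⟩ := h ε hε hε1
  refine ⟨fun n ζ => a * W n ζ, fun n ζ => a * U n ζ, fun n => |a| * b n, ?_, ?_⟩
  · filter_upwards [hev] with n hn
    obtain ⟨hW, hU, hb, hV, hbn⟩ := hn
    refine ⟨hW.const_mul a, hU.const_mul a, hb.const_mul a, fun ζ => by rw [hV]; ring, ?_⟩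
    rw [mul_pow, sq_abs, mul_div_assoc, mul_assoc]
    exact mul_le_mul_of_nonneg_left hbn (sq_nonneg a)
  · have := hlim.const_mul (a ^ 2)
    rw [mul_zero] at this
    refine this.congr fun n => ?_
    rw [sqNorm_const_mul]; ring

lemma Replaceable.add {ρ : unitInterval} {V V' : ℕ → ℝ → Config → ℝ} (h : Replaceable ρ V)
    (h' : Replaceable ρ V') : Replaceable ρ fun n ε ζ => V n ε ζ + V' n ε ζ := by
  obtain ⟨C₀, hC₀, h⟩ := h
  obtain ⟨C₀', hC₀', h'⟩ := h'
  refine ⟨2 * C₀ + 2 * C₀', by positivity, fun ε hε hε1 => ?_⟩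
  obtain ⟨W, U, b, hev, hlim⟩ := h ε hε hε1
  obtain ⟨W', U', b', hev', hlim'⟩ := h' ε hε hε1
  refine ⟨fun n ζ => W n ζ + W' n ζ, fun n ζ => U n ζ + U' n ζ, fun n => b n + b' n, ?_, ?_⟩
  · filter_upwards [hev, hev'] with n hn hn'
    obtain ⟨hW, hU, hb, hV, hbn⟩ := hn
    obtain ⟨hW', hU', hb', hV', hbn'⟩ := hn'
    refine ⟨hW.add hW', hU.add hU', hb.add hW hW' hb', fun ζ => by rw [hV, hV']; ring, ?_⟩
    have h1 : (b n + b' n) ^ 2 / (n : ℝ) ≤ (2 * b n ^ 2 + 2 * b' n ^ 2) / n :=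
      div_le_div_of_nonneg_right (by nlinarith [sq_nonneg (b n - b' n)]) (Nat.cast_nonneg n)
    rw [add_div, mul_div_assoc, mul_div_assoc] at h1
    linarith
  · have h1 := (hlim.const_mul 2).add (hlim'.const_mul 2)
    simp only [mul_zero, add_zero] at h1
    refine squeeze_zero' (Eventually.of_forall fun n =>
      mul_nonneg (Nat.cast_nonneg n) (sqNorm_nonneg _ _)) ?_ h1
    filter_upwards [hev, hev'] with n hn hn'
    have := mul_le_mul_of_nonneg_left (sqNorm_add_le ρ hn.2.1 hn'.2.1) (Nat.cast_nonneg (α := ℝ) n)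
    linarith

lemma Replaceable.finsetSum {ρ : unitInterval} {ι : Type*} (s : Finset ι)
    {V : ι → ℕ → ℝ → Config → ℝ} (h : ∀ i ∈ s, Replaceable ρ (V i)) :
    Replaceable ρ fun n ε ζ => ∑ i ∈ s, V i n ε ζ := by
  classical
  induction s using Finset.induction_on with
  | empty => simpa using Replaceable.zero ρ
  | insert a s ha ih =>
    simp only [Finset.sum_insert ha]
    exact (h a (by simp)).add (ih fun i hi => h i (by simp [hi]))

lemma sum_mul_sub_mul {ι : Type*} (s : Finset ι) (w b : ι → ℝ) (a g : ℝ) :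
    ∑ i ∈ s, w i * ((a - b i) * g) = (∑ i ∈ s, w i) * (a * g) - (∑ i ∈ s, w i * b i) * g := by
  rw [Finset.sum_mul, Finset.sum_mul, ← Finset.sum_sub_distrib]
  exact Finset.sum_congr rfl fun i _ => by ring

/-- Monomials of degree at least two are negligible: the leftmost and the rightmost factor are
replaced by their averages over `ε n` sites to the left and to the right. The product of the two
averages is of order `1 / (ε n)` in `L²(ν_ρ)`. -/
lemma replaceable_monomial_of_two_le (ρ : unitInterval) {B : Finset ℤ} (hB : 2 ≤ B.card) :
    Replaceable ρ fun _ _ ζ => monomial ρ B ζ := by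
  have hne : B.Nonempty := Finset.card_pos.1 (by omega)
  obtain ⟨p, q, hpB, hqB, hpq, hmin, hmax⟩ : ∃ p q, p ∈ B ∧ q ∈ B ∧ p < q ∧ (∀ z ∈ B, p ≤ z) ∧
      ∀ z ∈ B, z ≤ q :=
    ⟨B.min' hne, B.max' hne, B.min'_mem hne, B.max'_mem hne,
      Finset.min'_lt_max'_of_card B (by omega), fun z hz => B.min'_le z hz,
      fun z hz => B.le_max' z hz⟩
  set A := (B.erase p).erase q with hA
  have hAp : ∀ z ∈ A, p < z := fun z hz => by
    have h1 := Finset.mem_of_mem_erase hz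
    exact lt_of_le_of_ne (hmin z (Finset.mem_of_mem_erase h1)) (Finset.ne_of_mem_erase h1).symm
  have hAq : ∀ z ∈ A, z < q := fun z hz => by
    have h1 := Finset.mem_of_mem_erase hz
    exact lt_of_le_of_ne (hmax z (Finset.mem_of_mem_erase h1)) (Finset.ne_of_mem_erase hz)
  have hins : ∀ a b : ℤ, a ≤ p → q ≤ b → ∀ ζ, monomial ρ (insert a (insert b A)) ζ
      = (occ ζ a - ρ) * ((occ ζ b - ρ) * monomial ρ A ζ) := fun a b ha hb ζ => by
    have hbA : b ∉ A := fun h => absurd (hAq b h) (by omega)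
    have haA : a ∉ insert b A := by
      rw [Finset.mem_insert, not_or]
      exact ⟨by omega, fun h => absurd (hAp a h) (by omega)⟩
    rw [monomial, Finset.prod_insert haA, Finset.prod_insert hbA, monomial]
  have hBeq : ∀ ζ, monomial ρ B ζ = (occ ζ p - ρ) * ((occ ζ q - ρ) * monomial ρ A ζ) := fun ζ => by
    rw [← hins p q le_rfl le_rfl ζ, hA, Finset.insert_erase, Finset.insert_erase hpB]
    exact Finset.mem_erase.2 ⟨hpq.ne', hqB⟩
  refine ⟨8, by norm_num, fun ε hε _ => ?_⟩
  set ℓ : ℕ → ℕ := fun n => ⌈ε * n⌉₊ with hℓ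
  set avL : ℕ → Config → ℝ := fun n ζ =>
    ∑ j ∈ Finset.range (ℓ n), (ℓ n : ℝ)⁻¹ * (occ ζ (p - j) - ρ) with havL
  set avR : ℕ → Config → ℝ := fun n ζ =>
    ∑ j ∈ Finset.range (ℓ n), (ℓ n : ℝ)⁻¹ * (occ ζ (q + j) - ρ) with havR
  have hlL : ∀ n, IsLocal (avL n) := fun n => isLocal_finsetSum _ fun j _ =>
    ((isLocal_occ _).sub (isLocal_const _)).const_mul _
  have hlA := isLocal_monomial (ρ : ℝ) A
  -- first the factor at `p` is replaced by its average, then the factor at `q`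
  refine ⟨fun n ζ =>
    (∑ j ∈ Finset.range (ℓ n), (ℓ n : ℝ)⁻¹ * (((occ ζ p - ρ) - (occ ζ (p - j) - ρ))
      * ((occ ζ q - ρ) * monomial ρ A ζ)))
    + ∑ j ∈ Finset.range (ℓ n), (ℓ n : ℝ)⁻¹ * (((occ ζ q - ρ) - (occ ζ (q + j) - ρ))
      * (avL n ζ * monomial ρ A ζ)),
    fun n ζ => ∑ ij ∈ Finset.range (ℓ n) ×ˢ Finset.range (ℓ n), ((ℓ n : ℝ)⁻¹ ^ 2)
      * monomial ρ (insert (p - (ij.1 : ℤ)) (insert (q + (ij.2 : ℤ)) A)) ζ,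
    fun n => √(ℓ n) + √(ℓ n), ?_, ?_⟩
  · filter_upwards [eventually_ge_atTop 1, eventually_ge_atTop ⌈1 / ε⌉₊] with n hn hn'
    have hn0 : (0 : ℝ) < n := by exact_mod_cast hn
    have hℓ0 : 0 < ℓ n := Nat.ceil_pos.2 (by positivity)
    have hℓ0' : (0 : ℝ) < ℓ n := by exact_mod_cast hℓ0
    have hsum : ∑ _j ∈ Finset.range (ℓ n), (ℓ n : ℝ)⁻¹ = 1 := by
      rw [Finset.sum_const, Finset.card_range, nsmul_eq_mul, mul_inv_cancel₀ hℓ0'.ne']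
    have hgR : IsLocal fun ζ => (occ ζ q - ρ) * monomial ρ A ζ :=
      ((isLocal_occ q).sub (isLocal_const _)).mul hlA
    have hgL : IsLocal fun ζ => avL n ζ * monomial ρ A ζ := (hlL n).mul hlA
    have hW1 : IsLocal fun ζ => ∑ j ∈ Finset.range (ℓ n), (ℓ n : ℝ)⁻¹ *
        (((occ ζ p - ρ) - (occ ζ (p - j) - ρ)) * ((occ ζ q - ρ) * monomial ρ A ζ)) :=
      isLocal_finsetSum _ fun j _ => ((((isLocal_occ _).sub (isLocal_const _)).sub
        ((isLocal_occ _).sub (isLocal_const _))).mul hgR).const_mul _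
    have hW2 : IsLocal fun ζ => ∑ j ∈ Finset.range (ℓ n), (ℓ n : ℝ)⁻¹ *
        (((occ ζ q - ρ) - (occ ζ (q + j) - ρ)) * (avL n ζ * monomial ρ A ζ)) :=
      isLocal_finsetSum _ fun j _ => ((((isLocal_occ _).sub (isLocal_const _)).sub
        ((isLocal_occ _).sub (isLocal_const _))).mul hgL).const_mul _
    have hswap : ∀ j z : ℤ, z ≠ j → z ≠ j + 1 → ∀ ζ, occ (swapAt j ζ) z = occ ζ z :=
      fun j z h1 h2 ζ => by simp only [occ, swapAt, Equiv.swap_apply_of_ne_of_ne h1 h2]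
    have hb1 := hMinusOneBound_average ρ (Finset.range (ℓ n)) p (fun j => p - (j : ℤ))
      (w := fun _ => (ℓ n : ℝ)⁻¹) (fun _ _ => by positivity) (D := ℓ n)
      (fun j hj _ => by
        have : (j : ℝ) ≤ ℓ n := by exact_mod_cast (Finset.mem_range.1 hj).le
        push_cast
        rw [sub_sub_cancel, abs_of_nonneg (Nat.cast_nonneg j)]
        exact this) hgR
      (fun ζ => by
        rw [abs_mul]
        exact mul_le_one₀ (abs_occ_sub_le ρ ζ q) (abs_nonneg _) (abs_monomial_le ρ A ζ))
      (fun i _ j _ hj ζ => by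
        rw [max_eq_left (by omega)] at hj
        rw [hswap j q (by omega) (by omega), monomial_swapAt _ (fun h => absurd (hAp j h)
          (by omega)) (fun h => absurd (hAp _ h) (by omega))])
    have hb2 := hMinusOneBound_average ρ (Finset.range (ℓ n)) q (fun j => q + (j : ℤ))
      (w := fun _ => (ℓ n : ℝ)⁻¹) (fun _ _ => by positivity) (D := ℓ n)
      (fun j hj _ => by
        have : (j : ℝ) ≤ ℓ n := by exact_mod_cast (Finset.mem_range.1 hj).le
        push_cast
        rw [sub_add_cancel_left, abs_neg, abs_of_nonneg (Nat.cast_nonneg j)]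
        exact this) hgL
      (fun ζ => by
        rw [abs_mul]
        refine mul_le_one₀ ?_ (abs_nonneg _) (abs_monomial_le ρ A ζ)
        rw [← hsum]
        refine (Finset.abs_sum_le_sum_abs _ _).trans (Finset.sum_le_sum fun j _ => ?_)
        rw [abs_mul, abs_of_nonneg (by positivity : 0 ≤ (ℓ n : ℝ)⁻¹)]
        exact mul_le_of_le_one_right (by positivity) (abs_occ_sub_le ρ ζ _))
      (fun i _ j hj _ ζ => by
        rw [min_eq_left (by omega)] at hj
        rw [monomial_swapAt _ (fun h => absurd (hAq j h) (by omega))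
          (fun h => absurd (hAq _ h) (by omega))]
        congr 1
        exact Finset.sum_congr rfl fun i _ => by
          rw [hswap j _ (by omega) (by omega)])
    rw [hsum, one_mul] at hb1 hb2
    refine ⟨hW1.add hW2, isLocal_finsetSum _ fun ij _ => (isLocal_monomial _ _).const_mul _,
      hb1.add hW1 hW2 hb2, fun ζ => ?_, ?_⟩
    · have e1 : ∑ j ∈ Finset.range (ℓ n), (ℓ n : ℝ)⁻¹ *
          (((occ ζ p - ρ) - (occ ζ (p - j) - ρ)) * ((occ ζ q - ρ) * monomial ρ A ζ))
          = (occ ζ p - ρ) * ((occ ζ q - ρ) * monomial ρ A ζ)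
            - avL n ζ * ((occ ζ q - ρ) * monomial ρ A ζ) := by
        rw [sum_mul_sub_mul, hsum, one_mul]
      have e2 : ∑ j ∈ Finset.range (ℓ n), (ℓ n : ℝ)⁻¹ *
          (((occ ζ q - ρ) - (occ ζ (q + j) - ρ)) * (avL n ζ * monomial ρ A ζ))
          = (occ ζ q - ρ) * (avL n ζ * monomial ρ A ζ)
            - avR n ζ * (avL n ζ * monomial ρ A ζ) := by
        rw [sum_mul_sub_mul, hsum, one_mul]
      have e3 : ∑ ij ∈ Finset.range (ℓ n) ×ˢ Finset.range (ℓ n), ((ℓ n : ℝ)⁻¹ ^ 2)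
          * monomial ρ (insert (p - (ij.1 : ℤ)) (insert (q + (ij.2 : ℤ)) A)) ζ
          = avL n ζ * avR n ζ * monomial ρ A ζ := by
        rw [havL, havR]
        simp only
        rw [Finset.sum_mul_sum, Finset.sum_product, Finset.sum_mul]
        refine Finset.sum_congr rfl fun i _ => ?_
        rw [Finset.sum_mul]
        refine Finset.sum_congr rfl fun j _ => ?_
        rw [hins _ _ (by omega) (by omega)]
        ring
      rw [hBeq, e1, e2, e3]
      ring
    · have h1 : (ℓ n : ℝ) ≤ ε * n + 1 := (Nat.ceil_lt_add_one (by positivity)).le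
      have h2 : 1 ≤ ε * n := by
        have h3 : 1 / ε ≤ n := (Nat.le_ceil _).trans (by exact_mod_cast hn')
        rwa [div_le_iff₀ hε, mul_comm] at h3
      rw [div_le_iff₀ hn0, ← two_mul, mul_pow, Real.sq_sqrt hℓ0'.le]
      linarith
  · have hlim : Tendsto (fun n : ℕ => (1 / ε ^ 2) * (1 / (n : ℝ))) atTop (𝓝 ((1 / ε ^ 2) * 0)) :=
      tendsto_one_div_atTop_nhds_zero_nat.const_mul _
    rw [mul_zero] at hlim
    refine squeeze_zero' (Eventually.of_forall fun n =>
      mul_nonneg (Nat.cast_nonneg n) (sqNorm_nonneg _ _)) ?_ hlim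
    filter_upwards [eventually_ge_atTop 1] with n hn
    have hn0 : (0 : ℝ) < n := by exact_mod_cast hn
    have hℓ1 : ε * n ≤ ℓ n := Nat.le_ceil _
    have hℓ0' : (0 : ℝ) < ℓ n := lt_of_lt_of_le (by positivity) hℓ1
    have h1 := sqNorm_sum_monomial_le ρ (Finset.range (ℓ n) ×ˢ Finset.range (ℓ n))
      (B := fun ij => insert (p - (ij.1 : ℤ)) (insert (q + (ij.2 : ℤ)) A)) (fun i _ j _ hij => by
        simp only at hij
        have h2 : p - (i.1 : ℤ) ∈ insert (p - (j.1 : ℤ)) (insert (q + (j.2 : ℤ)) A) :=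
          hij ▸ Finset.mem_insert_self _ _
        have h3 : q + (i.2 : ℤ) ∈ insert (p - (j.1 : ℤ)) (insert (q + (j.2 : ℤ)) A) :=
          hij ▸ Finset.mem_insert_of_mem (Finset.mem_insert_self _ _)
        simp only [Finset.mem_insert] at h2 h3
        have h4 : p - (i.1 : ℤ) = p - (j.1 : ℤ) := by
          rcases h2 with h | h | h
          · exact h
          · omega
          · exact absurd (hAp _ h) (by omega)
        have h5 : q + (i.2 : ℤ) = q + (j.2 : ℤ) := by
          rcases h3 with h | h | h
          · omega
          · exact h
          · exact absurd (hAq _ h) (by omega)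
        exact Prod.ext (by omega) (by omega)) ((ℓ n : ℝ)⁻¹ ^ 2)
    rw [Finset.card_product, Finset.card_range] at h1
    have h2 : ((ℓ n : ℝ)⁻¹ ^ 2) ^ 2 * ((ℓ n * ℓ n : ℕ) : ℝ) = 1 / (ℓ n : ℝ) ^ 2 := by
      push_cast; field_simp
    rw [h2] at h1
    have h3 : 1 / (ℓ n : ℝ) ^ 2 ≤ 1 / (ε * n) ^ 2 :=
      one_div_le_one_div_of_le (by positivity) (pow_le_pow_left₀ (by positivity) hℓ1 2)
    calc (n : ℝ) * _ ≤ n * (1 / (ε * n) ^ 2) :=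
          mul_le_mul_of_nonneg_left (h1.trans h3) hn0.le
      _ = (1 / ε ^ 2) * (1 / (n : ℝ)) := by field_simp

/-! ### Riemann sums of the mollifier -/

lemma abs_integral_sub_riemannSum_le {ψ : ℝ → ℝ} {L : ℝ≥0} (hψ : LipschitzWith L ψ) {n : ℕ}
    (hn : 1 ≤ n) :
    |(∫ u in (0 : ℝ)..1, ψ u) - ∑ k ∈ Finset.range n, ψ (k / n) / n| ≤ L / n := by
  have hn0 : (0 : ℝ) < n := by exact_mod_cast hn
  have hint : ∀ a b : ℝ, IntervalIntegrable ψ volume a b :=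
    fun a b => hψ.continuous.intervalIntegrable a b
  have h1 : ∑ k ∈ Finset.range n, (∫ u in ((k : ℕ) / n : ℝ)..(((k + 1 : ℕ) : ℝ) / n), ψ u)
      = ∫ u in (0 : ℝ)..1, ψ u := by
    rw [intervalIntegral.sum_integral_adjacent_intervals (a := fun k : ℕ => (k : ℝ) / n)
      fun _ _ => hint _ _]
    simp [hn0.ne']
  have hlen : ∀ k : ℕ, ((k + 1 : ℕ) : ℝ) / n - k / n = 1 / n := fun k => by
    push_cast; ring
  have h2 : ∀ k ∈ Finset.range n,
      |(∫ u in ((k : ℕ) / n : ℝ)..(((k + 1 : ℕ) : ℝ) / n), ψ u) - ψ (k / n) / n|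
        ≤ L / n * (1 / n) := fun k _ => by
    have h3 : ψ (k / n) / n = ∫ _ in ((k : ℕ) / n : ℝ)..(((k + 1 : ℕ) : ℝ) / n), ψ (k / n) := by
      rw [intervalIntegral.integral_const, hlen, smul_eq_mul]; ring
    rw [h3, ← intervalIntegral.integral_sub (hint _ _) intervalIntegrable_const]
    have hle : (k : ℝ) / n ≤ ((k + 1 : ℕ) : ℝ) / n := by
      have := hlen k
      have : 0 < 1 / (n : ℝ) := by positivity
      linarith
    have h4 := intervalIntegral.norm_integral_le_of_norm_le_const (a := (k : ℝ) / n)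
      (b := ((k + 1 : ℕ) : ℝ) / n) (f := fun u => ψ u - ψ (k / n)) (C := L / n) fun u hu => by
        rw [Set.uIoc_of_le hle] at hu
        rw [← dist_eq_norm]
        refine (hψ.dist_le_mul _ _).trans ?_
        rw [div_eq_mul_one_div (L : ℝ)]
        refine mul_le_mul_of_nonneg_left ?_ L.2
        rw [Real.dist_eq, abs_of_nonneg (by linarith [hu.1])]
        have := hlen k
        linarith [hu.2]
    rwa [hlen, Real.norm_eq_abs, abs_of_pos (by positivity : 0 < 1 / (n : ℝ))] at h4
  rw [← h1, ← Finset.sum_sub_distrib]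
  refine (Finset.abs_sum_le_sum_abs _ _).trans ((Finset.sum_le_sum h2).trans_eq ?_)
  rw [Finset.sum_const, Finset.card_range, nsmul_eq_mul]
  field_simp

lemma IsMollifier.eq_zero {χ : ℝ → ℝ} (hχ : IsMollifier χ) {u : ℝ} (hu : ¬(0 < u ∧ u < 1)) :
    χ u = 0 :=
  image_eq_zero_of_notMem_tsupport fun h => hu (hχ.tsupport_subset h)

lemma IsMollifier.rescale_eq_zero {χ : ℝ → ℝ} (hχ : IsMollifier χ) {ε : ℝ} (hε : 0 < ε) {u : ℝ}
    (hu : ¬(0 < u ∧ u < ε)) : rescale χ ε u = 0 := by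
  rw [rescale, hχ.eq_zero, mul_zero]
  rwa [div_lt_one hε, div_pos_iff_of_pos_right hε]

lemma IsMollifier.exists_lipschitzWith_rescale {χ : ℝ → ℝ} (hχ : IsMollifier χ) (ε : ℝ) :
    ∃ L, LipschitzWith L (rescale χ ε) := by
  obtain ⟨L, hL⟩ := hχ.smooth.lipschitzWith_of_hasCompactSupport hχ.hasCompactSupport (by simp)
  have h1 : LipschitzWith ‖ε⁻¹‖₊ fun u : ℝ => u / ε := LipschitzWith.of_dist_le_mul fun u v => by
    rw [Real.dist_eq, Real.dist_eq, coe_nnnorm, Real.norm_eq_abs, ← sub_div, div_eq_inv_mul,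
      abs_mul]
  refine ⟨_, LipschitzWith.of_dist_le_mul (K := ‖ε⁻¹‖₊ * (L * ‖ε⁻¹‖₊)) fun u v => ?_⟩
  have h2 := (hL.comp h1).dist_le_mul u v
  rw [Real.dist_eq, rescale, rescale, ← mul_sub, abs_mul, NNReal.coe_mul, mul_assoc, coe_nnnorm,
    Real.norm_eq_abs]
  exact mul_le_mul_of_nonneg_left h2 (abs_nonneg _)

lemma IsMollifier.integral_rescale {χ : ℝ → ℝ} (hχ : IsMollifier χ) {ε : ℝ} (hε : 0 < ε)
    (hε1 : ε ≤ 1) : ∫ u in (0 : ℝ)..1, rescale χ ε u = 1 := by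
  rw [intervalIntegral.integral_of_le zero_le_one,
    setIntegral_eq_integral_of_forall_compl_eq_zero (f := rescale χ ε) fun u hu =>
      hχ.rescale_eq_zero hε fun h => hu (Set.mem_Ioc.2 ⟨h.1, (h.2.trans_le hε1).le⟩)]
  simp only [rescale]
  rw [integral_const_mul, Measure.integral_comp_div, hχ.integral_eq_one, abs_of_pos hε,
    smul_eq_mul, mul_one, inv_mul_cancel₀ hε.ne']

/-- The weight `n⁻¹ χ_ε(k / n)` that the discrete convolution at the origin gives to the site
`k`. -/
def kernelWeight (χ : ℝ → ℝ) (ε : ℝ) (n k : ℕ) : ℝ := rescale χ ε (k / n) / n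

lemma IsMollifier.convolve_rescale {χ : ℝ → ℝ} (hχ : IsMollifier χ) {ε : ℝ} (hε : 0 < ε)
    (hε1 : ε ≤ 1) {n : ℕ} (hn : 1 ≤ n) (ρ : ℝ) (ζ : Config) :
    convolve ρ n ζ (rescale χ ε) 0
      = ∑ k ∈ Finset.range n, kernelWeight χ ε n k * (occ ζ k - ρ) := by
  have hn0 : (0 : ℝ) < n := by exact_mod_cast hn
  have h := tsum_eq_sum (L := .unconditional ℤ) (s := (Finset.range n).map Nat.castEmbedding)
    (f := fun y : ℤ => rescale χ ε ((y : ℝ) / n) * (occ ζ (0 + y) - ρ)) (fun y hy => by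
      rw [hχ.rescale_eq_zero hε, zero_mul]
      rintro ⟨h0, h1⟩
      rw [div_pos_iff_of_pos_right hn0] at h0
      have h2 : (y : ℝ) < n := by
        have := h1.trans_le hε1
        rwa [div_lt_one hn0] at this
      have h0' : 0 < y := by exact_mod_cast h0
      have h2' : y < n := by exact_mod_cast h2
      refine hy (Finset.mem_map.2 ⟨y.toNat, Finset.mem_range.2 (by omega), ?_⟩)
      simp only [Nat.castEmbedding_apply]
      omega)
  rw [convolve, h, Finset.sum_map, Finset.mul_sum]
  refine Finset.sum_congr rfl fun k _ => ?_
  simp only [Nat.castEmbedding_apply, Int.cast_natCast, zero_add, kernelWeight]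
  ring

/-! ### Replacement of local functions -/

/-- Monomials of degree one are replaced by moving the particle from `x` to a site chosen with the
weights of the convolution kernel; the weights sum to `1` up to an error of order `1 / n`. -/
lemma replaceable_occ_sub_convolve (ρ : unitInterval) {χ : ℝ → ℝ} (hχ : IsMollifier χ) (x : ℤ) :
    Replaceable ρ fun n ε ζ => (occ ζ x - ρ) - convolve ρ n ζ (rescale χ ε) 0 := by
  refine ⟨8, by norm_num, fun ε hε hε1 => ?_⟩
  obtain ⟨L, hL⟩ := hχ.exists_lipschitzWith_rescale ε
  obtain ⟨T, hT⟩ : ∃ T : ℕ → ℝ, T = fun n => ∑ k ∈ Finset.range n, kernelWeight χ ε n k :=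
    ⟨_, rfl⟩
  have hTn : ∀ n, 1 ≤ n → |1 - T n| ≤ L / n := fun n hn => by
    have h := abs_integral_sub_riemannSum_le hL hn
    rw [hχ.integral_rescale hε hε1] at h
    rw [hT]
    exact h
  have hw0 : ∀ n k, 0 ≤ kernelWeight χ ε n k := fun n k =>
    div_nonneg (mul_nonneg (inv_nonneg.2 hε.le) (hχ.nonneg _)) (Nat.cast_nonneg n)
  refine ⟨fun n ζ => ∑ k ∈ Finset.range n, kernelWeight χ ε n k
      * (((occ ζ x - ρ) - (occ ζ ((fun k : ℕ => (k : ℤ)) k) - ρ)) * 1),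
    fun n ζ => (1 - T n) * monomial ρ {x} ζ, fun n => T n * √(ε * n + |(x : ℝ)|), ?_, ?_⟩
  · filter_upwards [eventually_ge_atTop 1, eventually_ge_atTop ⌈(L : ℝ)⌉₊,
      eventually_ge_atTop ⌈|(x : ℝ)| / ε⌉₊] with n hn hnL hnx
    have hn0 : (0 : ℝ) < n := by exact_mod_cast hn
    refine ⟨isLocal_finsetSum _ fun k _ => ((((isLocal_occ _).sub (isLocal_const _)).sub
      ((isLocal_occ _).sub (isLocal_const _))).mul (isLocal_const 1)).const_mul _,
      (isLocal_monomial _ _).const_mul _, ?_, fun ζ => ?_, ?_⟩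
    · simp only [hT]
      refine hMinusOneBound_average ρ (Finset.range n) x (fun k : ℕ => (k : ℤ))
        (fun k _ => hw0 n k) (D := ε * n + |(x : ℝ)|) (fun k _ hk => ?_) (isLocal_const 1)
        (fun _ => by simp) fun _ _ _ _ _ _ => rfl
      have hk' : (k : ℝ) < ε * n := by
        by_contra hcon
        refine hk ?_
        rw [kernelWeight, hχ.rescale_eq_zero hε, zero_div]
        rintro ⟨-, h⟩
        exact hcon ((div_lt_iff₀ hn0).1 h)
      push_cast
      refine (abs_sub _ _).trans ?_
      rw [abs_of_nonneg (Nat.cast_nonneg k : (0 : ℝ) ≤ k)]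
      linarith
    · have h1 := sum_mul_sub_mul (Finset.range n) (kernelWeight χ ε n)
        (fun k => occ ζ k - ρ) (occ ζ x - ρ) 1
      rw [h1, hχ.convolve_rescale hε hε1 hn, hT]
      simp only [monomial, Finset.prod_singleton]
      ring
    · have hL1 : (L : ℝ) / n ≤ 1 := by
        rw [div_le_one hn0]
        exact (Nat.le_ceil _).trans (by exact_mod_cast hnL)
      have hx1 : |(x : ℝ)| ≤ ε * n := by
        have h : |(x : ℝ)| / ε ≤ n := (Nat.le_ceil _).trans (by exact_mod_cast hnx)
        rwa [div_le_iff₀ hε, mul_comm] at h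
      have hT0 : 0 ≤ T n := by
        rw [hT]; exact Finset.sum_nonneg fun k _ => hw0 n k
      have hT2 : T n ≤ 2 := by
        have := (abs_le.1 ((hTn n hn).trans hL1)).1
        linarith
      rw [div_le_iff₀ hn0, mul_pow, Real.sq_sqrt (by positivity)]
      have h4 : T n ^ 2 ≤ 4 := by nlinarith
      calc T n ^ 2 * (ε * n + |(x : ℝ)|) ≤ 4 * (2 * (ε * n)) :=
            mul_le_mul h4 (by linarith) (by positivity) (by norm_num)
        _ = 8 * ε * n := by ring
  · have hlim : Tendsto (fun n : ℕ => (L : ℝ) ^ 2 * (1 / (n : ℝ))) atTop (𝓝 ((L : ℝ) ^ 2 * 0)) :=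
      tendsto_one_div_atTop_nhds_zero_nat.const_mul _
    rw [mul_zero] at hlim
    refine squeeze_zero' (Eventually.of_forall fun n =>
      mul_nonneg (Nat.cast_nonneg n) (sqNorm_nonneg _ _)) ?_ hlim
    filter_upwards [eventually_ge_atTop 1] with n hn
    have hn0 : (0 : ℝ) < n := by exact_mod_cast hn
    rw [sqNorm_const_mul]
    have h1 : (1 - T n) ^ 2 ≤ (L / n) ^ 2 := by
      rw [← sq_abs]
      exact pow_le_pow_left₀ (abs_nonneg _) (hTn n hn) 2
    calc (n : ℝ) * ((1 - T n) ^ 2 * sqNorm ρ (monomial ρ {x})) ≤ n * ((L / n) ^ 2 * 1) :=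
          mul_le_mul_of_nonneg_left (mul_le_mul h1 (sqNorm_monomial_le ρ _) (sqNorm_nonneg _ _)
            (sq_nonneg _)) hn0.le
      _ = (L : ℝ) ^ 2 * (1 / (n : ℝ)) := by field_simp

/-- Here `p ↦ (p - ρ) ^ |B|` is the mean of the monomial under `ν_p`; the two indicators are its
value and its derivative at `ρ`. -/
lemma replaceable_monomial_sub (ρ : unitInterval) {χ : ℝ → ℝ} (hχ : IsMollifier χ)
    (B : Finset ℤ) :
    Replaceable ρ fun n ε ζ => monomial ρ B ζ - (if B.card = 0 then 1 else 0)
      - (if B.card = 1 then 1 else 0) * convolve ρ n ζ (rescale χ ε) 0 := by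
  obtain h0 | h1 | h2 : B.card = 0 ∨ B.card = 1 ∨ 2 ≤ B.card := by omega
  · rw [Finset.card_eq_zero] at h0
    subst h0
    simpa [monomial] using Replaceable.zero ρ
  · obtain ⟨x, rfl⟩ := Finset.card_eq_one.1 h1
    simpa [monomial] using replaceable_occ_sub_convolve ρ hχ x
  · simpa [show B.card ≠ 0 by omega, show B.card ≠ 1 by omega]
      using replaceable_monomial_of_two_le ρ h2

/-- Differentiability of the mean of a local function at the density `ρ`, and the decomposition of
the remainder in its first-order replacement. -/
theorem IsLocal.differentiableAt_meanUnder_and_replaceable {φ : Config → ℝ} (hφ : IsLocal φ)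
    {ρ : unitInterval} (hρ0 : 0 < (ρ : ℝ)) (hρ1 : (ρ : ℝ) < 1) {χ : ℝ → ℝ} (hχ : IsMollifier χ) :
    DifferentiableAt ℝ (meanUnder φ) (ρ : ℝ) ∧
      Replaceable ρ fun n ε ζ => φ ζ - meanUnder φ ρ
        - deriv (meanUnder φ) ρ * convolve ρ n ζ (rescale χ ε) 0 := by
  obtain ⟨Λ, hΛ⟩ := hφ.exists_finset
  obtain ⟨a, ha⟩ := hΛ.exists_eq_sum_monomial (ρ : ℝ)
  have hmean : meanUnder φ = fun p => ∑ B ∈ Λ.powerset, a B * meanUnder (monomial ρ B) p := by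
    funext p
    simp only [meanUnder, ha]
    rw [integral_finsetSum _ fun B _ => ((isLocal_monomial (ρ : ℝ) B).const_mul (a B)).integrable _]
    exact Finset.sum_congr rfl fun B _ => integral_const_mul _ _
  have hderiv : HasDerivAt (meanUnder φ)
      (∑ B ∈ Λ.powerset, a B * if B.card = 1 then 1 else 0) (ρ : ℝ) := by
    rw [hmean]
    exact HasDerivAt.fun_sum fun B _ => (hasDerivAt_meanUnder_monomial hρ0 hρ1 B).const_mul (a B)
  refine ⟨hderiv.differentiableAt, ?_⟩
  have h := Replaceable.finsetSum Λ.powerset fun B _ =>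
    (replaceable_monomial_sub ρ hχ B).const_mul (a B)
  refine cast (congrArg (Replaceable ρ) ?_) h
  funext n ε ζ
  rw [hderiv.deriv, hmean, ha]
  simp only [meanUnder_monomial_self, mul_sub, Finset.sum_sub_distrib, Finset.sum_mul, mul_assoc]

/-! ### The limit of the probabilities -/

/-- The exponential estimate, used with a large `K`, makes the probability small once `ε` is small
and `n` is large. -/
theorem Replaceable.limsup_prob_eq_zero {c : Config → ℝ} (hc : IsExchangeRate c) {R : Finset ℤ}
    {r : ℤ → Config → ℝ} (hr : IsJumpRate R r) {ρ : unitInterval} (hρ0 : 0 < (ρ : ℝ))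
    (hρ1 : (ρ : ℝ) < 1) {S : ℕ → Type*} [∀ n, MeasurableSpace (S n)]
    (P : ∀ n, Measure (S n)) [∀ n, IsProbabilityMeasure (P n)]
    (η : ∀ n, ℝ≥0 → S n → Config) (x : ∀ n, ℝ≥0 → S n → ℤ)
    (h : ∀ n, 1 ≤ n → IsWalkInExclusion c R r ρ n (P n) (η n) (x n))
    {V : ℕ → ℝ → Config → ℝ} (hV : Replaceable ρ V) {δ : ℝ} (hδ : 0 < δ) {t : ℝ} (ht : 0 ≤ t) :
    limsup (fun ε : ℝ => limsup (fun n : ℕ =>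
      P n {ω | δ < |√(n : ℝ) * ∫ s in (0 : ℝ)..t, V n ε (envAt (η n) (x n) s ω)|})
        atTop) (𝓝[>] (0 : ℝ)) = 0 := by
  obtain ⟨ε₀, C, hε₀, hC, hE⟩ := exists_energy_estimate ρ hc hr
  obtain ⟨C₀, hC₀, hV⟩ := hV
  refine le_antisymm (ENNReal.le_of_forall_pos_le_add fun κ hκ _ => ?_) bot_le
  rw [zero_add]
  have hκ2 : (0 : ℝ) < κ / 4 := by positivity
  -- `K` is chosen so that the exponential bound is below `κ / 2`.
  obtain ⟨K, hK0, hK⟩ : ∃ K : ℝ, 0 ≤ K ∧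
      Real.exp (-(K * (δ / 2)) + (C + 1 + 1) * t) ≤ κ / 4 := by
    have hlim : Tendsto (fun K : ℝ => Real.exp (-(K * (δ / 2)) + (C + 1 + 1) * t)) atTop
        (𝓝 0) := by
      refine Real.tendsto_exp_atBot.comp (tendsto_atBot_add_const_right _ _ ?_)
      exact tendsto_neg_atTop_atBot.comp (tendsto_id.atTop_mul_const (half_pos hδ))
    obtain ⟨K, h1, h2⟩ := ((eventually_ge_atTop (0 : ℝ)).and
      (hlim.eventually (eventually_le_nhds hκ2))).exists
    exact ⟨K, h1, h2⟩
  have hsmall : ∀ᶠ ε : ℝ in 𝓝[>] (0 : ℝ), K ^ 2 * (C₀ * ε) / (4 * ε₀) ≤ 1 := by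
    have hcont : Continuous fun ε : ℝ => K ^ 2 * (C₀ * ε) / (4 * ε₀) := by fun_prop
    have hlim : Tendsto (fun ε : ℝ => K ^ 2 * (C₀ * ε) / (4 * ε₀)) (𝓝 0) (𝓝 0) := by
      simpa using hcont.tendsto 0
    exact (hlim.mono_left nhdsWithin_le_nhds).eventually (eventually_le_nhds one_pos)
  refine limsup_le_of_le (by isBoundedDefault) ?_
  filter_upwards [hsmall, Ioc_mem_nhdsGT (zero_lt_one (α := ℝ))] with ε hε hε1
  obtain ⟨W, U, b, hev, hlim⟩ := hV ε hε1.1 hε1.2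
  refine limsup_le_of_le (by isBoundedDefault) ?_
  have hlim' : Tendsto (fun n : ℕ => t * Real.exp ((C + 1) * t) / (δ / 2)
      * √(n * sqNorm ρ (U n))) atTop (𝓝 0) := by
    simpa using (hlim.sqrt).const_mul (t * Real.exp ((C + 1) * t) / (δ / 2))
  filter_upwards [hev, hlim'.eventually (eventually_le_nhds (half_pos (NNReal.coe_pos.2 hκ))),
    eventually_ge_atTop 1] with n hn hU hn1
  obtain ⟨hW, hU', hb, hVWU, hbn⟩ := hn
  have hP := prob_abs_integral_gt_le hρ0 hρ1 hc.finiteRange hr.isLocal hn1 hε₀ hC (hE n) (h n hn1)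
    hW hU' hVWU hb hK0 hδ ht
  have hexp : Real.exp (-(K * (δ / 2)) + (C + K ^ 2 * (b n ^ 2 / n) / (4 * ε₀) + 1) * t)
      ≤ κ / 4 := by
    refine (Real.exp_le_exp.2 ?_).trans hK
    have h1 : K ^ 2 * (b n ^ 2 / n) / (4 * ε₀) ≤ 1 :=
      (div_le_div_of_nonneg_right (mul_le_mul_of_nonneg_left hbn (sq_nonneg K))
        (by positivity)).trans hε
    have h2 := mul_le_mul_of_nonneg_right (by linarith :
      C + K ^ 2 * (b n ^ 2 / n) / (4 * ε₀) + 1 ≤ C + 1 + 1) ht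
    linarith
  rw [← ENNReal.ofReal_coe_nnreal, ← ENNReal.ofReal_toReal (measure_ne_top (P n) _)]
  refine ENNReal.ofReal_le_ofReal ?_
  change (P n).real _ ≤ _
  linarith

end

end ExclusionWalk

theorem mainTheorem4
    -- interaction rate of the lattice gas, jump rates of the walk, density
    (c : ExclusionWalk.Config → ℝ) (hc : ExclusionWalk.IsExchangeRate c)
    (R : Finset ℤ) (r : ℤ → ExclusionWalk.Config → ℝ) (hr : ExclusionWalk.IsJumpRate R r)
    (ρ : unitInterval) (hρ0 : 0 < (ρ : ℝ)) (hρ1 : (ρ : ℝ) < 1)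
    -- for each `n ≥ 1`, the lattice gas and the walk on some probability space
    {S : ℕ → Type*} [∀ n, MeasurableSpace (S n)]
    (P : ∀ n, Measure (S n)) [∀ n, IsProbabilityMeasure (P n)]
    (η : ∀ n, ℝ≥0 → S n → ExclusionWalk.Config) (x : ∀ n, ℝ≥0 → S n → ℤ)
    (hprocess : ∀ n, 1 ≤ n → ExclusionWalk.IsWalkInExclusion c R r ρ n (P n) (η n) (x n))
    -- the mollifier and the local function
    (χ : ℝ → ℝ) (hχ : ExclusionWalk.IsMollifier χ)
    (φ : ExclusionWalk.Config → ℝ) (hφ : ExclusionWalk.IsLocal φ) :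
    DifferentiableAt ℝ (ExclusionWalk.meanUnder φ) (ρ : ℝ) ∧
    ∀ (δ : ℝ), 0 < δ → ∀ t : ℝ≥0,
      limsup (fun ε : ℝ =>
        limsup (fun n : ℕ =>
          P n {ω | δ < |√(n : ℝ) * ∫ s in (0 : ℝ)..t,
            (φ (ExclusionWalk.environment (η n) (x n) s.toNNReal ω)
              - ExclusionWalk.meanUnder φ ρ
              - deriv (ExclusionWalk.meanUnder φ) ρ
                * ExclusionWalk.convolve ρ n
                    (ExclusionWalk.environment (η n) (x n) s.toNNReal ω)
                    (ExclusionWalk.rescale χ ε) 0)|})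
          atTop)
        (𝓝[>] (0 : ℝ)) = 0 := by
  obtain ⟨hdiff, hrepl⟩ := hφ.differentiableAt_meanUnder_and_replaceable hρ0 hρ1 hχ
  exact ⟨hdiff, fun δ hδ t => hrepl.limsup_prob_eq_zero hc hr hρ0 hρ1 P η x hprocess hδ t.2⟩
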